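/- Let $E\subset(0,\infty)$ be a set of parameters (for instance $E=(0,1)$). For every $\varepsilon\in E$ let $u^\varepsilon_{\rm in}\in H^2(\mathbb R)$, with $\tfrac12\|u^\varepsilon_{\rm in}\|_{L^2(\mathbb R)}^2\le c$ for a constant $c$ independent of $\varepsilon$, and let $u^\varepsilon:[0,\infty)\times\mathbb R\to\mathbb R$ be a weak solution of the viscoplastic Burgers equation $$\partial_t u^\varepsilon+\partial_x\frac{(u^\varepsilon)^2}{2}-\partial_x\big(R^\varepsilon+\varepsilon\,\partial_xu^\varepsilon\big)=0\ \text{ in }(0,\infty)\times\mathbb R,\qquad R^\varepsilon:=\frac{\partial_xu^\varepsilon}{\sqrt{|\partial_xu^\varepsilon|^2+\varepsilon^2}},\qquad \lim_{|x|\to\infty}u^\varepsilon(t,x)=0\ \ (t\ge 0),$$ with initial datum $u^\varepsilon_{\rm in}$; that is, $$\int_0^\infty\!\!\int_{\mathbb R}\Big(u^\varepsilon\partial_t\phi+\big(\tfrac{(u^\varepsilon)^2}{2}-\varepsilon\partial_xu^\varepsilon-R^\varepsilon\big)\partial_x\phi\Big)\,dx\,dt+\int_{\mathbb R}u^\varepsilon_{\rm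 in}\,\phi(0,\cdot)\,dx=0\qquad\text{for all }\phi\in C^1_c([0,\infty)\times\mathbb R),$$ and for all $T>0$, $u^\varepsilon\in L^\infty(0,T;H^2(\mathbb R))$ and $\partial_tu^\varepsilon\in L^\infty(0,T;L^2(\mathbb R))\cap L^2(0,T;H^1(\mathbb R))$. Here $u^\varepsilon$ denotes the representative that is continuous on $[0,\infty)\times\mathbb R$. Then the following holds. 1. Assume that $u^\varepsilon_{\rm in}\in L^\infty(\mathbb R)\cap L^1(\mathbb R)$ and $\underline u\le u^\varepsilon_{\rm in}\le\bar u$ a.e. in $\mathbb R$ for all $\varepsilon\in E$, with two constants $\underline u\le\bar u$ independent of $\varepsilon$. Then for all $\varepsilon\in E$ $$\|u^\varepsilon\|_{L^\infty(0,\infty;L^\infty(\mathbb R))}\le\max\{|\underline u|,|\bar u|\},\qquad \|u^\varepsilon\|_{L^\infty(0,\infty;L^1(\mathbb R))}\le\|u^\varepsilon_{\rm in}\|_{L^1(\mathbb R)}.$$ 2. For all $\varepsilon\in E$, $\ \|\partial_xu^\varepsilon\|_{L^\infty(0,\infty;L^1(\mathbb R))}\le\|\partial_xu^\varepsilon_{\rm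 in}\|_{L^1(\mathbb R)}$ (the right-hand side may be $\infty$). 3. For all $\varepsilon\in E$ and $t>0$ the function $u^\varepsilon(t,\cdot)$ is continuously differentiable, and $\partial_xu^\varepsilon(t,x)<\frac1t$ for all $x\in\mathbb R$. 4. Let $\partial_tu^\varepsilon_{\rm in}:=\partial_x\Big(-\frac{(u^\varepsilon_{\rm in})^2}{2}+\frac{\partial_xu^\varepsilon_{\rm in}}{\sqrt{|\partial_xu^\varepsilon_{\rm in}|^2+\varepsilon^2}}+\varepsilon\,\partial_xu^\varepsilon_{\rm in}\Big)$. If $\|\partial_tu^\varepsilon_{\rm in}\|_{L^1(\mathbb R)}\le C$ for all $\varepsilon\in E$, with a constant $C>0$ independent of $\varepsilon$, then $\|\partial_tu^\varepsilon\|_{L^\infty(0,\infty;L^1(\mathbb R))}\le C$ for all $\varepsilon\in E$. 5. Under the assumptions of 1, and if $\|\partial_xu^\varepsilon_{\rm in}\|_{L^1(\mathbb R)}\le K$ for all $\varepsilon\in E$ with a constant $K$ independent of $\varepsilon$, there is a constant $C>0$ such that $\big\|\partial_x\frac{(u^\varepsilon)^2}{2}\big\|_{L^\infty(0,\infty;L^1(\mathbb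 R))}\le C$ for all $\varepsilon\in E$. 6. Under the assumptions of 1 and 4 there is a constant $C>0$ such that $\|\partial_x(R^\varepsilon+\varepsilon\,\partial_xu^\varepsilon)\|_{L^\infty(0,\infty;L^1(\mathbb R))}\le C$ for all $\varepsilon\in E$. -/

import Mathlib

open MeasureTheory Set Filter Topology
open scoped ContDiff

noncomputable section

namespace Viscoplastic

/-- `g` is the weak derivative of `f` in direction `e` on the open set `Ω`: both functions are
locally integrable on `Ω`, and `∫_Ω f ∂_e φ = - ∫_Ω g φ` for all `φ ∈ C_c^∞(Ω)`. -/
def HasWeakDeriv {X : Type*} [NormedAddCommGroup X] [NormedSpace ℝ X] [MeasureSpace X]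
    (Ω : Set X) (e : X) (f g : X → ℝ) : Prop :=
  LocallyIntegrableOn f Ω volume ∧ LocallyIntegrableOn g Ω volume ∧
    ∀ φ : X → ℝ, ContDiff ℝ ∞ φ → HasCompactSupport φ → tsupport φ ⊆ Ω →
      ∫ z in Ω, f z * fderiv ℝ φ z e = - ∫ z in Ω, g z * φ z

/-- Weak derivative of a function of one real variable on the whole line. -/
abbrev HasWeakDerivLine (f g : ℝ → ℝ) : Prop := HasWeakDeriv univ (1 : ℝ) f g

/-- The open half plane `(0,∞) × ℝ` of points `(t, x)`. -/
def halfPlane : Set (ℝ × ℝ) := Ioi (0 : ℝ) ×ˢ (univ : Set ℝ)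

/-- `g = ∂_x f` weakly on `(0,∞) × ℝ`. -/
abbrev HasWeakDx (f g : ℝ × ℝ → ℝ) : Prop := HasWeakDeriv halfPlane ((0 : ℝ), (1 : ℝ)) f g

/-- `g = ∂_t f` weakly on `(0,∞) × ℝ`. -/
abbrev HasWeakDt (f g : ℝ × ℝ → ℝ) : Prop := HasWeakDeriv halfPlane ((1 : ℝ), (0 : ℝ)) f g

/-- The norm of `L^p(I; L^q(ℝ))`, with value `∞` where it is not finite. -/
def mixedNorm (p q : ENNReal) (I : Set ℝ) (f : ℝ × ℝ → ℝ) : ENNReal :=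
  eLpNorm (fun t : ℝ => eLpNorm (fun x : ℝ => f (t, x)) q volume) p (volume.restrict I)

/-- The Sobolev space `H²(ℝ)`. -/
def MemH2 (f : ℝ → ℝ) : Prop :=
  ∃ f₁ f₂ : ℝ → ℝ, HasWeakDerivLine f f₁ ∧ HasWeakDerivLine f₁ f₂ ∧
    MemLp f 2 volume ∧ MemLp f₁ 2 volume ∧ MemLp f₂ 2 volume

/-- The regularized stress `e / √(|e|² + ε²)`. -/
def stress (ε e : ℝ) : ℝ := e / Real.sqrt (|e| ^ 2 + ε ^ 2)

/-- `u` is a global weak solution, with the initial datum `uin` and parameter `ε`, of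
`∂_t u + ∂_x (u²/2) - ∂_x (∂_x u / √(|∂_x u|² + ε²)) - ε ∂_{xx} u = 0` in `(0,∞) × ℝ`,
with `u(t,x) → 0` as `|x| → ∞`, such that for all `T > 0`
`u ∈ L^∞(0,T; H²(ℝ))` and `∂_t u ∈ L^∞(0,T; L²(ℝ)) ∩ L²(0,T; H¹(ℝ))`.
The function is the continuous representative on `[0,∞) × ℝ`, which exists by this regularity. -/
structure IsSolution (ε : ℝ) (uin : ℝ → ℝ) (u : ℝ × ℝ → ℝ) : Prop where
  continuousOn : ContinuousOn u (Ici (0 : ℝ) ×ˢ (univ : Set ℝ))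
  far_field : ∀ t : ℝ, 0 ≤ t → Tendsto (fun x : ℝ => u (t, x)) (cocompact ℝ) (𝓝 0)
  regularity_and_weak_form : ∃ ux uxx ut utx : ℝ × ℝ → ℝ,
    HasWeakDx u ux ∧ HasWeakDx ux uxx ∧ HasWeakDt u ut ∧ HasWeakDx ut utx ∧
    (∀ T : ℝ, 0 < T →
      mixedNorm ⊤ 2 (Ioo 0 T) u < ⊤ ∧ mixedNorm ⊤ 2 (Ioo 0 T) ux < ⊤ ∧
      mixedNorm ⊤ 2 (Ioo 0 T) uxx < ⊤ ∧
      mixedNorm ⊤ 2 (Ioo 0 T) ut < ⊤ ∧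
      mixedNorm 2 2 (Ioo 0 T) ut < ⊤ ∧ mixedNorm 2 2 (Ioo 0 T) utx < ⊤) ∧
    ∀ φ : ℝ × ℝ → ℝ, ContDiff ℝ 1 φ → HasCompactSupport φ →
      (∫ z in halfPlane,
          (u z * fderiv ℝ φ z (1, 0) +
            (u z ^ 2 / 2 - ε * ux z - stress ε (ux z)) * fderiv ℝ φ z (0, 1))) +
        ∫ x : ℝ, uin x * φ (0, x) = 0

/-- `w` is the time derivative at `t = 0` that the equation prescribes for the datum `uin`:
`w = ∂_x ( - uin²/2 + ∂_x uin / √(|∂_x uin|² + ε²) + ε ∂_x uin )` weakly. -/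
def IsInitialTimeDeriv (ε : ℝ) (uin w : ℝ → ℝ) : Prop :=
  ∃ d : ℝ → ℝ, HasWeakDerivLine uin d ∧
    HasWeakDerivLine (fun x => -(uin x ^ 2 / 2) + stress ε (d x) + ε * d x) w

/-- The family of data lies in `L¹(ℝ)`, with values a.e. in the interval `[lo, hi]`. -/
def DataBounds {ι : Type*} (uin : ι → ℝ → ℝ) (lo hi : ℝ) : Prop :=
  ∀ i : ι, MemLp (uin i) 1 volume ∧ ∀ᵐ x : ℝ, lo ≤ uin i x ∧ uin i x ≤ hi

/-- The initial time derivatives of the family are bounded by `C` in `L¹(ℝ)`. -/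
def DataTimeDerivBound {E : Set ℝ} (uin : E → ℝ → ℝ) (C : ℝ) : Prop :=
  ∀ ε : E, ∃ w : ℝ → ℝ, IsInitialTimeDeriv ε (uin ε) w ∧
    eLpNorm w 1 volume ≤ ENNReal.ofReal C

/-- The first spatial derivatives of the family are bounded by `K` in `L¹(ℝ)`. -/
def DataTotalVarBound {ι : Type*} (uin : ι → ℝ → ℝ) (K : ℝ) : Prop :=
  ∀ i : ι, ∃ d : ℝ → ℝ, HasWeakDerivLine (uin i) d ∧
    eLpNorm d 1 volume ≤ ENNReal.ofReal K

end Viscoplastic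

end

noncomputable section

namespace Viscoplastic

/-! ### Absolutely continuous functions of one variable -/

section

/-! Write v = ∂_x u, w = ∂_t u and P = flux(v) - u²/2, where flux(p) = stress(p) + εp is increasing
and vanishes at 0. The equation says w = ∂_x P. The regularity assumed makes u, v, w and P
absolutely continuous on almost every horizontal line, and u and a version of v absolutely
continuous on almost every vertical line (`Regular`). Every estimate is then an integration by parts
at a fixed time, where boundary terms vanish by integrability, followed by integration in time
(`energy_balance`).

The L¹ bounds come from contraction (`Evolution.l1_contraction`). For z = u₁ - u₂ one tests with a
regularized sign of z. Monotonicity of the flux gives the viscous term a good sign; the convective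
term carries a factor that is bounded and tends to 0 with the regularization. Comparison with 0
bounds u. Comparison with translates in x and t, divided by the step, bounds v and w through Fatou's
lemma. For w the increment over a short first time interval is also needed: it comes from comparing
u with its initial profile, regarded as a stationary evolution with a source equal to the initial
time derivative.

For the maximum principle, a convex function vanishing on [-M, M] has an integral along u that
cannot grow (`integral_comp_mul_nonpos`). For Oleinik's condition, m(t) = 1/(t + 1/K) solves m' =
-m² and starts at a bound K for |v| on a bounded time interval; the integral of ((v - m)₊)³ starts
at 0 and does not grow (`integral_pos_sq_mul_nonpos`). Hence v ≤ m < 1/t almost everywhere, and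
equicontinuity of v in x carries this to every t > 0 (`Regular.exists_deriv`).

The convective bound 5 is the product of the bounds for u and v. For the viscous term, ∂_x flux(v) =
w + uv, and the L¹ norm of uv is at most twice that of w (`integral_abs_mul_le`), with no bound on
the total variation of the datum. -/

/-- `F` is absolutely continuous between `a` and `b`, with derivative `f` almost everywhere. -/
def PrimOn (F f : ℝ → ℝ) (a b : ℝ) : Prop :=
  AbsolutelyContinuousOnInterval F a b ∧ ∀ᵐ x : ℝ, x ∈ uIcc a b → HasDerivAt F (f x) x

/-- `F` is locally absolutely continuous on the line, with derivative `f` almost everywhere. -/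
def Prim (F f : ℝ → ℝ) : Prop := ∀ a b : ℝ, PrimOn F f a b

theorem absolutelyContinuousOnInterval_congr {F G : ℝ → ℝ} {a b : ℝ}
    (hF : AbsolutelyContinuousOnInterval F a b) (h : EqOn F G (uIcc a b)) :
    AbsolutelyContinuousOnInterval G a b := by
  rw [absolutelyContinuousOnInterval_iff] at hF ⊢
  intro ε hε
  obtain ⟨δ, hδ, H⟩ := hF ε hε
  refine ⟨δ, hδ, fun E hE hl => ?_⟩
  have := H E hE hl
  rwa [Finset.sum_congr rfl fun i hi => by
    rw [← h (hE.1 i hi).1, ← h (hE.1 i hi).2]]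

/-- The range of F on the interval is bounded, and a C¹ function is Lipschitz on bounded intervals.
Dividing by K + 1 rather than K covers K = 0. -/
theorem AbsolutelyContinuousOnInterval.comp_contDiff {F β : ℝ → ℝ} {a b : ℝ}
    (hF : AbsolutelyContinuousOnInterval F a b) (hβ : ContDiff ℝ 1 β) :
    AbsolutelyContinuousOnInterval (fun x => β (F x)) a b := by
  obtain ⟨C, hC⟩ := hF.exists_bound
  obtain ⟨K, hK⟩ := hβ.contDiffOn.exists_lipschitzOnWith (s := Icc (-C) C) (by decide)
    (convex_Icc _ _) isCompact_Icc
  have hmem : ∀ x ∈ uIcc a b, F x ∈ Icc (-C) C := fun x hx => abs_le.1 (hC x hx)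
  rw [absolutelyContinuousOnInterval_iff] at hF ⊢
  intro ε hε
  obtain ⟨δ, hδ, H⟩ := hF (ε / (K + 1)) (by positivity)
  refine ⟨δ, hδ, fun E hE hl => ?_⟩
  calc _ ≤ ∑ i ∈ Finset.range E.1, K * dist (F (E.2 i).1) (F (E.2 i).2) :=
        Finset.sum_le_sum fun i hi =>
          hK.dist_le_mul _ (hmem _ (hE.1 i hi).1) _ (hmem _ (hE.1 i hi).2)
    _ = K * ∑ i ∈ Finset.range E.1, dist (F (E.2 i).1) (F (E.2 i).2) :=
        (Finset.mul_sum _ _ _).symm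
    _ ≤ K * (ε / (K + 1)) := by gcongr; exact (H E hE hl).le
    _ < (K + 1) * (ε / (K + 1)) := by gcongr; linarith
    _ = ε := by field

namespace PrimOn

variable {F f G g : ℝ → ℝ} {a b : ℝ}

theorem mono (h : PrimOn F f a b) {c d : ℝ} (hs : uIcc c d ⊆ uIcc a b) : PrimOn F f c d :=
  ⟨h.1.mono hs, h.2.mono fun _ hx hm => hx (hs hm)⟩

theorem ae_deriv_eq (h : PrimOn F f a b) : ∀ᵐ x : ℝ, x ∈ uIcc a b → deriv F x = f x :=
  h.2.mono fun _ hx hm => (hx hm).deriv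

theorem intervalIntegrable (h : PrimOn F f a b) : IntervalIntegrable f volume a b := by
  refine h.1.intervalIntegrable_deriv.congr_ae ?_
  rw [EventuallyEq, ae_restrict_iff' measurableSet_uIoc]
  exact h.ae_deriv_eq.mono fun x hx hm => hx (uIoc_subset_uIcc hm)

theorem integral_eq (h : PrimOn F f a b) : ∫ x in a..b, f x = F b - F a := by
  rw [← h.1.integral_deriv_eq_sub]
  exact intervalIntegral.integral_congr_ae
    (h.ae_deriv_eq.mono fun x hx hm => (hx (uIoc_subset_uIcc hm)).symm)

theorem eq_add (h : PrimOn F f a b) {t : ℝ} (ht : t ∈ uIcc a b) :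
    F t = F a + ∫ x in a..t, f x := by
  have := (h.mono (uIcc_subset_uIcc left_mem_uIcc ht)).integral_eq
  linarith

theorem continuousOn (h : PrimOn F f a b) : ContinuousOn F (uIcc a b) := h.1.continuousOn

theorem congr_ae (h : PrimOn F f a b) (hfg : ∀ᵐ x : ℝ, x ∈ uIcc a b → f x = g x) :
    PrimOn F g a b :=
  ⟨h.1, by filter_upwards [h.2, hfg] with x h1 h2 hm; rw [← h2 hm]; exact h1 hm⟩

theorem of_eq_integral (hf : IntervalIntegrable f volume a b)
    (h : ∀ t ∈ uIcc a b, F t = F a + ∫ x in a..t, f x) : PrimOn F f a b := by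
  refine ⟨?_, ?_⟩
  · refine absolutelyContinuousOnInterval_congr (F := fun t => F a + ∫ x in a..t, f x) ?_
      fun t ht => (h t ht).symm
    exact (contDiff_const.contDiffOn (n := 1)).absolutelyContinuousOnInterval.add
      (hf.absolutelyContinuousOnInterval_intervalIntegral left_mem_uIcc)
  -- The formula for F is known only on the closed interval, so the endpoints are removed: elsewhere
  -- it holds in a neighbourhood, which a two-sided derivative requires.
  · have h1 : ∀ᵐ x : ℝ, x ≠ a := by simp [ae_iff, measure_singleton]
    have h2 : ∀ᵐ x : ℝ, x ≠ b := by simp [ae_iff, measure_singleton]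
    filter_upwards [hf.ae_hasDerivAt_integral, h1, h2] with x hx hxa hxb hm
    have hd := (hx hm a left_mem_uIcc).const_add (F a)
    refine hd.congr_of_eventuallyEq ?_
    have : uIcc a b ∈ 𝓝 x := by
      rw [uIcc]
      refine Icc_mem_nhds ?_ ?_
      · rcases le_total a b with hab | hab
        · rw [uIcc_of_le hab] at hm; simpa [hab] using lt_of_le_of_ne hm.1 hxa.symm
        · rw [uIcc_of_ge hab] at hm; simpa [hab] using lt_of_le_of_ne hm.1 hxb.symm
      · rcases le_total a b with hab | hab
        · rw [uIcc_of_le hab] at hm; simpa [hab] using lt_of_le_of_ne hm.2 hxb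
        · rw [uIcc_of_ge hab] at hm; simpa [hab] using lt_of_le_of_ne hm.2 hxa
    filter_upwards [this] with t ht using h t ht

theorem of_contDiff (hF : ContDiff ℝ 1 F) : PrimOn F (deriv F) a b :=
  ⟨hF.contDiffOn.absolutelyContinuousOnInterval,
    .of_forall fun x _ => (hF.differentiable one_ne_zero x).hasDerivAt⟩

theorem const (c : ℝ) : PrimOn (fun _ => c) (fun _ => 0) a b :=
  ⟨(contDiff_const.contDiffOn (n := 1)).absolutelyContinuousOnInterval,
    .of_forall fun x _ => hasDerivAt_const x c⟩

theorem add (hF : PrimOn F f a b) (hG : PrimOn G g a b) :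
    PrimOn (fun x => F x + G x) (fun x => f x + g x) a b :=
  ⟨hF.1.add hG.1, by filter_upwards [hF.2, hG.2] with x h1 h2 hm; exact (h1 hm).add (h2 hm)⟩

theorem sub (hF : PrimOn F f a b) (hG : PrimOn G g a b) :
    PrimOn (fun x => F x - G x) (fun x => f x - g x) a b :=
  ⟨hF.1.sub hG.1, by filter_upwards [hF.2, hG.2] with x h1 h2 hm; exact (h1 hm).sub (h2 hm)⟩

theorem mul (hF : PrimOn F f a b) (hG : PrimOn G g a b) :
    PrimOn (fun x => F x * G x) (fun x => f x * G x + F x * g x) a b :=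
  ⟨hF.1.mul hG.1, by filter_upwards [hF.2, hG.2] with x h1 h2 hm; exact (h1 hm).mul (h2 hm)⟩

theorem comp (hF : PrimOn F f a b) {β : ℝ → ℝ} (hβ : ContDiff ℝ 1 β) :
    PrimOn (fun x => β (F x)) (fun x => deriv β (F x) * f x) a b :=
  ⟨AbsolutelyContinuousOnInterval.comp_contDiff hF.1 hβ, by
    filter_upwards [hF.2] with x h1 hm
    exact ((hβ.differentiable one_ne_zero (F x)).hasDerivAt).comp x (h1 hm)⟩

theorem comp_add (hF : PrimOn F f (a + c) (b + c)) :
    PrimOn (fun x => F (x + c)) (fun x => f (x + c)) a b := by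
  refine of_eq_integral ?_ fun t ht => ?_
  · simpa using hF.intervalIntegrable.comp_add_right c
  · rw [intervalIntegral.integral_comp_add_right]
    refine hF.eq_add ?_
    rcases le_total a b with hab | hab
    · rw [uIcc_of_le hab] at ht; rw [uIcc_of_le (by linarith)]
      exact ⟨by linarith [ht.1], by linarith [ht.2]⟩
    · rw [uIcc_of_ge hab] at ht; rw [uIcc_of_ge (by linarith)]
      exact ⟨by linarith [ht.1], by linarith [ht.2]⟩

end PrimOn

namespace Prim

variable {F f G g : ℝ → ℝ}

theorem continuous (h : Prim F f) : Continuous F := by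
  rw [continuous_iff_continuousAt]
  intro x
  refine (h (x - 1) (x + 1)).continuousOn.continuousAt ?_
  rw [uIcc_of_le (by linarith)]
  exact Icc_mem_nhds (by linarith) (by linarith)

theorem ae_hasDerivAt (h : Prim F f) : ∀ᵐ x : ℝ, HasDerivAt F (f x) x := by
  have : ∀ᵐ x : ℝ, ∀ n : ℕ, x ∈ uIcc (-(n : ℝ)) n → HasDerivAt F (f x) x :=
    ae_all_iff.2 fun n => (h _ _).2
  filter_upwards [this] with x hx
  obtain ⟨n, hn⟩ := exists_nat_ge |x|
  exact hx n (by rw [uIcc_of_le (by linarith [abs_nonneg x])]; exact abs_le.1 hn)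

theorem ae_unique (h : Prim F f) (h' : Prim F g) : f =ᵐ[volume] g := by
  filter_upwards [h.ae_hasDerivAt, h'.ae_hasDerivAt] with x h1 h2 using h1.unique h2

theorem integral_eq (h : Prim F f) (a b : ℝ) : ∫ x in a..b, f x = F b - F a :=
  (h a b).integral_eq

theorem locallyIntegrable (h : Prim F f) : LocallyIntegrable f volume := by
  intro x
  refine ⟨Icc (x - 1) (x + 1), Icc_mem_nhds (by linarith) (by linarith), ?_⟩
  rw [integrableOn_Icc_iff_integrableOn_Ioc, ← intervalIntegrable_iff_integrableOn_Ioc_of_le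
    (by linarith)]
  exact (h _ _).intervalIntegrable

theorem congr_ae (h : Prim F f) (hfg : f =ᵐ[volume] g) : Prim F g := fun a b =>
  (h a b).congr_ae (hfg.mono fun _ hx _ => hx)

theorem of_eq_integral (hf : LocallyIntegrable f volume) (x₀ c : ℝ)
    (h : ∀ t, F t = c + ∫ x in x₀..t, f x) : Prim F f := by
  have hi : ∀ a b, IntervalIntegrable f volume a b := fun a b =>
    intervalIntegrable_iff.2 ((hf.integrableOn_isCompact isCompact_uIcc).mono_set uIoc_subset_uIcc)
  intro a b
  refine .of_eq_integral (hi a b) fun t _ => ?_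
  rw [h t, h a, add_assoc, intervalIntegral.integral_add_adjacent_intervals (hi _ _) (hi _ _)]

theorem of_contDiff (hF : ContDiff ℝ 1 F) : Prim F (deriv F) := fun _ _ => .of_contDiff hF
theorem const (c : ℝ) : Prim (fun _ => c) (fun _ => 0) := fun _ _ => .const c
theorem add (hF : Prim F f) (hG : Prim G g) : Prim (fun x => F x + G x) (fun x => f x + g x) :=
  fun a b => (hF a b).add (hG a b)
theorem sub (hF : Prim F f) (hG : Prim G g) : Prim (fun x => F x - G x) (fun x => f x - g x) :=
  fun a b => (hF a b).sub (hG a b)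
theorem mul (hF : Prim F f) (hG : Prim G g) :
    Prim (fun x => F x * G x) (fun x => f x * G x + F x * g x) :=
  fun a b => (hF a b).mul (hG a b)
theorem comp (hF : Prim F f) {β : ℝ → ℝ} (hβ : ContDiff ℝ 1 β) :
    Prim (fun x => β (F x)) (fun x => deriv β (F x) * f x) := fun a b => (hF a b).comp hβ
theorem comp_add (hF : Prim F f) (c : ℝ) : Prim (fun x => F (x + c)) (fun x => f (x + c)) :=
  fun _ _ => (hF _ _).comp_add

/-- Integrability of f gives F a limit at infinity, and integrability of F leaves 0 as the only
possible limit. -/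
theorem tendsto_atTop (h : Prim F f) (hF : Integrable F) (hf : Integrable f) :
    Tendsto F atTop (𝓝 0) := by
  have h1 : Tendsto F atTop (𝓝 (F 0 + ∫ x in Ioi 0, f x)) := by
    have := (intervalIntegral_tendsto_integral_Ioi 0 hf.integrableOn tendsto_id).const_add (F 0)
    refine this.congr fun t => ?_
    rw [h.integral_eq]; simp
  have : F 0 + ∫ x in Ioi 0, f x = 0 := by
    by_contra hne
    have hint : IntegrableAtFilter F atTop := hF.integrableAtFilter _
    exact hne (hint.eq_zero_of_tendsto (fun s hs => by
      obtain ⟨a, ha⟩ := mem_atTop_sets.1 hs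
      exact measure_mono_top (show Ici a ⊆ s from fun x hx => ha x hx) (by simp)) h1)
  rwa [this] at h1

theorem comp_neg (h : Prim F f) : Prim (fun x => F (-x)) (fun x => -f (-x)) := by
  intro a b
  refine .of_eq_integral ?_ fun t _ => ?_
  · have := (IntervalIntegrable.iff_comp_neg (f := f) (a := -a) (b := -b)).1
      (h (-a) (-b)).intervalIntegrable
    simp only [neg_neg] at this
    exact this.neg
  · rw [intervalIntegral.integral_neg, intervalIntegral.integral_comp_neg, h.integral_eq]
    ring

theorem tendsto_atBot (h : Prim F f) (hF : Integrable F) (hf : Integrable f) :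
    Tendsto F atBot (𝓝 0) := by
  have := (h.comp_neg.tendsto_atTop hF.comp_neg hf.comp_neg.neg).comp tendsto_neg_atBot_atTop
  simpa [Function.comp_def] using this

/-- The form in which integration by parts is used at fixed times: applied to a product, it needs
only integrability and no explicit boundary terms. -/
theorem integral_eq_zero (h : Prim F f) (hF : Integrable F) (hf : Integrable f) :
    ∫ x, f x = 0 := by
  have h1 := intervalIntegral_tendsto_integral hf tendsto_neg_atTop_atBot tendsto_id
  have h2 : Tendsto (fun t : ℝ => F t - F (-t)) atTop (𝓝 (0 - 0)) :=
    (h.tendsto_atTop hF hf).sub ((h.tendsto_atBot hF hf).comp tendsto_neg_atTop_atBot)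
  refine tendsto_nhds_unique h1 ?_
  simpa [h.integral_eq] using h2

/-- A primitive in `L¹` of a function in `L¹` is bounded. -/
theorem abs_le_integral (h : Prim F f) (hF : Integrable F) (hf : Integrable f) (x : ℝ) :
    |F x| ≤ ∫ y, |f y| := by
  have h1 : Tendsto (fun t => |F x - F t|) atBot (𝓝 |F x - 0|) :=
    ((h.tendsto_atBot hF hf).const_sub _).abs
  rw [sub_zero] at h1
  refine le_of_tendsto h1 ?_
  filter_upwards [eventually_le_atBot x] with t ht
  rw [← h.integral_eq, intervalIntegral.integral_of_le ht]
  refine (abs_integral_le_integral_abs).trans ?_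
  exact setIntegral_le_integral hf.abs (.of_forall fun _ => abs_nonneg _)

/-- The embedding of H¹(ℝ) into the bounded functions, by the L¹ bound for the primitive F² of 2Ff.
-/
theorem sq_le (h : Prim F f) (hF : MemLp F 2) (hf : MemLp f 2) (x : ℝ) :
    F x ^ 2 ≤ ∫ y, |2 * (F y * f y)| := by
  have h2 : Prim (fun x => F x * F x) (fun x => 2 * (F x * f x)) :=
    (h.mul h).congr_ae (.of_forall fun x => by ring)
  have := h2.abs_le_integral (hF.integrable_mul hF) ((hF.integrable_mul hf).const_mul 2) x
  rwa [← sq, abs_of_nonneg (sq_nonneg _)] at this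

theorem exists_bound (h : Prim F f) (hF : MemLp F 2) (hf : MemLp f 2) :
    ∃ K, 0 ≤ K ∧ ∀ x, |F x| ≤ K :=
  ⟨√(∫ y, |2 * (F y * f y)|), Real.sqrt_nonneg _, fun x => Real.abs_le_sqrt (h.sq_le hF hf x)⟩

end Prim

end

/-! ### Test functions on the plane -/

theorem hasDerivAt_fst_of_contDiff {φ : ℝ × ℝ → ℝ} {n : WithTop ℕ∞} (hφ : ContDiff ℝ n φ)
    (hn : n ≠ 0) (s y : ℝ) :
    HasDerivAt (fun σ => φ (σ, y)) (fderiv ℝ φ (s, y) (1, 0)) s := by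
  have h1 : HasDerivAt (fun σ : ℝ => (σ, y)) ((1 : ℝ), (0 : ℝ)) s :=
    (hasDerivAt_id s).prodMk (hasDerivAt_const s y)
  exact ((hφ.differentiable hn (s, y)).hasFDerivAt).comp_hasDerivAt s h1

theorem hasDerivAt_snd_of_contDiff {φ : ℝ × ℝ → ℝ} {n : WithTop ℕ∞} (hφ : ContDiff ℝ n φ)
    (hn : n ≠ 0) (s y : ℝ) :
    HasDerivAt (fun x => φ (s, x)) (fderiv ℝ φ (s, y) (0, 1)) y := by
  have h1 : HasDerivAt (fun x : ℝ => (s, x)) ((0 : ℝ), (1 : ℝ)) y :=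
    (hasDerivAt_const y s).prodMk (hasDerivAt_id y)
  exact ((hφ.differentiable hn (s, y)).hasFDerivAt).comp_hasDerivAt y h1

theorem _root_.HasCompactSupport.slice_fst {φ : ℝ × ℝ → ℝ} (h : HasCompactSupport φ) (y : ℝ) :
    HasCompactSupport (fun s => φ (s, y)) :=
  HasCompactSupport.intro (IsCompact.image h continuous_fst) fun s hs =>
    image_eq_zero_of_notMem_tsupport fun hm => hs ⟨(s, y), hm, rfl⟩

/-- The integral is a convolution of ψ(·, y) with the constant 1, evaluated at 0, so smoothness in
the parameter y is the smoothness of parametric convolutions. -/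
theorem contDiff_integral_fst {ψ : ℝ × ℝ → ℝ} (hψ : ContDiff ℝ ∞ ψ) (hc : HasCompactSupport ψ) :
    ContDiff ℝ ∞ (fun y => ∫ σ, ψ (σ, y)) := by
  have hk : IsCompact (Prod.fst '' tsupport ψ) := IsCompact.image hc continuous_fst
  have := contDiffOn_convolution_right_with_param_comp (μ := volume) (n := ⊤)
    (ContinuousLinearMap.mul ℝ ℝ) (s := univ) (v := fun _ : ℝ => (0 : ℝ)) contDiffOn_const
    (f := fun _ : ℝ => (1 : ℝ)) (g := fun y s => ψ (s, y)) isOpen_univ hk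
    (fun y s _ hs => image_eq_zero_of_notMem_tsupport fun hm => hs ⟨(s, y), hm, rfl⟩)
    (continuous_const.locallyIntegrable) (by
      refine ContDiff.contDiffOn ?_
      exact hψ.comp (contDiff_snd.prodMk contDiff_fst))
  rw [contDiffOn_univ] at this
  convert this using 1
  funext y
  rw [convolution_def]
  simp only [ContinuousLinearMap.mul_apply', one_mul, zero_sub]
  exact (integral_neg_eq_self (fun σ => ψ (σ, y)) volume).symm

/-- Subtracting ρ times the line integral leaves a function with zero integral on each line of fixed
y. Its primitive therefore vanishes on both sides of the support and is again a test function;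
order-connectedness of I keeps its support inside I × J. -/
theorem exists_antideriv {I J : Set ℝ} (hI : I.OrdConnected) {ψ : ℝ × ℝ → ℝ}
    (hψ : ContDiff ℝ ∞ ψ) (hψc : HasCompactSupport ψ) (hψs : tsupport ψ ⊆ I ×ˢ J)
    {ρ : ℝ → ℝ} (hρ : ContDiff ℝ ∞ ρ) (hρc : HasCompactSupport ρ) (hρs : tsupport ρ ⊆ I)
    (hρ1 : ∫ s, ρ s = 1) :
    ∃ φ : ℝ × ℝ → ℝ, ContDiff ℝ ∞ φ ∧ HasCompactSupport φ ∧ tsupport φ ⊆ I ×ˢ J ∧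
      ∀ z, fderiv ℝ φ z (1, 0) = ψ z - ρ z.1 * ∫ σ, ψ (σ, z.2) := by
  set Ψ : ℝ → ℝ := fun y => ∫ σ, ψ (σ, y) with hΨ
  have hΨs : ContDiff ℝ ∞ Ψ := contDiff_integral_fst hψ hψc
  set κ : ℝ × ℝ → ℝ := fun z => ψ z - ρ z.1 * Ψ z.2 with hκ
  have hκs : ContDiff ℝ ∞ κ := hψ.sub ((hρ.comp contDiff_fst).mul (hΨs.comp contDiff_snd))
  set K₁ : Set ℝ := Prod.fst '' tsupport ψ ∪ tsupport ρ with hK₁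
  set K₂ : Set ℝ := Prod.snd '' tsupport ψ with hK₂
  have hK₁c : IsCompact K₁ := (IsCompact.image hψc continuous_fst).union hρc
  have hK₂c : IsCompact K₂ := IsCompact.image hψc continuous_snd
  have hK₁I : K₁ ⊆ I := union_subset (by rintro _ ⟨z, hz, rfl⟩; exact (hψs hz).1) hρs
  have hK₂J : K₂ ⊆ J := by rintro _ ⟨z, hz, rfl⟩; exact (hψs hz).2
  have hne : K₁.Nonempty := by
    by_contra h
    have : tsupport ρ = ∅ := by
      rw [not_nonempty_iff_eq_empty, hK₁, union_empty_iff] at h; exact h.2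
    rw [tsupport_eq_empty_iff] at this
    simp [this] at hρ1
  obtain ⟨a, ha⟩ := hK₁c.exists_isLeast hne
  obtain ⟨b, hb⟩ := hK₁c.exists_isGreatest hne
  have hab : Icc a b ⊆ I := hI.out (hK₁I ha.1) (hK₁I hb.1)
  have hψ0 : ∀ s y, s ∉ Icc a b → ψ (s, y) = 0 := fun s y hs =>
    image_eq_zero_of_notMem_tsupport fun hm =>
      hs ⟨ha.2 (Or.inl ⟨_, hm, rfl⟩), hb.2 (Or.inl ⟨_, hm, rfl⟩)⟩
  have hψ0' : ∀ s y, y ∉ K₂ → ψ (s, y) = 0 := fun s y hs =>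
    image_eq_zero_of_notMem_tsupport fun hm => hs ⟨_, hm, rfl⟩
  have hρ0 : ∀ s, s ∉ Icc a b → ρ s = 0 := fun s hs =>
    image_eq_zero_of_notMem_tsupport fun hm => hs ⟨ha.2 (Or.inr hm), hb.2 (Or.inr hm)⟩
  have hκ0 : ∀ s y, s ∉ Icc a b → κ (s, y) = 0 := fun s y hs => by
    simp [hκ, hψ0 s y hs, hρ0 s hs]
  have hκ0' : ∀ s y, y ∉ K₂ → κ (s, y) = 0 := fun s y hy => by
    simp [hκ, hΨ, fun s => hψ0' s y hy]
  have hκy : ∀ y, Continuous fun s => κ (s, y) := fun y =>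
    hκs.continuous.comp (continuous_id.prodMk continuous_const)
  have hκi : ∀ y, ∫ s, κ (s, y) = 0 := fun y => by
    have h1 : Integrable fun s => ψ (s, y) :=
      (hψ.continuous.comp (continuous_id.prodMk continuous_const)).integrable_of_hasCompactSupport
        (hψc.slice_fst y)
    have h2 : Integrable ρ := hρ.continuous.integrable_of_hasCompactSupport hρc
    simp only [hκ]
    rw [integral_sub h1 (h2.mul_const _), integral_mul_const, hρ1]
    simp [hΨ]
  have hκint : ∀ y, Integrable fun s => κ (s, y) := fun y =>
    (hκy y).integrable_of_hasCompactSupport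
      (HasCompactSupport.intro (isCompact_Icc (a := a) (b := b)) fun s hs => hκ0 s y hs)
  set φ : ℝ × ℝ → ℝ := fun z => ∫ σ in a..z.1, κ (σ, z.2) with hφ
  have hφIic : ∀ s y, φ (s, y) = ∫ σ in Iic s, κ (σ, y) := fun s y => by
    have h1 := intervalIntegral.integral_Iic_sub_Iic (a := a) (b := s) (μ := volume)
      (hκint y).integrableOn (hκint y).integrableOn
    have h2 : ∫ σ in Iic a, κ (σ, y) = 0 := by
      rw [integral_Iic_eq_integral_Iio]
      exact setIntegral_eq_zero_of_forall_eq_zero fun σ hσ =>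
        hκ0 σ y fun hm => absurd hm.1 (not_le.2 hσ)
    simp only [hφ]
    linarith
  have hφs : ContDiff ℝ ∞ φ := by
    -- The primitive is the convolution of κ(·, y) with the Heaviside function, hence smooth in both
    -- variables.
    have := contDiffOn_convolution_right_with_param_comp (μ := volume) (n := ⊤)
      (ContinuousLinearMap.mul ℝ ℝ) (s := univ) (v := fun z : ℝ × ℝ => z.1)
      contDiff_fst.contDiffOn
      (f := (Ici (0 : ℝ)).indicator fun _ : ℝ => (1 : ℝ)) (g := fun z s => κ (s, z.2)) isOpen_univ
      (isCompact_Icc (a := a) (b := b)) (fun z s _ hs => hκ0 s z.2 hs)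
      ((locallyIntegrable_const (1 : ℝ)).indicator measurableSet_Ici) (by
        refine ContDiff.contDiffOn ?_
        exact hκs.comp (contDiff_snd.prodMk (contDiff_snd.comp contDiff_fst)))
    rw [contDiffOn_univ] at this
    convert this using 1
    funext z
    rw [convolution_def, show z = (z.1, z.2) from rfl, hφIic]
    simp only [ContinuousLinearMap.mul_apply']
    rw [← integral_indicator measurableSet_Iic, ← integral_sub_left_eq_self _ volume z.1]
    refine integral_congr_ae (.of_forall fun t => ?_)
    by_cases ht : 0 ≤ t
    · simp [indicator, ht]
    · simp [indicator, ht]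
  have hφ0 : ∀ z, z ∉ Icc a b ×ˢ K₂ → φ z = 0 := by
    rintro ⟨s, y⟩ hz
    by_cases hy : y ∈ K₂
    · have hs : s ∉ Icc a b := fun hs => hz ⟨hs, hy⟩
      rw [hφIic]
      by_cases hsa : s < a
      · exact setIntegral_eq_zero_of_forall_eq_zero fun σ hσ =>
          hκ0 σ y fun hm => absurd hm.1 (not_le.2 (lt_of_le_of_lt hσ hsa))
      · have hsb : b < s := by
          by_contra h; exact hs ⟨not_lt.1 hsa, not_lt.1 h⟩
        rw [setIntegral_eq_integral_of_forall_compl_eq_zero, hκi]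
        exact fun σ hσ => hκ0 σ y fun hm => hσ (hm.2.trans hsb.le)
    · simp [hφ, fun s => hκ0' s y hy]
  have hφt : tsupport φ ⊆ Icc a b ×ˢ K₂ := closure_minimal
    (fun z hz => by by_contra h; exact hz (hφ0 z h)) (isCompact_Icc.prod hK₂c).isClosed
  refine ⟨φ, hφs, HasCompactSupport.intro (isCompact_Icc.prod hK₂c) hφ0,
    hφt.trans (prod_mono hab hK₂J), fun z => ?_⟩
  have h1 := hasDerivAt_fst_of_contDiff hφs (by simp) z.1 z.2
  have h2 : HasDerivAt (fun σ => φ (σ, z.2)) (κ (z.1, z.2)) z.1 :=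
    intervalIntegral.integral_hasDerivAt_right ((hκy z.2).intervalIntegrable _ _)
      ((hκy z.2).stronglyMeasurableAtFilter _ _) (hκy z.2).continuousAt
  exact h1.unique h2

/-! ### Local integrability, slices and primitives on the plane -/

/-- The open square of half side length `n` around the origin. -/
def square (n : ℕ) : Set (ℝ × ℝ) := Ioo (-(n : ℝ)) n ×ˢ Ioo (-(n : ℝ)) n

theorem mem_square_of {z : ℝ × ℝ} {n : ℕ} (h1 : |z.1| < n) (h2 : |z.2| < n) : z ∈ square n :=
  ⟨abs_lt.1 h1, abs_lt.1 h2⟩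

theorem isOpen_square (n : ℕ) : IsOpen (square n) := isOpen_Ioo.prod isOpen_Ioo

theorem locallyIntegrable_iff_square {f : ℝ × ℝ → ℝ} :
    LocallyIntegrable f volume ↔ ∀ n : ℕ, IntegrableOn f (square n) volume := by
  refine ⟨fun h n => (h.integrableOn_isCompact (isCompact_Icc.prod isCompact_Icc)).mono_set
    (prod_mono Ioo_subset_Icc_self Ioo_subset_Icc_self), fun h z => ?_⟩
  obtain ⟨n, hn⟩ := exists_nat_gt (max |z.1| |z.2|)
  exact ⟨square n, (isOpen_square n).mem_nhds (mem_square_of (lt_of_le_of_lt (le_max_left _ _) hn)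
    (lt_of_le_of_lt (le_max_right _ _) hn)), h n⟩

theorem locallyIntegrable_iff_Ioo {f : ℝ → ℝ} :
    LocallyIntegrable f volume ↔ ∀ n : ℕ, IntegrableOn f (Ioo (-(n : ℝ)) n) volume := by
  refine ⟨fun h n => (h.integrableOn_isCompact isCompact_Icc).mono_set Ioo_subset_Icc_self,
    fun h z => ?_⟩
  obtain ⟨n, hn⟩ := exists_nat_gt |z|
  exact ⟨_, isOpen_Ioo.mem_nhds (abs_lt.1 hn), h n⟩

theorem integrableOn_square_iff {f : ℝ × ℝ → ℝ} {n : ℕ} : IntegrableOn f (square n) volume ↔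
    Integrable f ((volume.restrict (Ioo (-(n : ℝ)) n)).prod
      (volume.restrict (Ioo (-(n : ℝ)) n))) := by
  rw [Measure.prod_restrict]; rfl

theorem locallyIntegrable_slice_fst {f : ℝ × ℝ → ℝ} (hf : LocallyIntegrable f volume) :
    ∀ᵐ y : ℝ, LocallyIntegrable (fun s => f (s, y)) volume := by
  have : ∀ᵐ y : ℝ, ∀ n m : ℕ, y ∈ Ioo (-(m : ℝ)) m → n ≤ m →
      IntegrableOn (fun s => f (s, y)) (Ioo (-(n : ℝ)) n) := by
    refine ae_all_iff.2 fun n => ae_all_iff.2 fun m => ?_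
    have := (integrableOn_square_iff.1 (locallyIntegrable_iff_square.1 hf m)).prod_left_ae
    rw [ae_restrict_iff' measurableSet_Ioo] at this
    filter_upwards [this] with y hy hm hnm
    exact IntegrableOn.mono_set (hy hm)
      (Ioo_subset_Ioo (neg_le_neg (Nat.cast_le.2 hnm)) (Nat.cast_le.2 hnm))
  filter_upwards [this] with y hy
  rw [locallyIntegrable_iff_Ioo]
  intro n
  obtain ⟨m, hm⟩ := exists_nat_gt |y|
  refine hy n (max m n) (abs_lt.1 (hm.trans_le ?_)) (le_max_right _ _)
  exact_mod_cast le_max_left _ _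

theorem locallyIntegrable_comp_swap {f : ℝ × ℝ → ℝ} (hf : LocallyIntegrable f volume) :
    LocallyIntegrable (fun z : ℝ × ℝ => f z.swap) volume := by
  rw [locallyIntegrable_iff_square] at hf ⊢
  intro n
  have := hf n
  rw [integrableOn_square_iff] at this ⊢
  exact this.swap

theorem locallyIntegrable_slice_snd {f : ℝ × ℝ → ℝ} (hf : LocallyIntegrable f volume) :
    ∀ᵐ s : ℝ, LocallyIntegrable (fun y => f (s, y)) volume :=
  locallyIntegrable_slice_fst (locallyIntegrable_comp_swap hf)

theorem locallyIntegrable_primitive {g : ℝ × ℝ → ℝ} (hg : LocallyIntegrable g volume) (s₀ : ℝ) :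
    LocallyIntegrable (fun z : ℝ × ℝ => ∫ σ in s₀..z.1, g (σ, z.2)) volume := by
  rw [locallyIntegrable_iff_square]
  have key : ∀ n : ℕ, |s₀| < n →
      IntegrableOn (fun z : ℝ × ℝ => ∫ σ in s₀..z.1, g (σ, z.2)) (square n) := by
    intro n hn
    have hs0 := abs_lt.1 hn
    rw [integrableOn_square_iff]
    set m : Measure ℝ := volume.restrict (Ioo (-(n : ℝ)) n) with hm
    have h1 : Integrable g (m.prod m) := integrableOn_square_iff.1 (locallyIntegrable_iff_square.1 hg n)
    have h2 : Integrable (fun p : ℝ × ℝ × ℝ => g p.2.swap) (m.prod (m.prod m)) :=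
      Integrable.comp_snd h1.swap m
    have h3 : Integrable (fun p : (ℝ × ℝ) × ℝ => g (p.2, p.1.2)) ((m.prod m).prod m) :=
      (measurePreserving_prodAssoc m m m).integrable_comp_of_integrable h2
    -- The signed indicator of the interval between s₀ and s replaces the moving limits of
    -- integration by a bounded kernel on a fixed domain, so that Fubini applies.
    set k : (ℝ × ℝ) × ℝ → ℝ := fun p =>
      {p : (ℝ × ℝ) × ℝ | s₀ < p.2 ∧ p.2 ≤ p.1.1}.indicator (fun _ => (1 : ℝ)) p -
      {p : (ℝ × ℝ) × ℝ | p.1.1 < p.2 ∧ p.2 ≤ s₀}.indicator (fun _ => (1 : ℝ)) p with hk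
    have hkm : Measurable k := by
      refine (measurable_const.indicator ?_).sub (measurable_const.indicator ?_)
      · exact (measurableSet_lt measurable_const measurable_snd).inter
          (measurableSet_le measurable_snd (measurable_fst.comp measurable_fst))
      · exact (measurableSet_lt (measurable_fst.comp measurable_fst) measurable_snd).inter
          (measurableSet_le measurable_snd measurable_const)
    have h4 : Integrable (fun p => k p * g (p.2, p.1.2)) ((m.prod m).prod m) := by
      refine h3.bdd_mul (c := 2) hkm.aestronglyMeasurable (.of_forall fun p => ?_)
      simp only [hk, indicator]
      split_ifs <;> norm_num
    refine h4.integral_prod_left.congr ?_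
    rw [hm, Measure.prod_restrict]
    refine (ae_restrict_iff' (measurableSet_Ioo.prod measurableSet_Ioo)).2 (.of_forall ?_)
    rintro ⟨s, y⟩ ⟨hs, hy⟩
    simp only [hk] at hs ⊢
    rcases le_total s₀ s with h | h
    · rw [intervalIntegral.integral_of_le h, ← integral_indicator measurableSet_Ioo,
        ← integral_indicator measurableSet_Ioc]
      refine integral_congr_ae (.of_forall fun σ => ?_)
      have hh : ¬ (s < σ ∧ σ ≤ s₀) := fun hh => by linarith
      by_cases h' : s₀ < σ ∧ σ ≤ s
      · have : -(n : ℝ) < σ ∧ σ < n := ⟨by linarith, by linarith [hs.2]⟩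
        simp [indicator, h', hh, this]
      · simp [indicator, h', hh]
    · rw [intervalIntegral.integral_of_ge h, ← integral_indicator measurableSet_Ioo,
        ← integral_indicator measurableSet_Ioc, ← integral_neg]
      refine integral_congr_ae (.of_forall fun σ => ?_)
      have hh : ¬ (s₀ < σ ∧ σ ≤ s) := fun hh => by linarith
      by_cases h' : s < σ ∧ σ ≤ s₀
      · have : -(n : ℝ) < σ ∧ σ < n := ⟨by linarith [hs.1], by linarith⟩
        simp [indicator, h', hh, this]
      · simp [indicator, h', hh]
  intro n
  obtain ⟨m, hm⟩ := exists_nat_gt |s₀|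
  refine (key (max m n) (hm.trans_le (by exact_mod_cast le_max_left _ _))).mono_set ?_
  have : (n : ℝ) ≤ ((max m n : ℕ) : ℝ) := by exact_mod_cast le_max_right _ _
  exact prod_mono (Ioo_subset_Ioo (neg_le_neg this) this) (Ioo_subset_Ioo (neg_le_neg this) this)

/-! ### Weak derivatives in one variable are derivatives of primitives -/

/-- Integration by parts in the first variable against a test function. -/
theorem integral_mul_fderiv_fst {F f : ℝ × ℝ → ℝ} (hF : LocallyIntegrable F volume)
    (hf : LocallyIntegrable f volume) (h : ∀ᵐ y : ℝ, Prim (fun s => F (s, y)) (fun s => f (s, y)))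
    {φ : ℝ × ℝ → ℝ} (hφ : ContDiff ℝ 1 φ) (hc : HasCompactSupport φ) :
    ∫ z, F z * fderiv ℝ φ z (1, 0) = - ∫ z, f z * φ z := by
  have hd : Continuous fun z => fderiv ℝ φ z (1, 0) :=
    (hφ.continuous_fderiv one_ne_zero).clm_apply continuous_const
  have hdc : HasCompactSupport fun z => fderiv ℝ φ z (1, 0) := hc.fderiv_apply ℝ (1, 0)
  have h1 : Integrable fun z => F z * fderiv ℝ φ z (1, 0) :=
    hF.integrable_smul_right_of_hasCompactSupport hd hdc
  have h2 : Integrable fun z => f z * φ z :=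
    hf.integrable_smul_right_of_hasCompactSupport hφ.continuous hc
  rw [← add_eq_zero_iff_eq_neg, ← integral_add h1 h2]
  rw [Measure.volume_eq_prod, integral_prod_symm _ (by exact h1.add h2)]
  refine integral_eq_zero_of_ae ?_
  filter_upwards [h] with y hy
  have e : Prim (fun s => F (s, y) * φ (s, y))
      (fun s => F (s, y) * fderiv ℝ φ (s, y) (1, 0) + f (s, y) * φ (s, y)) := by
    have hφy : ContDiff ℝ 1 fun s => φ (s, y) := hφ.comp (contDiff_id.prodMk contDiff_const)
    refine (hy.mul (Prim.of_contDiff hφy)).congr_ae (.of_forall fun s => ?_)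
    simp only [(hasDerivAt_fst_of_contDiff hφ one_ne_zero s y).deriv]
    ring
  refine e.integral_eq_zero ?_ (.add ?_ ?_)
  · exact (hy.continuous.locallyIntegrable).integrable_smul_right_of_hasCompactSupport
      (hφ.continuous.comp (continuous_id.prodMk continuous_const)) (hc.slice_fst y)
  · exact (hy.continuous.locallyIntegrable).integrable_smul_right_of_hasCompactSupport
      (hd.comp (continuous_id.prodMk continuous_const)) (hdc.slice_fst y)
  · exact hy.locallyIntegrable.integrable_smul_right_of_hasCompactSupport
      (hφ.continuous.comp (continuous_id.prodMk continuous_const)) (hc.slice_fst y)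

/-- A function with a weak derivative in the first variable is, up to a function of the second
variable, a primitive of that derivative. -/
theorem exists_eq_add_primitive {I J : Set ℝ} (hIo : IsOpen I) (hJo : IsOpen J)
    (hI : I.OrdConnected) (s₀ : ℝ) (hne : I.Nonempty)
    {f g : ℝ × ℝ → ℝ} (hf : LocallyIntegrable f volume) (hg : LocallyIntegrable g volume)
    (h : ∀ φ : ℝ × ℝ → ℝ, ContDiff ℝ ∞ φ → HasCompactSupport φ → tsupport φ ⊆ I ×ˢ J →
      ∫ z, f z * fderiv ℝ φ z (1, 0) = - ∫ z, g z * φ z) :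
    ∃ c : ℝ → ℝ, LocallyIntegrable c volume ∧
      ∀ᵐ z : ℝ × ℝ, z ∈ I ×ˢ J → f z = c z.2 + ∫ σ in s₀..z.1, g (σ, z.2) := by
  obtain ⟨p, hp⟩ := hne
  obtain ⟨r, hr, hrI⟩ := Metric.isOpen_iff.1 hIo p hp
  let ρb : ContDiffBump p := ⟨r / 4, r / 2, by positivity, by linarith⟩
  set ρ : ℝ → ℝ := ρb.normed volume with hρd
  have hρ : ContDiff ℝ ∞ ρ := ρb.contDiff_normed
  have hρs : tsupport ρ ⊆ I := by
    rw [hρd, ρb.tsupport_normed_eq]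
    exact (Metric.closedBall_subset_ball (by change r / 2 < r; linarith)).trans hrI
  have hρc : HasCompactSupport ρ := ρb.hasCompactSupport_normed
  have hρ1 : ∫ s, ρ s = 1 := ρb.integral_normed
  set G : ℝ × ℝ → ℝ := fun z => ∫ σ in s₀..z.1, g (σ, z.2) with hG
  have hGl : LocallyIntegrable G volume := locallyIntegrable_primitive hg s₀
  have hGp : ∀ᵐ y : ℝ, Prim (fun s => G (s, y)) (fun s => g (s, y)) := by
    filter_upwards [locallyIntegrable_slice_fst hg] with y hy
    exact Prim.of_eq_integral hy s₀ 0 fun t => by simp [hG]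
  set k : ℝ × ℝ → ℝ := fun z => f z - G z with hk
  have hkl : LocallyIntegrable k volume := hf.sub hGl
  have hk0 : ∀ φ : ℝ × ℝ → ℝ, ContDiff ℝ ∞ φ → HasCompactSupport φ → tsupport φ ⊆ I ×ˢ J →
      ∫ z, k z * fderiv ℝ φ z (1, 0) = 0 := by
    intro φ hφ hc hs
    have hd : Continuous fun z => fderiv ℝ φ z (1, 0) :=
      (hφ.continuous_fderiv (by simp)).clm_apply continuous_const
    have hdc : HasCompactSupport fun z => fderiv ℝ φ z (1, 0) := hc.fderiv_apply ℝ (1, 0)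
    have h1 : Integrable fun z => f z * fderiv ℝ φ z (1, 0) :=
      hf.integrable_smul_right_of_hasCompactSupport hd hdc
    have h2 : Integrable fun z => G z * fderiv ℝ φ z (1, 0) :=
      hGl.integrable_smul_right_of_hasCompactSupport hd hdc
    simp only [hk, sub_mul]
    rw [integral_sub h1 h2, h φ hφ hc hs,
      integral_mul_fderiv_fst hGl hg hGp (hφ.of_le (by simp)) hc, sub_self]
  -- The weak derivative of k in the first variable is zero, so k should depend on y alone. Its
  -- average against ρ, which has mass 1, is the only candidate.
  set c : ℝ → ℝ := fun y => ∫ σ, k (σ, y) * ρ σ with hc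
  obtain ⟨Cρ, hCρ⟩ := hρ.continuous.bounded_above_of_compact_support hρc
  obtain ⟨Nρ, hNρ⟩ := (hρc.isBounded).subset_ball 0
  have hρ0 : ∀ s, s ∉ Ioo (-Nρ) Nρ → ρ s = 0 := fun s hs =>
    image_eq_zero_of_notMem_tsupport fun hm => hs (by
      have := hNρ hm
      rwa [Real.ball_eq_Ioo, zero_sub, zero_add] at this)
  have hkρ : ∀ n : ℕ, Integrable (fun z : ℝ × ℝ => k z * ρ z.1)
      (volume.prod (volume.restrict (Ioo (-(n : ℝ)) n))) := by
    intro n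
    obtain ⟨m, hm⟩ := exists_nat_gt Nρ
    have h1 := integrableOn_square_iff.1 (locallyIntegrable_iff_square.1 hkl (max m n))
    have hmm : (m : ℝ) ≤ ((max m n : ℕ) : ℝ) := by exact_mod_cast le_max_left _ _
    have hnm : (n : ℝ) ≤ ((max m n : ℕ) : ℝ) := by exact_mod_cast le_max_right _ _
    have h2 := (h1.mul_bdd (c := Cρ) (g := fun z : ℝ × ℝ => ρ z.1)
      (hρ.continuous.comp continuous_fst).aestronglyMeasurable (.of_forall fun z => hCρ _))
    rw [Measure.prod_restrict, ← Measure.volume_eq_prod] at h2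
    have h3 := Integrable.mono_measure (h2 : IntegrableOn _ _ _)
      (Measure.restrict_mono (s := Ioo (-((max m n : ℕ) : ℝ)) ((max m n : ℕ) : ℝ) ×ˢ
        Ioo (-(n : ℝ)) n) (prod_mono subset_rfl (Ioo_subset_Ioo (neg_le_neg hnm) hnm)) le_rfl)
    have h4 : IntegrableOn (fun z : ℝ × ℝ => k z * ρ z.1) (univ ×ˢ Ioo (-(n : ℝ)) n)
        volume := by
      refine (IntegrableOn.of_forall_sdiff_eq_zero h3
        (MeasurableSet.univ.prod measurableSet_Ioo) ?_)
      rintro ⟨s, y⟩ ⟨hs1, hs2⟩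
      have : s ∉ Ioo (-Nρ) Nρ := fun hs => hs2 ⟨⟨by linarith [hs.1], by linarith [hs.2]⟩, hs1.2⟩
      simp [hρ0 s this]
    rwa [IntegrableOn, Measure.volume_eq_prod, ← Measure.prod_restrict, Measure.restrict_univ] at h4
  have hcl : LocallyIntegrable c volume := by
    rw [locallyIntegrable_iff_Ioo]
    intro n
    exact (hkρ n).integral_prod_right
  have hcl2 : LocallyIntegrable (fun z : ℝ × ℝ => c z.2) volume := by
    rw [locallyIntegrable_iff_square]
    intro n
    rw [integrableOn_square_iff]
    exact Integrable.comp_snd (locallyIntegrable_iff_Ioo.1 hcl n) _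
  refine ⟨c, hcl, ?_⟩
  have hfin : LocallyIntegrable (fun z : ℝ × ℝ => k z - c z.2) volume := hkl.sub hcl2
  have := (hIo.prod hJo).ae_eq_zero_of_integral_contDiff_smul_eq_zero
    (hfin.locallyIntegrableOn _) (μ := volume) fun ψ hψ hψc hψs => by
    obtain ⟨φ, hφ, hφc, hφs, hφd⟩ := exists_antideriv hI hψ hψc hψs hρ hρc hρs hρ1
    have h0 := hk0 φ hφ hφc hφs
    have hΨ := contDiff_integral_fst hψ hψc
    have hΨc : HasCompactSupport fun y => ∫ σ, ψ (σ, y) :=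
      HasCompactSupport.intro (IsCompact.image hψc continuous_snd) fun y hy => by
        have : ∀ s, ψ (s, y) = 0 := fun s =>
          image_eq_zero_of_notMem_tsupport fun hm => hy ⟨_, hm, rfl⟩
        simp [this]
    set Ψ : ℝ → ℝ := fun y => ∫ σ, ψ (σ, y) with hΨd
    have hρΨc : HasCompactSupport fun z : ℝ × ℝ => ρ z.1 * Ψ z.2 := by
      refine HasCompactSupport.intro (IsCompact.prod hρc hΨc) fun z hz => ?_
      by_cases h1 : z.1 ∈ tsupport ρ
      · rw [image_eq_zero_of_notMem_tsupport (f := Ψ) fun h2 => hz ⟨h1, h2⟩, mul_zero]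
      · rw [image_eq_zero_of_notMem_tsupport h1, zero_mul]
    have i1 : Integrable fun z => k z * ψ z :=
      hkl.integrable_smul_right_of_hasCompactSupport hψ.continuous hψc
    have i2 : Integrable fun z : ℝ × ℝ => k z * (ρ z.1 * Ψ z.2) :=
      hkl.integrable_smul_right_of_hasCompactSupport
        ((hρ.continuous.comp continuous_fst).mul (hΨ.continuous.comp continuous_snd)) hρΨc
    have i3 : Integrable fun z : ℝ × ℝ => c z.2 * ψ z :=
      hcl2.integrable_smul_right_of_hasCompactSupport hψ.continuous hψc
    -- The difference of the two test functions is a derivative of a test function, by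
    -- `exists_antideriv`, and k annihilates those.
    have e1 : ∫ z, k z * ψ z = ∫ z : ℝ × ℝ, k z * (ρ z.1 * Ψ z.2) := by
      rw [← sub_eq_zero, ← integral_sub i1 i2, ← h0]
      refine integral_congr_ae (.of_forall fun z => ?_)
      simp only [hφd z, hΨd]; ring
    have e2 : ∫ z : ℝ × ℝ, k z * (ρ z.1 * Ψ z.2) = ∫ y, c y * Ψ y := by
      rw [Measure.volume_eq_prod, integral_prod_symm _ (by exact i2)]
      refine integral_congr_ae (.of_forall fun y => ?_)
      simp only [hc, ← integral_mul_const]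
      refine integral_congr_ae (.of_forall fun s => ?_)
      simp only; ring
    have e3 : ∫ z : ℝ × ℝ, c z.2 * ψ z = ∫ y, c y * Ψ y := by
      rw [Measure.volume_eq_prod, integral_prod_symm _ (by exact i3)]
      refine integral_congr_ae (.of_forall fun y => ?_)
      simp only [hΨd, ← integral_const_mul]
    calc ∫ z, ψ z • (k z - c z.2) = ∫ z, (k z * ψ z - c z.2 * ψ z) :=
          integral_congr_ae (.of_forall fun z => by simp only [smul_eq_mul]; ring)
      _ = 0 := by rw [integral_sub i1 i3, e1, e2, e3, sub_self]
  filter_upwards [this] with z hz hm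
  have := hz hm
  simp only [hk, hG] at this
  linarith

/-! ### The half plane, strips and mixed norms -/

theorem isOpen_halfPlane : IsOpen halfPlane := isOpen_Ioi.prod isOpen_univ

theorem measurableSet_halfPlane : MeasurableSet halfPlane := isOpen_halfPlane.measurableSet

theorem mem_halfPlane {z : ℝ × ℝ} : z ∈ halfPlane ↔ 0 < z.1 := by simp [halfPlane]

/-- Extension by zero from the half plane. -/
def ext0 (f : ℝ × ℝ → ℝ) : ℝ × ℝ → ℝ := halfPlane.indicator f

theorem ext0_of_pos (f : ℝ × ℝ → ℝ) {t : ℝ} (ht : 0 < t) (x : ℝ) : ext0 f (t, x) = f (t, x) :=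
  indicator_of_mem (mem_halfPlane.2 ht) f

theorem ext0_of_nonpos (f : ℝ × ℝ → ℝ) {t : ℝ} (ht : t ≤ 0) (x : ℝ) : ext0 f (t, x) = 0 :=
  indicator_of_notMem (fun h => not_lt.2 ht (mem_halfPlane.1 h)) f

/-- Lebesgue measure on the strip `(0,T) × ℝ`. -/
def stripM (T : ℝ) : Measure (ℝ × ℝ) := (volume.restrict (Ioo 0 T)).prod volume

theorem stripM_eq (T : ℝ) : stripM T = volume.restrict (Ioo 0 T ×ˢ univ) := by
  rw [stripM, Measure.volume_eq_prod, ← Measure.prod_restrict, Measure.restrict_univ]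

theorem ae_stripM {p : ℝ × ℝ → Prop} {T : ℝ} (h : ∀ᵐ z : ℝ × ℝ, 0 < z.1 → p z) :
    ∀ᵐ z ∂stripM T, p z := by
  rw [stripM_eq, ae_restrict_iff' (measurableSet_Ioo.prod MeasurableSet.univ)]
  filter_upwards [h] with z hz hm using hz hm.1.1

theorem ae_Ioo_of_ae_pos {p : ℝ → Prop} {T : ℝ} (h : ∀ᵐ t : ℝ, 0 < t → p t) :
    ∀ᵐ t ∂volume.restrict (Ioo 0 T), p t := by
  rw [ae_restrict_iff' measurableSet_Ioo]
  filter_upwards [h] with t ht hm using ht hm.1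

theorem ae_slice_snd {p : ℝ × ℝ → Prop} (h : ∀ᵐ z : ℝ × ℝ, p z) : ∀ᵐ t : ℝ, ∀ᵐ x : ℝ, p (t, x) :=
  Measure.ae_ae_of_ae_prod h

theorem ae_swap {p : ℝ × ℝ → Prop} (h : ∀ᵐ z : ℝ × ℝ, p z) : ∀ᵐ z : ℝ × ℝ, p z.swap :=
  (Measure.measurePreserving_swap (μ := (volume : Measure ℝ)) (ν := (volume : Measure ℝ))
    ).quasiMeasurePreserving.ae h

theorem ae_slice_fst {p : ℝ × ℝ → Prop} (h : ∀ᵐ z : ℝ × ℝ, p z) : ∀ᵐ x : ℝ, ∀ᵐ t : ℝ, p (t, x) :=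
  Measure.ae_ae_of_ae_prod (ae_swap h)

theorem locallyIntegrable_ext0_of_integrableOn {f : ℝ × ℝ → ℝ}
    (h : ∀ n : ℕ, IntegrableOn f (Ioo 0 (n : ℝ) ×ˢ Ioo (-(n : ℝ)) n)) :
    LocallyIntegrable (ext0 f) volume := by
  rw [locallyIntegrable_iff_square]
  intro n
  rw [IntegrableOn, ext0, integrable_indicator_iff measurableSet_halfPlane, IntegrableOn,
    Measure.restrict_restrict measurableSet_halfPlane]
  refine (h n).mono_set ?_
  rintro z ⟨hz, hz1, hz2⟩
  exact ⟨⟨mem_halfPlane.1 hz, hz1.2⟩, hz2⟩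

theorem locallyIntegrable_ext0_of_integrable {f : ℝ × ℝ → ℝ}
    (h : ∀ T, Integrable f (stripM T)) : LocallyIntegrable (ext0 f) volume :=
  locallyIntegrable_ext0_of_integrableOn fun n =>
    IntegrableOn.mono_set (show IntegrableOn f (Ioo 0 (n : ℝ) ×ˢ univ) volume by
      rw [IntegrableOn, ← stripM_eq]; exact h n) (prod_mono subset_rfl (subset_univ _))

theorem locallyIntegrable_ext0 {f : ℝ × ℝ → ℝ} (h : ∀ T, MemLp f 2 (stripM T)) :
    LocallyIntegrable (ext0 f) volume := by
  refine locallyIntegrable_ext0_of_integrableOn fun n => ?_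
  have h2 : MemLp f 2 (volume.restrict (Ioo 0 (n : ℝ) ×ˢ Ioo (-(n : ℝ)) n)) :=
    (stripM_eq n ▸ h n).mono_measure
      (Measure.restrict_mono (prod_mono subset_rfl (subset_univ _)) le_rfl)
  have : IsFiniteMeasure (volume.restrict (Ioo 0 (n : ℝ) ×ˢ Ioo (-(n : ℝ)) n)) := by
    rw [Measure.volume_eq_prod, ← Measure.prod_restrict]; infer_instance
  exact h2.integrable (by norm_num)

theorem locallyIntegrableOn_of_ext0 {f : ℝ × ℝ → ℝ} (hf : LocallyIntegrable (ext0 f) volume) :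
    LocallyIntegrableOn f halfPlane volume := by
  intro z hz
  obtain ⟨s, hs, hi⟩ := hf z
  refine ⟨s ∩ halfPlane, inter_mem (mem_nhdsWithin_of_mem_nhds hs) self_mem_nhdsWithin, ?_⟩
  rw [inter_comm, IntegrableOn, ← Measure.restrict_restrict measurableSet_halfPlane]
  exact (integrable_indicator_iff measurableSet_halfPlane).1 hi

theorem memLp_strip_of_lintegral {f : ℝ × ℝ → ℝ} (hf : LocallyIntegrableOn f halfPlane volume)
    {T : ℝ} (h : ∫⁻ t in Ioo 0 T, (eLpNorm (fun x => f (t, x)) 2 volume) ^ (2 : ℝ) < ⊤) :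
    MemLp f 2 (stripM T) := by
  have hm : AEStronglyMeasurable f (stripM T) := by
    rw [stripM_eq]
    exact hf.aestronglyMeasurable.mono_measure (Measure.restrict_mono
      (fun z hz => mem_halfPlane.2 hz.1.1) le_rfl)
  refine ⟨hm, ?_⟩
  rw [eLpNorm_lt_top_iff_lintegral_rpow_enorm_lt_top (by norm_num) (by norm_num), stripM,
    lintegral_prod _ (by exact (hm.enorm.pow_const _))]
  refine lt_of_le_of_lt (lintegral_mono fun t => ?_) h
  rw [eLpNorm_eq_lintegral_rpow_enorm_toReal (by norm_num) (by norm_num)]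
  simp only [ENNReal.toReal_ofNat]
  rw [← ENNReal.rpow_mul]
  norm_num

theorem memLp_strip_top {f : ℝ × ℝ → ℝ} (hf : LocallyIntegrableOn f halfPlane volume)
    {T : ℝ} (h : mixedNorm ⊤ 2 (Ioo 0 T) f < ⊤) : MemLp f 2 (stripM T) := by
  refine memLp_strip_of_lintegral hf ?_
  rw [mixedNorm, eLpNorm_exponent_top] at h
  have hae : ∀ᵐ t ∂volume.restrict (Ioo 0 T), eLpNorm (fun x => f (t, x)) 2 volume ≤
      eLpNormEssSup (fun t => eLpNorm (fun x => f (t, x)) 2 volume) (volume.restrict (Ioo 0 T)) := by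
    simpa using ae_le_eLpNormEssSup (μ := volume.restrict (Ioo 0 T))
      (f := fun t => eLpNorm (fun x => f (t, x)) 2 volume)
  refine lt_of_le_of_lt (lintegral_mono_ae (hae.mono fun t ht =>
    ENNReal.rpow_le_rpow ht (by norm_num : (0 : ℝ) ≤ 2))) ?_
  rw [lintegral_const]
  exact ENNReal.mul_lt_top (ENNReal.rpow_lt_top_of_nonneg (by norm_num) h.ne) (by simp)

theorem memLp_strip_two {f : ℝ × ℝ → ℝ} (hf : LocallyIntegrableOn f halfPlane volume)
    {T : ℝ} (h : mixedNorm 2 2 (Ioo 0 T) f < ⊤) : MemLp f 2 (stripM T) := by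
  refine memLp_strip_of_lintegral hf ?_
  rw [mixedNorm, eLpNorm_lt_top_iff_lintegral_rpow_enorm_lt_top (by norm_num) (by norm_num)] at h
  simpa using h

theorem ae_eLpNorm_le_mixedNorm (f : ℝ × ℝ → ℝ) (T : ℝ) :
    ∀ᵐ t : ℝ, 0 < t → t < T →
      eLpNorm (fun x => f (t, x)) 2 volume ≤ mixedNorm ⊤ 2 (Ioo 0 T) f := by
  have := ae_le_eLpNormEssSup (μ := volume.restrict (Ioo 0 T))
      (f := fun t => eLpNorm (fun x => f (t, x)) 2 volume)
  rw [ae_restrict_iff' measurableSet_Ioo] at this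
  filter_upwards [this] with t ht h0 hT
  rw [mixedNorm, eLpNorm_exponent_top]
  simpa using ht ⟨h0, hT⟩

theorem HasWeakDeriv.congr {Ω : Set (ℝ × ℝ)} {e : ℝ × ℝ}
    {f g f' g' : ℝ × ℝ → ℝ} (h : HasWeakDeriv Ω e f g)
    (hf : f =ᵐ[volume.restrict Ω] f') (hg : g =ᵐ[volume.restrict Ω] g')
    : HasWeakDeriv Ω e f' g' := by
  have aux : ∀ {k k' : ℝ × ℝ → ℝ}, k =ᵐ[volume.restrict Ω] k' → LocallyIntegrableOn k Ω volume →
      LocallyIntegrableOn k' Ω volume := by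
    intro k k' hk hl z hz
    obtain ⟨s, hs, hi⟩ := hl z hz
    refine ⟨s ∩ Ω, inter_mem hs self_mem_nhdsWithin, ?_⟩
    refine (hi.mono_set inter_subset_left).congr_fun_ae ?_
    exact ae_mono (Measure.restrict_mono inter_subset_right le_rfl) hk
  refine ⟨aux hf h.1, aux hg h.2.1, fun φ h1 h2 h3 => ?_⟩
  have e1 := integral_congr_ae (hf.mul (ae_eq_refl fun z => fderiv ℝ φ z e))
  have e2 := integral_congr_ae (hg.mul (ae_eq_refl φ))
  simp only [Pi.mul_apply] at e1 e2
  rw [← e1, ← e2]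
  exact h.2.2 φ h1 h2 h3

theorem ae_restrict_halfPlane {p : ℝ × ℝ → Prop} :
    (∀ᵐ z ∂volume.restrict halfPlane, p z) ↔ ∀ᵐ z : ℝ × ℝ, 0 < z.1 → p z := by
  rw [ae_restrict_iff' measurableSet_halfPlane]
  simp only [mem_halfPlane]

/-! ### Weak derivatives on the half plane as primitives along lines -/

theorem fderiv_swap {φ : ℝ × ℝ → ℝ} (hφ : ContDiff ℝ 1 φ) (z : ℝ × ℝ) :
    fderiv ℝ (fun z : ℝ × ℝ => φ z.swap) z (1, 0) = fderiv ℝ φ z.swap (0, 1) := by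
  have h1 : ContDiff ℝ 1 fun z : ℝ × ℝ => φ z.swap := hφ.comp (contDiff_snd.prodMk contDiff_fst)
  have h2 := hasDerivAt_fst_of_contDiff h1 one_ne_zero z.1 z.2
  have h3 := hasDerivAt_snd_of_contDiff hφ one_ne_zero z.2 z.1
  exact h2.unique h3

theorem integral_swap (f : ℝ × ℝ → ℝ) : ∫ z : ℝ × ℝ, f z.swap = ∫ z, f z := by
  have := integral_prod_swap (μ := (volume : Measure ℝ)) (ν := (volume : Measure ℝ)) f
  exact this

theorem hasCompactSupport_swap {φ : ℝ × ℝ → ℝ} (h : HasCompactSupport φ) :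
    HasCompactSupport fun z : ℝ × ℝ => φ z.swap :=
  h.comp_homeomorph (Homeomorph.prodComm ℝ ℝ)

theorem tsupport_swap_subset {φ : ℝ × ℝ → ℝ} {s : Set (ℝ × ℝ)} (h : tsupport φ ⊆ s) :
    tsupport (fun z : ℝ × ℝ => φ z.swap) ⊆ Prod.swap ⁻¹' s :=
  (tsupport_comp_subset_preimage φ continuous_swap).trans (preimage_mono h)

/-- Integration by parts in the second variable against a test function. -/
theorem integral_mul_fderiv_snd {F f : ℝ × ℝ → ℝ} (hF : LocallyIntegrable F volume)
    (hf : LocallyIntegrable f volume) (h : ∀ᵐ t : ℝ, Prim (fun x => F (t, x)) (fun x => f (t, x)))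
    {φ : ℝ × ℝ → ℝ} (hφ : ContDiff ℝ 1 φ) (hc : HasCompactSupport φ) :
    ∫ z, F z * fderiv ℝ φ z (0, 1) = - ∫ z, f z * φ z := by
  have := integral_mul_fderiv_fst (locallyIntegrable_comp_swap hF) (locallyIntegrable_comp_swap hf)
    h (φ := fun z => φ z.swap) (hφ.comp (contDiff_snd.prodMk contDiff_fst))
    (hasCompactSupport_swap hc)
  simp only [fderiv_swap hφ] at this
  rw [integral_swap (fun z => F z * fderiv ℝ φ z (0, 1)), integral_swap (fun z => f z * φ z)] at this
  exact this

theorem setIntegral_halfPlane (f k : ℝ × ℝ → ℝ) :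
    ∫ z in halfPlane, f z * k z = ∫ z, ext0 f z * k z := by
  rw [← integral_indicator measurableSet_halfPlane]
  refine integral_congr_ae (.of_forall fun z => ?_)
  by_cases hz : z ∈ halfPlane <;> simp [ext0, hz]

theorem HasWeakDeriv.exists_primitive_snd {f g : ℝ × ℝ → ℝ} (h : HasWeakDx f g)
    (hf : LocallyIntegrable (ext0 f) volume) (hg : LocallyIntegrable (ext0 g) volume) :
    ∃ c : ℝ → ℝ, (∀ᵐ t : ℝ, 0 < t → LocallyIntegrable (fun x => g (t, x))) ∧
      ∀ᵐ z : ℝ × ℝ, 0 < z.1 → f z = c z.1 + ∫ y in (0 : ℝ)..z.2, g (z.1, y) := by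
  obtain ⟨c, -, hc⟩ := exists_eq_add_primitive (I := univ) (J := Ioi 0) isOpen_univ isOpen_Ioi
    ordConnected_univ 0 univ_nonempty (locallyIntegrable_comp_swap hf)
    (locallyIntegrable_comp_swap hg) fun φ h1 h2 h3 => by
      have hsw : ContDiff ℝ ∞ fun z : ℝ × ℝ => φ z.swap :=
        h1.comp (contDiff_snd.prodMk contDiff_fst)
      have := h.2.2 (fun z => φ z.swap) hsw (hasCompactSupport_swap h2)
        ((tsupport_swap_subset h3).trans fun z hz => mem_halfPlane.2 hz.2)
      rw [setIntegral_halfPlane, setIntegral_halfPlane] at this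
      rw [← integral_swap, ← integral_swap (fun z => ext0 g z.swap * φ z)]
      simp only [Prod.swap_swap]
      convert this using 3 with z
      have e := fderiv_swap (hsw.of_le (by simp)) z.swap
      simp only [Prod.swap_swap] at e
      rw [e]
  refine ⟨c, ?_, ?_⟩
  · filter_upwards [locallyIntegrable_slice_snd hg] with t hl h0
    exact hl.congr (.of_forall fun x => ext0_of_pos g h0 x)
  · filter_upwards [ae_swap hc] with z hz h0
    have := hz ⟨mem_univ _, h0⟩
    simpa [ext0_of_pos _ h0] using this

/-- The base point 1 is an arbitrary interior time. Since the extension of g by zero is integrable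
up to time 0, the primitive makes sense at t = 0 as well, which later gives meaning to initial
values. -/
theorem HasWeakDeriv.exists_primitive_fst {f g : ℝ × ℝ → ℝ} (h : HasWeakDt f g)
    (hf : LocallyIntegrable (ext0 f) volume) (hg : LocallyIntegrable (ext0 g) volume) :
    ∃ c : ℝ → ℝ, ∀ᵐ z : ℝ × ℝ, 0 < z.1 → f z = c z.2 + ∫ s in (1 : ℝ)..z.1, ext0 g (s, z.2) := by
  obtain ⟨c, -, hc⟩ := exists_eq_add_primitive (I := Ioi 0) (J := univ) isOpen_Ioi isOpen_univ
    ordConnected_Ioi 1 ⟨1, mem_Ioi.2 one_pos⟩ hf hg fun φ h1 h2 h3 => by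
      have := h.2.2 φ h1 h2 h3
      rwa [setIntegral_halfPlane, setIntegral_halfPlane] at this
  refine ⟨c, ?_⟩
  filter_upwards [hc] with z hz h0
  rw [← hz ⟨h0, mem_univ _⟩, ext0, indicator_of_mem (mem_halfPlane.2 h0)]

/-- A weak `x`-derivative from primitives on almost every line. -/
theorem hasWeakDx_of_prim {F f : ℝ × ℝ → ℝ} (hF : LocallyIntegrable (ext0 F) volume)
    (hf : LocallyIntegrable (ext0 f) volume)
    (h : ∀ᵐ t : ℝ, 0 < t → Prim (fun x => F (t, x)) (fun x => f (t, x))) : HasWeakDx F f := by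
  refine ⟨locallyIntegrableOn_of_ext0 hF, locallyIntegrableOn_of_ext0 hf, fun φ h1 h2 h3 => ?_⟩
  rw [setIntegral_halfPlane, setIntegral_halfPlane]
  refine integral_mul_fderiv_snd hF hf ?_ (h1.of_le (by simp)) h2
  filter_upwards [h] with t ht
  rcases lt_or_ge 0 t with h0 | h0
  · simpa only [ext0_of_pos _ h0] using ht h0
  · simpa only [ext0_of_nonpos _ h0] using Prim.const 0

/-- Reduction to the plane: f and g are regarded as functions of two variables that do not depend on
the second, and one good line is selected. -/
theorem hasWeakDerivLine_primitive {f g : ℝ → ℝ} (h : HasWeakDerivLine f g) :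
    ∃ c : ℝ, ∀ᵐ x : ℝ, f x = c + ∫ y in (0 : ℝ)..x, g y := by
  have hloc : ∀ {k : ℝ → ℝ}, LocallyIntegrable k volume →
      LocallyIntegrable (fun z : ℝ × ℝ => k z.1) volume := by
    intro k hk
    rw [locallyIntegrable_iff_square]
    intro n
    rw [integrableOn_square_iff]
    exact Integrable.comp_fst (locallyIntegrable_iff_Ioo.1 hk n) _
  have hf := locallyIntegrableOn_univ.1 h.1
  have hg := locallyIntegrableOn_univ.1 h.2.1
  obtain ⟨c, -, hc⟩ := exists_eq_add_primitive (I := univ) (J := univ) isOpen_univ isOpen_univ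
    ordConnected_univ 0 univ_nonempty (hloc hf) (hloc hg) fun φ h1 h2 h3 => by
      have hd : Continuous fun z => fderiv ℝ φ z (1, 0) :=
        (h1.continuous_fderiv (by simp)).clm_apply continuous_const
      have hdc : HasCompactSupport fun z => fderiv ℝ φ z (1, 0) := h2.fderiv_apply ℝ (1, 0)
      rw [Measure.volume_eq_prod,
        integral_prod_symm _
          (by exact (hloc hf).integrable_smul_right_of_hasCompactSupport hd hdc),
        integral_prod_symm _
          (by exact (hloc hg).integrable_smul_right_of_hasCompactSupport h1.continuous h2),
        ← integral_neg]
      refine integral_congr_ae (.of_forall fun y => ?_)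
      have := h.2.2 (fun s => φ (s, y)) (h1.comp (contDiff_id.prodMk contDiff_const))
        (h2.slice_fst y) (subset_univ _)
      simp only [Measure.restrict_univ] at this
      change _ = -∫ x : ℝ, g x * φ (x, y)
      rw [← this]
      refine integral_congr_ae (.of_forall fun s => ?_)
      simp only
      rw [← (hasDerivAt_fst_of_contDiff h1 (by simp) s y).deriv]
      rfl
  have := (ae_slice_fst hc).exists
  obtain ⟨y, hy⟩ := this
  exact ⟨c y, hy.mono fun x hx => hx ⟨mem_univ _, mem_univ _⟩⟩

/-! ### The flux function -/

/-- The stress together with the linear viscosity. -/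
def flux (ε p : ℝ) : ℝ := stress ε p + ε * p

theorem sqrt_pos_of_eps {ε : ℝ} (hε : 0 < ε) (p : ℝ) : 0 < √(|p| ^ 2 + ε ^ 2) :=
  Real.sqrt_pos.2 (by positivity)

theorem hasDerivAt_stress {ε : ℝ} (hε : 0 < ε) (p : ℝ) :
    HasDerivAt (stress ε) (ε ^ 2 / √(p ^ 2 + ε ^ 2) ^ 3) p := by
  have hpos : 0 < p ^ 2 + ε ^ 2 := by positivity
  have hs : 0 < √(p ^ 2 + ε ^ 2) := Real.sqrt_pos.2 hpos
  have h1 : HasDerivAt (fun p : ℝ => √(p ^ 2 + ε ^ 2)) (2 * p / (2 * √(p ^ 2 + ε ^ 2))) p := by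
    have : HasDerivAt (fun p : ℝ => p ^ 2 + ε ^ 2) (2 * p) p := by
      simpa using (hasDerivAt_pow 2 p).add_const (ε ^ 2)
    exact this.sqrt hpos.ne'
  have h2 := (hasDerivAt_id p).div h1 hs.ne'
  have e : stress ε = fun p => id p / √(p ^ 2 + ε ^ 2) := by
    funext q; simp [stress, sq_abs]
  rw [e]
  refine h2.congr_deriv ?_
  have hsq : √(p ^ 2 + ε ^ 2) ^ 2 = p ^ 2 + ε ^ 2 := Real.sq_sqrt hpos.le
  simp only [id_eq]
  field_simp
  linear_combination hsq

theorem contDiff_stress {ε : ℝ} (hε : 0 < ε) : ContDiff ℝ 1 (stress ε) := by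
  unfold stress
  simp only [sq_abs]
  refine contDiff_id.div (ContDiff.sqrt (by fun_prop) fun p => by positivity) fun p => ?_
  have : 0 < √(p ^ 2 + ε ^ 2) := Real.sqrt_pos.2 (by positivity)
  exact this.ne'

theorem contDiff_flux {ε : ℝ} (hε : 0 < ε) : ContDiff ℝ 1 (flux ε) :=
  (contDiff_stress hε).add (contDiff_const.mul contDiff_id)

theorem deriv_flux_nonneg {ε : ℝ} (hε : 0 < ε) (p : ℝ) : 0 ≤ deriv (flux ε) p := by
  have h : HasDerivAt (flux ε) (ε ^ 2 / √(p ^ 2 + ε ^ 2) ^ 3 + ε * 1) p :=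
    (hasDerivAt_stress hε p).add ((hasDerivAt_id p).const_mul ε)
  rw [h.deriv]; positivity

theorem monotone_flux {ε : ℝ} (hε : 0 < ε) : Monotone (flux ε) :=
  monotone_of_deriv_nonneg ((contDiff_flux hε).differentiable one_ne_zero) (deriv_flux_nonneg hε)

theorem flux_zero (ε : ℝ) : flux ε 0 = 0 := by simp [flux, stress]

theorem flux_pos_iff {ε : ℝ} (hε : 0 < ε) (p : ℝ) : 0 < flux ε p ↔ 0 < p := by
  refine ⟨fun h => ?_, fun h => ?_⟩
  · by_contra hp
    exact absurd ((monotone_flux hε (not_lt.1 hp)).trans (flux_zero ε).le) (not_le.2 h)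
  · unfold flux stress
    have := sqrt_pos_of_eps hε p
    positivity

theorem abs_flux_le {ε : ℝ} (hε : 0 < ε) (p : ℝ) : |flux ε p| ≤ (1 / ε + ε) * |p| := by
  have h1 : ε ≤ √(|p| ^ 2 + ε ^ 2) := Real.le_sqrt_of_sq_le (by nlinarith [sq_nonneg |p|])
  have h2 : |stress ε p| ≤ 1 / ε * |p| := by
    rw [stress, abs_div, abs_of_pos (sqrt_pos_of_eps hε p), div_eq_mul_inv, mul_comm, ← one_div]
    gcongr
  calc |flux ε p| ≤ |stress ε p| + |ε * p| := abs_add_le _ _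
    _ ≤ 1 / ε * |p| + ε * |p| := by rw [abs_mul, abs_of_pos hε]; gcongr
    _ = _ := by ring

/-! ### Regularity of a solution on lines -/

theorem memLp_slice {f : ℝ × ℝ → ℝ} (h : ∀ T, MemLp f 2 (stripM T)) :
    ∀ᵐ t : ℝ, 0 < t → MemLp (fun x => f (t, x)) 2 := by
  have : ∀ᵐ t : ℝ, ∀ n : ℕ, t ∈ Ioo 0 (n : ℝ) → MemLp (fun x => f (t, x)) 2 := by
    refine ae_all_iff.2 fun n => (ae_restrict_iff' measurableSet_Ioo).1 ?_
    have h1 := (h n).1.prodMk_left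
    have h2 := ((memLp_two_iff_integrable_sq (h n).1).1 (h n)).prod_right_ae
    filter_upwards [h1, h2] with t h1 h2
    exact (memLp_two_iff_integrable_sq h1).2 h2
  filter_upwards [this] with t ht h0
  obtain ⟨n, hn⟩ := exists_nat_gt t
  exact ht n ⟨h0, hn⟩

/-- The regularity that a solution has on almost all horizontal and vertical lines:
`v = ∂_x u`, `a = ∂_xx u`, `w = ∂_t u`, `b = ∂_x ∂_t u`. -/
structure Regular (ε : ℝ) (u v a w b : ℝ × ℝ → ℝ) : Prop where
  cont : ContinuousOn u (Ici (0 : ℝ) ×ˢ (univ : Set ℝ))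
  memLp_u : ∀ T, MemLp u 2 (stripM T)
  memLp_v : ∀ T, MemLp v 2 (stripM T)
  memLp_a : ∀ T, MemLp a 2 (stripM T)
  memLp_w : ∀ T, MemLp w 2 (stripM T)
  memLp_b : ∀ T, MemLp b 2 (stripM T)
  prim_u : ∀ᵐ t : ℝ, 0 < t → Prim (fun x => u (t, x)) (fun x => v (t, x))
  prim_v : ∀ᵐ t : ℝ, 0 < t → Prim (fun x => v (t, x)) (fun x => a (t, x))
  prim_w : ∀ᵐ t : ℝ, 0 < t → Prim (fun x => w (t, x)) (fun x => b (t, x))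
  prim_flux : ∀ᵐ t : ℝ, 0 < t →
    Prim (fun x => flux ε (v (t, x)) - u (t, x) ^ 2 / 2) (fun x => w (t, x))
  time_u : ∀ᵐ x : ℝ, ∀ T, 0 ≤ T → PrimOn (fun t => u (t, x)) (fun t => w (t, x)) 0 T
  time_v : ∃ V : ℝ × ℝ → ℝ, (∀ᵐ z : ℝ × ℝ, 0 < z.1 → V z = v z) ∧
    ∀ᵐ x : ℝ, ∀ T, 0 ≤ T → PrimOn (fun t => V (t, x)) (fun t => b (t, x)) 0 T
  bounds : ∀ T, ∃ C : ENNReal, C < ⊤ ∧ ∀ᵐ t : ℝ, 0 < t → t < T →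
    eLpNorm (fun x => u (t, x)) 2 volume ≤ C ∧ eLpNorm (fun x => v (t, x)) 2 volume ≤ C ∧
    eLpNorm (fun x => a (t, x)) 2 volume ≤ C

theorem contDiff_fderiv_apply {φ : ℝ × ℝ → ℝ} (hφ : ContDiff ℝ ∞ φ) (e : ℝ × ℝ) :
    ContDiff ℝ ∞ fun z => fderiv ℝ φ z e :=
  (hφ.fderiv_right (m := ∞) (by simp)).clm_apply contDiff_const

theorem fderiv_fderiv_comm {φ : ℝ × ℝ → ℝ} (hφ : ContDiff ℝ ∞ φ) (e e' : ℝ × ℝ) (z : ℝ × ℝ) :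
    fderiv ℝ (fun z => fderiv ℝ φ z e) z e' = fderiv ℝ (fun z => fderiv ℝ φ z e') z e := by
  have hd : DifferentiableAt ℝ (fderiv ℝ φ) z :=
    ((hφ.fderiv_right (m := ∞) (by simp)).differentiable (by simp)) z
  have h1 : ∀ e e' : ℝ × ℝ, fderiv ℝ (fun z => fderiv ℝ φ z e) z e' =
      fderiv ℝ (fderiv ℝ φ) z e' e := by
    intro e e'
    have h := (hd.hasFDerivAt.clm_apply (hasFDerivAt_const e z)).fderiv
    rw [h]; simp
  rw [h1, h1]
  have h2 : ContDiff ℝ 2 φ := by exact_mod_cast contDiff_infty.1 hφ 2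
  have : IsSymmSndFDerivAt ℝ φ z := h2.contDiffAt.isSymmSndFDerivAt (by
    rw [minSmoothness_of_isRCLikeNormedField])
  exact this.eq _ _

theorem tsupport_fderiv_apply {φ : ℝ × ℝ → ℝ} (e : ℝ × ℝ) :
    tsupport (fun z => fderiv ℝ φ z e) ⊆ tsupport φ := by
  exact tsupport_fderiv_apply_subset ℝ e

/-- Second derivatives of test functions commute, so ∂_t ∂_x u = ∂_x ∂_t u. This supplies the
evolution of v needed for Oleinik's condition without differentiating the equation. -/
theorem HasWeakDeriv.mixed {u v w b : ℝ × ℝ → ℝ} (huv : HasWeakDx u v) (huw : HasWeakDt u w)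
    (hwb : HasWeakDx w b) : HasWeakDt v b := by
  refine ⟨huv.2.1, hwb.2.1, fun φ h1 h2 h3 => ?_⟩
  have e1 := huv.2.2 (fun z => fderiv ℝ φ z (1, 0)) (contDiff_fderiv_apply h1 _)
    (h2.fderiv_apply ℝ _) ((tsupport_fderiv_apply _).trans h3)
  have e2 := huw.2.2 (fun z => fderiv ℝ φ z (0, 1)) (contDiff_fderiv_apply h1 _)
    (h2.fderiv_apply ℝ _) ((tsupport_fderiv_apply _).trans h3)
  have e3 := hwb.2.2 φ h1 h2 h3
  simp only [fderiv_fderiv_comm h1 (1, 0) (0, 1)] at e1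
  linarith

theorem continuous_slice {u : ℝ × ℝ → ℝ} (h : ContinuousOn u (Ici (0 : ℝ) ×ˢ (univ : Set ℝ)))
    {t : ℝ} (ht : 0 ≤ t) : Continuous fun x => u (t, x) := by
  rw [← continuousOn_univ]
  exact h.comp (continuous_const.prodMk continuous_id).continuousOn fun x _ => ⟨ht, mem_univ _⟩

theorem continuousOn_time {u : ℝ × ℝ → ℝ} (h : ContinuousOn u (Ici (0 : ℝ) ×ˢ (univ : Set ℝ)))
    (x : ℝ) : ContinuousOn (fun t => u (t, x)) (Ici 0) :=
  h.comp (continuous_id.prodMk continuous_const).continuousOn fun _ ht => ⟨ht, mem_univ _⟩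

theorem memLp_strip_of_pos {f : ℝ × ℝ → ℝ} (h : ∀ T, 0 < T → MemLp f 2 (stripM T)) (T : ℝ) :
    MemLp f 2 (stripM T) := by
  rcases lt_or_ge 0 T with hT | hT
  · exact h T hT
  · rw [stripM, Ioo_eq_empty (not_lt.2 hT), Measure.restrict_empty, Measure.zero_prod]
    simp

theorem HasWeakDeriv.exists_prim {f g : ℝ × ℝ → ℝ} (h : HasWeakDx f g)
    (hf : LocallyIntegrable (ext0 f) volume) (hg : LocallyIntegrable (ext0 g) volume) :
    ∃ F : ℝ × ℝ → ℝ, (∀ᵐ z : ℝ × ℝ, 0 < z.1 → f z = F z) ∧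
      ∀ᵐ t : ℝ, 0 < t → Prim (fun x => F (t, x)) (fun x => g (t, x)) := by
  obtain ⟨c, hl, hc⟩ := h.exists_primitive_snd hf hg
  refine ⟨fun z => c z.1 + ∫ y in (0 : ℝ)..z.2, g (z.1, y), hc, ?_⟩
  filter_upwards [hl] with t ht h0
  exact Prim.of_eq_integral (ht h0) 0 (c t) fun x => rfl

theorem HasWeakDeriv.prim_of_continuous {f g : ℝ × ℝ → ℝ} (h : HasWeakDx f g)
    (hf : LocallyIntegrable (ext0 f) volume) (hg : LocallyIntegrable (ext0 g) volume)
    (hc : ∀ᵐ t : ℝ, 0 < t → Continuous fun x => f (t, x)) :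
    ∀ᵐ t : ℝ, 0 < t → Prim (fun x => f (t, x)) (fun x => g (t, x)) := by
  obtain ⟨F, hF, hp⟩ := h.exists_prim hf hg
  filter_upwards [ae_slice_snd hF, hp, hc] with t h1 h2 h3 h0
  have : (fun x => f (t, x)) = fun x => F (t, x) :=
    ((h3 h0).ae_eq_iff_eq volume (h2 h0).continuous).1 (h1.mono fun x hx => hx h0)
  rw [this]
  exact h2 h0

theorem ae_ne_zero : ∀ᵐ t : ℝ, t ≠ 0 := by simp [ae_iff, measure_singleton]

theorem HasWeakDeriv.exists_prim_time {f g : ℝ × ℝ → ℝ} (h : HasWeakDt f g)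
    (hf : LocallyIntegrable (ext0 f) volume) (hg : LocallyIntegrable (ext0 g) volume) :
    ∃ F : ℝ × ℝ → ℝ, (∀ᵐ z : ℝ × ℝ, 0 < z.1 → F z = f z) ∧
      ∀ᵐ x : ℝ, ∀ T, 0 ≤ T → PrimOn (fun t => F (t, x)) (fun t => g (t, x)) 0 T := by
  obtain ⟨c, hc⟩ := h.exists_primitive_fst hf hg
  refine ⟨fun z => c z.2 + ∫ s in (1 : ℝ)..z.1, ext0 g (s, z.2),
    hc.mono fun z hz h0 => (hz h0).symm, ?_⟩
  filter_upwards [locallyIntegrable_slice_fst hg] with x hx T hT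
  have := Prim.of_eq_integral (F := fun t => c x + ∫ s in (1 : ℝ)..t, ext0 g (s, x)) hx 1 (c x)
    fun t => rfl
  refine (this 0 T).congr_ae ?_
  filter_upwards [ae_ne_zero] with t ht hm
  rw [uIcc_of_le hT] at hm
  exact ext0_of_pos g (lt_of_le_of_ne hm.1 ht.symm) x

theorem primOn_congr_left {F G f : ℝ → ℝ} {a b : ℝ} (h : PrimOn F f a b)
    (he : EqOn F G (uIcc a b)) : PrimOn G f a b := by
  refine .of_eq_integral h.intervalIntegrable fun t ht => ?_
  rw [← he ht, ← he left_mem_uIcc, h.eq_add ht]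

theorem HasWeakDeriv.prim_time_of_continuous {u g : ℝ × ℝ → ℝ} (h : HasWeakDt u g)
    (hf : LocallyIntegrable (ext0 u) volume) (hg : LocallyIntegrable (ext0 g) volume)
    (hc : ContinuousOn u (Ici (0 : ℝ) ×ˢ (univ : Set ℝ))) :
    ∀ᵐ x : ℝ, ∀ T, 0 ≤ T → PrimOn (fun t => u (t, x)) (fun t => g (t, x)) 0 T := by
  obtain ⟨F, hF, hp⟩ := h.exists_prim_time hf hg
  filter_upwards [ae_slice_fst hF, hp] with x h1 h2 T hT
  refine primOn_congr_left (h2 T hT) ?_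
  rcases hT.eq_or_lt with rfl | hT'
  -- On a degenerate interval an almost everywhere identity says nothing; the value at 0 is read off
  -- from [0, 1].
  · have key : EqOn (fun t => F (t, x)) (fun t => u (t, x)) (Icc 0 1) := by
      have hcF := (h2 1 zero_le_one).continuousOn
      rw [uIcc_of_le zero_le_one] at hcF
      have hcu := (continuousOn_time hc x).mono (fun t (ht : t ∈ Icc 0 1) => ht.1)
      refine Measure.eqOn_Icc_of_ae_eq (μ := volume) zero_ne_one ?_ hcF hcu
      rw [EventuallyEq, ae_restrict_iff' measurableSet_Icc]
      filter_upwards [h1, ae_ne_zero] with t ht hne hm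
      exact ht (lt_of_le_of_ne hm.1 hne.symm)
    intro t ht
    rw [uIcc_self] at ht
    exact key (by rw [mem_singleton_iff.1 ht]; simp)
  · have hcF := (h2 T hT).continuousOn
    rw [uIcc_of_le hT] at hcF ⊢
    have hcu := (continuousOn_time hc x).mono (fun t (ht : t ∈ Icc 0 T) => ht.1)
    refine Measure.eqOn_Icc_of_ae_eq (μ := volume) hT'.ne ?_ hcF hcu
    rw [EventuallyEq, ae_restrict_iff' measurableSet_Icc]
    filter_upwards [h1, ae_ne_zero] with t ht hne hm
    exact ht (lt_of_le_of_ne hm.1 hne.symm)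

theorem integrable_mul_test {f : ℝ × ℝ → ℝ} (hf : LocallyIntegrable (ext0 f) volume)
    {k : ℝ × ℝ → ℝ} (hk : Continuous k) (hc : HasCompactSupport k) :
    Integrable (fun z => f z * k z) (volume.restrict halfPlane) := by
  have h1 : Integrable fun z => ext0 f z * k z := hf.integrable_smul_right_of_hasCompactSupport hk hc
  refine (integrable_indicator_iff measurableSet_halfPlane).1 (h1.congr (.of_forall fun z => ?_))
  by_cases hz : z ∈ halfPlane <;> simp [ext0, hz]

theorem memLp_flux {ε : ℝ} (hε : 0 < ε) {α : Type*} [MeasurableSpace α] {μ : Measure α}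
    {p : α → ℝ} (h : MemLp p 2 μ) : MemLp (fun z => flux ε (p z)) 2 μ :=
  h.of_le_mul ((contDiff_flux hε).continuous.comp_aestronglyMeasurable h.1)
    (.of_forall fun z => abs_flux_le hε (p z))

theorem locallyIntegrable_ext0_flux_sub {ε : ℝ} (hε : 0 < ε) {u v : ℝ × ℝ → ℝ}
    (hu : ∀ T, MemLp u 2 (stripM T)) (hv : ∀ T, MemLp v 2 (stripM T)) :
    LocallyIntegrable (ext0 fun z => flux ε (v z) - u z ^ 2 / 2) volume := by
  have h1 := locallyIntegrable_ext0 (fun T => memLp_flux hε (hv T))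
  have h2 := locallyIntegrable_ext0_of_integrable fun T => ((hu T).integrable_sq.div_const 2)
  refine (h1.sub h2).congr (.of_forall fun z => ?_)
  by_cases hz : z ∈ halfPlane <;> simp [ext0, hz]

/-- A solution has the regularity of `Regular`, for suitable versions of its derivatives. -/
theorem IsSolution.exists_regular {ε : ℝ} (hε : 0 < ε) {uin : ℝ → ℝ} {u : ℝ × ℝ → ℝ}
    (hu : IsSolution ε uin u) :
    ∃ v a w b : ℝ × ℝ → ℝ, Regular ε u v a w b ∧ HasWeakDx u v ∧ HasWeakDt u w ∧
      ∀ φ : ℝ × ℝ → ℝ, ContDiff ℝ 1 φ → HasCompactSupport φ →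
        (∫ z in halfPlane, u z * fderiv ℝ φ z (1, 0)) -
          (∫ z in halfPlane, (flux ε (v z) - u z ^ 2 / 2) * fderiv ℝ φ z (0, 1)) +
          ∫ x : ℝ, uin x * φ (0, x) = 0 := by
  obtain ⟨ux, uxx, ut, utx, hux, huxx, hut, hutx, hN, hW⟩ := hu.regularity_and_weak_form
  have mu : ∀ T, MemLp u 2 (stripM T) :=
    memLp_strip_of_pos fun T hT => memLp_strip_top hux.1 (hN T hT).1
  have mux : ∀ T, MemLp ux 2 (stripM T) :=
    memLp_strip_of_pos fun T hT => memLp_strip_top huxx.1 (hN T hT).2.1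
  have ma : ∀ T, MemLp uxx 2 (stripM T) :=
    memLp_strip_of_pos fun T hT => memLp_strip_top huxx.2.1 (hN T hT).2.2.1
  have mt : ∀ T, MemLp ut 2 (stripM T) :=
    memLp_strip_of_pos fun T hT => memLp_strip_two hutx.1 (hN T hT).2.2.2.2.1
  have mb : ∀ T, MemLp utx 2 (stripM T) :=
    memLp_strip_of_pos fun T hT => memLp_strip_two hutx.2.1 (hN T hT).2.2.2.2.2
  -- The derivatives are replaced by versions that are primitives in x on almost every horizontal
  -- line. The version of v that is good in t is a different function, kept separately in `time_v`.
  obtain ⟨v, hv, pv⟩ := huxx.exists_prim (locallyIntegrable_ext0 mux) (locallyIntegrable_ext0 ma)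
  obtain ⟨w, hw, pw⟩ := hutx.exists_prim (locallyIntegrable_ext0 mt) (locallyIntegrable_ext0 mb)
  have mv : ∀ T, MemLp v 2 (stripM T) := fun T => (memLp_congr_ae (ae_stripM hv)).1 (mux T)
  have mw : ∀ T, MemLp w 2 (stripM T) := fun T => (memLp_congr_ae (ae_stripM hw)).1 (mt T)
  have hv' := ae_restrict_halfPlane.2 hv
  have hw' := ae_restrict_halfPlane.2 hw
  have huv : HasWeakDx u v := hux.congr (ae_eq_refl _) hv'
  have huw : HasWeakDt u w := hut.congr (ae_eq_refl _) hw'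
  have hwb : HasWeakDx w utx := hutx.congr hw' (ae_eq_refl _)
  have hvb : HasWeakDt v utx := huv.mixed huw hwb
  have lu := locallyIntegrable_ext0 mu
  have lv := locallyIntegrable_ext0 mv
  have lw := locallyIntegrable_ext0 mw
  have lP := locallyIntegrable_ext0_flux_sub hε mu mv
  have pu := huv.prim_of_continuous lu lv
    (.of_forall fun t ht => continuous_slice hu.continuousOn ht.le)
  have hweak : ∀ φ : ℝ × ℝ → ℝ, ContDiff ℝ 1 φ → HasCompactSupport φ →
        (∫ z in halfPlane, u z * fderiv ℝ φ z (1, 0)) -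
          (∫ z in halfPlane, (flux ε (v z) - u z ^ 2 / 2) * fderiv ℝ φ z (0, 1)) +
          ∫ x : ℝ, uin x * φ (0, x) = 0 := by
    intro φ h1 h2
    have hd : ∀ e, Continuous fun z => fderiv ℝ φ z e := fun e =>
      (h1.continuous_fderiv one_ne_zero).clm_apply continuous_const
    have hdc : ∀ e, HasCompactSupport fun z => fderiv ℝ φ z e := fun e => h2.fderiv_apply ℝ e
    have h3 := hW φ h1 h2
    rw [← integral_sub (integrable_mul_test lu (hd _) (hdc _))
      (integrable_mul_test lP (hd _) (hdc _))]
    refine Eq.trans ?_ h3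
    congr 1
    refine integral_congr_ae ?_
    filter_upwards [hv'] with z hz
    rw [hz, flux]
    ring
  -- For a test function supported in the open half plane the datum term disappears, and the weak
  -- form turns into ∂_x P = ∂_t u.
  have hPw : HasWeakDx (fun z => flux ε (v z) - u z ^ 2 / 2) w := by
    refine ⟨locallyIntegrableOn_of_ext0 lP, locallyIntegrableOn_of_ext0 lw, fun φ h1 h2 h3 => ?_⟩
    have e1 := hweak φ (h1.of_le (by simp)) h2
    have e2 : ∫ x : ℝ, uin x * φ (0, x) = 0 := by
      refine integral_eq_zero_of_ae (.of_forall fun x => ?_)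
      have : φ (0, x) = 0 := image_eq_zero_of_notMem_tsupport fun hm =>
        lt_irrefl _ (mem_halfPlane.1 (h3 hm))
      simp [this]
    rw [e2, huw.2.2 φ h1 h2 h3] at e1
    linarith
  refine ⟨v, uxx, w, utx, ⟨hu.continuousOn, mu, mv, ma, mw, mb, pu, pv, pw, ?_, ?_, ?_, ?_⟩,
    huv, huw, hweak⟩
  · refine hPw.prim_of_continuous lP lw ?_
    filter_upwards [pv] with t ht h0
    exact ((contDiff_flux hε).continuous.comp (ht h0).continuous).sub
      (((continuous_slice hu.continuousOn h0.le).pow 2).div_const 2)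
  · exact huw.prim_time_of_continuous lu lw hu.continuousOn
  · exact hvb.exists_prim_time lv (locallyIntegrable_ext0 mb)
  · intro T
    rcases lt_or_ge 0 T with hT | hT
    · refine ⟨max (mixedNorm ⊤ 2 (Ioo 0 T) u) (max (mixedNorm ⊤ 2 (Ioo 0 T) ux)
        (mixedNorm ⊤ 2 (Ioo 0 T) uxx)), max_lt (hN T hT).1 (max_lt (hN T hT).2.1 (hN T hT).2.2.1), ?_⟩
      filter_upwards [ae_eLpNorm_le_mixedNorm u T, ae_eLpNorm_le_mixedNorm ux T,
        ae_eLpNorm_le_mixedNorm uxx T, ae_slice_snd hv] with t h1 h2 h3 h4 h0 h5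
      refine ⟨(h1 h0 h5).trans (le_max_left _ _), ?_,
        ((h3 h0 h5).trans (le_max_right _ _)).trans (le_max_right _ _)⟩
      rw [← eLpNorm_congr_ae (h4.mono fun x hx => hx h0)]
      exact ((h2 h0 h5).trans (le_max_left _ _)).trans (le_max_right _ _)
    · exact ⟨0, by simp, .of_forall fun t h0 h1 => absurd (h0.trans h1) (not_lt.2 hT)⟩

/-! ### Attainment of the initial datum -/

section

variable {ε : ℝ} {u v a w b : ℝ × ℝ → ℝ}

theorem continuous_extend_past (hu : ContinuousOn u (Ici (0 : ℝ) ×ˢ (univ : Set ℝ))) :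
    Continuous fun z : ℝ × ℝ => u (max z.1 0, z.2) := by
  rw [← continuousOn_univ]
  exact hu.comp (by fun_prop) fun z _ => ⟨mem_Ici.2 (le_max_right _ _), mem_univ _⟩

/-- Freezing u at its initial value for negative times makes it absolutely continuous on the whole
time line, with derivative 0 in the past. Test functions that do not vanish at t = 0 can then be
used. -/
theorem Regular.prim_time (h : Regular ε u v a w b) :
    ∀ᵐ x : ℝ, Prim (fun t => u (max t 0, x)) (fun t => ext0 w (t, x)) := by
  filter_upwards [h.time_u, locallyIntegrable_slice_fst (locallyIntegrable_ext0 h.memLp_w)]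
    with x hx hl
  refine Prim.of_eq_integral hl 0 (u (0, x)) fun t => ?_
  rcases le_total 0 t with ht | ht
  · rw [max_eq_left ht, (hx t ht).eq_add right_mem_uIcc]
    congr 1
    refine intervalIntegral.integral_congr_ae (.of_forall fun s hs => ?_)
    rw [uIoc_of_le ht] at hs
    exact (ext0_of_pos w hs.1 x).symm
  · rw [max_eq_right ht, left_eq_add]
    refine intervalIntegral.integral_zero_ae (.of_forall fun s hs => ?_)
    rw [uIoc_of_ge ht] at hs
    exact ext0_of_nonpos w hs.2 x

theorem integral_past {f : ℝ → ℝ} (hf : Continuous f) {φ : ℝ × ℝ → ℝ} (hφ : ContDiff ℝ 1 φ)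
    (hc : HasCompactSupport φ) :
    ∫ z in halfPlaneᶜ, f z.2 * fderiv ℝ φ z (1, 0) = ∫ x, f x * φ (0, x) := by
  have hd : Continuous fun z => fderiv ℝ φ z (1, 0) :=
    (hφ.continuous_fderiv one_ne_zero).clm_apply continuous_const
  have hdc : HasCompactSupport fun z => fderiv ℝ φ z (1, 0) := hc.fderiv_apply ℝ (1, 0)
  have hi : Integrable fun z : ℝ × ℝ => f z.2 * fderiv ℝ φ z (1, 0) :=
    ((hf.comp continuous_snd).mul hd).integrable_of_hasCompactSupport hdc.mul_left
  have e : halfPlaneᶜ = Iic (0 : ℝ) ×ˢ (univ : Set ℝ) := by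
    ext z; simp [halfPlane]
  rw [e, Measure.volume_eq_prod, ← Measure.prod_restrict, Measure.restrict_univ,
    integral_prod_symm]
  · refine integral_congr_ae (.of_forall fun x => ?_)
    simp only
    rw [integral_const_mul]
    congr 1
    have hx : Continuous fun t => fderiv ℝ φ (t, x) (1, 0) :=
      hd.comp (continuous_id.prodMk continuous_const)
    have h1 := integral_Iic_of_hasDerivAt_of_tendsto (f := fun t => φ (t, x)) (a := (0 : ℝ))
      (m := 0) (f' := fun t => fderiv ℝ φ (t, x) (1, 0))
      (hφ.continuous.comp (continuous_id.prodMk continuous_const)).continuousWithinAt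
      (fun t _ => hasDerivAt_fst_of_contDiff hφ one_ne_zero t x)
      (hx.integrable_of_hasCompactSupport (hdc.slice_fst x)).integrableOn ?_
    · rw [h1, sub_zero]
    · exact ((hc.slice_fst x).is_zero_at_infty).mono_left atBot_le_cocompact
  · have := hi.integrableOn (s := Iic (0 : ℝ) ×ˢ (univ : Set ℝ))
    rwa [IntegrableOn, Measure.volume_eq_prod, ← Measure.prod_restrict,
      Measure.restrict_univ] at this

/-- Integrating the frozen extension of u by parts over the whole plane produces ∫ u(0,x) φ(0,x)
from the past. Comparison with the weak form, whose boundary term is ∫ uin φ(0,x), identifies the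
datum. -/
theorem Regular.initial (hε : 0 < ε) (h : Regular ε u v a w b) {uin : ℝ → ℝ}
    (hin : LocallyIntegrable uin volume)
    (hW : ∀ φ : ℝ × ℝ → ℝ, ContDiff ℝ 1 φ → HasCompactSupport φ →
        (∫ z in halfPlane, u z * fderiv ℝ φ z (1, 0)) -
          (∫ z in halfPlane, (flux ε (v z) - u z ^ 2 / 2) * fderiv ℝ φ z (0, 1)) +
          ∫ x : ℝ, uin x * φ (0, x) = 0) :
    ∀ᵐ x : ℝ, uin x = u (0, x) := by
  have hu0 := continuous_slice h.cont le_rfl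
  have hU := continuous_extend_past h.cont
  have lw := locallyIntegrable_ext0 h.memLp_w
  have lP := locallyIntegrable_ext0_flux_sub hε h.memLp_u h.memLp_v
  have key : ∀ φ : ℝ × ℝ → ℝ, ContDiff ℝ 1 φ → HasCompactSupport φ →
      ∫ x, uin x * φ (0, x) = ∫ x, u (0, x) * φ (0, x) := by
    intro φ h1 h2
    have hd : Continuous fun z => fderiv ℝ φ z (1, 0) :=
      (h1.continuous_fderiv one_ne_zero).clm_apply continuous_const
    have hdc : HasCompactSupport fun z => fderiv ℝ φ z (1, 0) := h2.fderiv_apply ℝ (1, 0)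
    have e1 := integral_mul_fderiv_fst hU.locallyIntegrable lw h.prim_time h1 h2
    have e2 := integral_mul_fderiv_snd lP lw (by
      filter_upwards [h.prim_flux] with t ht
      rcases lt_or_ge 0 t with h0 | h0
      · simpa only [ext0_of_pos _ h0] using ht h0
      · simpa only [ext0_of_nonpos _ h0] using Prim.const 0) h1 h2
    have e3 := hW φ h1 h2
    rw [setIntegral_halfPlane (fun z => flux ε (v z) - u z ^ 2 / 2), e2] at e3
    have hi : Integrable fun z : ℝ × ℝ => u (max z.1 0, z.2) * fderiv ℝ φ z (1, 0) :=
      (hU.mul hd).integrable_of_hasCompactSupport hdc.mul_left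
    rw [← integral_add_compl measurableSet_halfPlane hi] at e1
    have e4 : ∫ z in halfPlane, u (max z.1 0, z.2) * fderiv ℝ φ z (1, 0) =
        ∫ z in halfPlane, u z * fderiv ℝ φ z (1, 0) :=
      setIntegral_congr_fun measurableSet_halfPlane fun z hz => by
        simp only [max_eq_left (mem_halfPlane.1 hz).le]
    have e5 : ∫ z in halfPlaneᶜ, u (max z.1 0, z.2) * fderiv ℝ φ z (1, 0) =
        ∫ z in halfPlaneᶜ, u (0, z.2) * fderiv ℝ φ z (1, 0) :=
      setIntegral_congr_fun measurableSet_halfPlane.compl fun z hz => by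
        simp only [max_eq_right (not_lt.1 fun hh => hz (mem_halfPlane.2 hh))]
    rw [e4, e5, integral_past hu0 h1 h2] at e1
    linarith
  refine ae_eq_of_integral_contDiff_smul_eq hin hu0.locallyIntegrable fun ψ h1 h2 => ?_
  -- A cutoff in time equal to 1 at t = 0 makes every test function of x the trace of a test
  -- function on the plane.
  let χ : ContDiffBump (0 : ℝ) := ⟨1, 2, one_pos, one_lt_two⟩
  have hχ : χ 0 = 1 := χ.one_of_mem_closedBall (by simpa using χ.rIn_pos.le)
  have := key (fun z => χ z.1 * ψ z.2)
    ((χ.contDiff.comp contDiff_fst).mul ((h1.of_le (by simp)).comp contDiff_snd)) (by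
      refine HasCompactSupport.intro (IsCompact.prod χ.hasCompactSupport h2) fun z hz => ?_
      by_cases h3 : z.1 ∈ tsupport χ
      · rw [image_eq_zero_of_notMem_tsupport (f := ψ) fun h4 => hz ⟨h3, h4⟩, mul_zero]
      · rw [image_eq_zero_of_notMem_tsupport h3, zero_mul])
  simp only [hχ, one_mul] at this
  simpa only [smul_eq_mul, mul_comm] using this

/-! ### Uniform bounds and the spatial derivative at every time -/

theorem integral_sq_le {f : ℝ → ℝ} {C : ENNReal} (hC : C < ⊤) (hf : MemLp f 2)
    (h : eLpNorm f 2 volume ≤ C) : ∫ x, f x ^ 2 ≤ C.toReal ^ 2 := by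
  have h1 := hf.eLpNorm_eq_integral_rpow_norm (by norm_num) (by norm_num)
  have h2 : (∫ x, ‖f x‖ ^ (2 : ENNReal).toReal) = ∫ x, f x ^ 2 :=
    integral_congr_ae (.of_forall fun x => by simp)
  have h0 : 0 ≤ ∫ x, f x ^ 2 := integral_nonneg fun x => sq_nonneg _
  rw [h2] at h1
  have h3 := ENNReal.toReal_mono hC.ne h
  rw [h1, ENNReal.toReal_ofReal (Real.rpow_nonneg h0 _)] at h3
  have h4 := pow_le_pow_left₀ (Real.rpow_nonneg h0 _) h3 2
  rw [← Real.rpow_natCast, ← Real.rpow_mul h0] at h4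
  simpa using h4

theorem Prim.sq_le_integral_add {F f : ℝ → ℝ} (h : Prim F f) (hF : MemLp F 2) (hf : MemLp f 2)
    (x : ℝ) : F x ^ 2 ≤ (∫ y, F y ^ 2) + ∫ y, f y ^ 2 := by
  refine (h.sq_le hF hf x).trans ?_
  rw [← integral_add hF.integrable_sq hf.integrable_sq]
  refine integral_mono ((hF.integrable_mul hf).const_mul 2).abs
    (hF.integrable_sq.add hf.integrable_sq) fun y => ?_
  simp only [abs_le]
  constructor
  · nlinarith [sq_nonneg (F y + f y)]
  · nlinarith [sq_nonneg (F y - f y)]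

theorem Regular.exists_sup_bound (h : Regular ε u v a w b) (T : ℝ) :
    ∃ K : ℝ, 0 < K ∧ ∀ᵐ t : ℝ, 0 < t → t < T → ∀ x, |u (t, x)| ≤ K ∧ |v (t, x)| ≤ K := by
  obtain ⟨C, hC, hb⟩ := h.bounds T
  refine ⟨√(C.toReal ^ 2 + C.toReal ^ 2) + 1, by positivity, ?_⟩
  filter_upwards [hb, h.prim_u, h.prim_v, memLp_slice h.memLp_u, memLp_slice h.memLp_v,
    memLp_slice h.memLp_a] with t h1 h2 h3 h4 h5 h6 h0 hT x
  obtain ⟨b1, b2, b3⟩ := h1 h0 hT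
  have c1 := integral_sq_le hC (h4 h0) b1
  have c2 := integral_sq_le hC (h5 h0) b2
  have c3 := integral_sq_le hC (h6 h0) b3
  constructor
  · exact (Real.abs_le_sqrt (((h2 h0).sq_le_integral_add (h4 h0) (h5 h0) x).trans
      (add_le_add c1 c2))).trans (by linarith)
  · exact (Real.abs_le_sqrt (((h3 h0).sq_le_integral_add (h5 h0) (h6 h0) x).trans
      (add_le_add c2 c3))).trans (by linarith)

/-- Young's inequality |f| ≤ ηf² + 1/η under the integral. With η free it replaces the Hölder-1/2
estimate and avoids square roots. -/
theorem Prim.abs_sub_le {F f : ℝ → ℝ} (h : Prim F f) (hf : MemLp f 2) {η : ℝ} (hη : 0 < η)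
    (x y : ℝ) : |F x - F y| ≤ η * (∫ z, f z ^ 2) + |x - y| / η := by
  wlog hxy : y ≤ x generalizing x y
  · rw [abs_sub_comm (F x), abs_sub_comm x]; exact this y x (le_of_not_ge hxy)
  rw [← h.integral_eq, abs_of_nonneg (sub_nonneg.2 hxy)]
  refine (intervalIntegral.abs_integral_le_integral_abs hxy).trans ?_
  have hi : IntervalIntegrable (fun z => η * f z ^ 2 + 1 / η) volume y x :=
    ((hf.integrable_sq.const_mul η).intervalIntegrable).add intervalIntegrable_const
  have h1 : ∫ z in y..x, |f z| ≤ ∫ z in y..x, (η * f z ^ 2 + 1 / η) := by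
    refine intervalIntegral.integral_mono_on hxy (h y x).intervalIntegrable.abs hi fun z _ => ?_
    have : 0 ≤ η * (|f z| - 1 / η) ^ 2 := by positivity
    have e : η * (|f z| - 1 / η) ^ 2 = η * f z ^ 2 - 2 * |f z| + 1 / η := by
      field_simp; rw [← sq_abs (f z)]; ring
    linarith [abs_nonneg (f z)]
  refine h1.trans ?_
  rw [intervalIntegral.integral_add (hf.integrable_sq.const_mul η).intervalIntegrable
    intervalIntegrable_const, intervalIntegral.integral_const,
    intervalIntegral.integral_const_mul, smul_eq_mul, mul_one_div]
  gcongr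
  rw [intervalIntegral.integral_of_le hxy]
  exact setIntegral_le_integral hf.integrable_sq (.of_forall fun z => sq_nonneg _)

/-- The L² norm of ∂_xx u is bounded uniformly on bounded time intervals, which gives v(t, ·) a
common modulus of continuity for almost every t. -/
theorem Regular.equicontinuous (h : Regular ε u v a w b) (T : ℝ) {e : ℝ} (he : 0 < e) :
    ∃ δ > 0, ∀ᵐ t : ℝ, 0 < t → t < T → ∀ x y, |x - y| < δ → |v (t, x) - v (t, y)| ≤ e := by
  obtain ⟨C, hC, hb⟩ := h.bounds T
  set D := C.toReal ^ 2 + 1 with hD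
  have hDpos : 0 < D := by positivity
  -- With η = e/(2D) each of the two terms of `Prim.abs_sub_le` is at most e/2.
  refine ⟨e / 2 * (e / (2 * D)), by positivity, ?_⟩
  filter_upwards [hb, h.prim_v, memLp_slice h.memLp_a] with t h1 h2 h3 h0 hT x y hxy
  have c := integral_sq_le hC (h3 h0) (h1 h0 hT).2.2
  refine ((h2 h0).abs_sub_le (h3 h0) (η := e / (2 * D)) (by positivity) x y).trans ?_
  have e1 : e / (2 * D) * (∫ z, a (t, z) ^ 2) ≤ e / (2 * D) * D := by
    gcongr; linarith
  have e2 : |x - y| / (e / (2 * D)) ≤ e / 2 := by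
    rw [div_le_iff₀ (by positivity)]; exact hxy.le
  have e3 : e / (2 * D) * D = e / 2 := by field_simp
  linarith

/-- Right neighbourhoods of `t`, up to null sets. -/
def aeRight (t : ℝ) : Filter ℝ := 𝓝[>] t ⊓ ae volume

instance (t : ℝ) : (aeRight t).NeBot := by
  rw [aeRight, inf_neBot_iff]
  intro s hs s' hs'
  obtain ⟨r, hr, hrs⟩ := mem_nhdsGT_iff_exists_Ioo_subset.1 hs
  by_contra hne
  rw [not_nonempty_iff_eq_empty, ← disjoint_iff_inter_eq_empty] at hne
  have h1 : Ioo t r ⊆ s'ᶜ := hrs.trans hne.subset_compl_right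
  have h2 := measure_mono_null h1 (mem_ae_iff.1 hs')
  rw [Real.volume_Ioo, ENNReal.ofReal_eq_zero] at h2
  exact absurd h2 (by simpa using hr)

theorem eventually_aeRight {t T : ℝ} (ht : 0 ≤ t) (hT : t < T) {p : ℝ → Prop}
    (h : ∀ᵐ s : ℝ, 0 < s → s < T → p s) : ∀ᶠ s in aeRight t, p s := by
  have h1 : ∀ᶠ s in aeRight t, s ∈ Ioo t T := inf_le_left (a := 𝓝[>] t) (Ioo_mem_nhdsGT hT)
  have h2 : ∀ᶠ s in aeRight t, 0 < s → s < T → p s := inf_le_right (b := ae volume) h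
  filter_upwards [h1, h2] with s hs hp using hp (ht.trans_lt hs.1) hs.2

theorem tendsto_aeRight {t : ℝ} (ht : 0 ≤ t)
    (hu : ContinuousOn u (Ici (0 : ℝ) ×ˢ (univ : Set ℝ))) (x : ℝ) :
    Tendsto (fun s => u (s, x)) (aeRight t) (𝓝 (u (t, x))) := by
  have h1 := (continuousOn_time hu x t ht)
  exact (h1.mono_left (nhdsWithin_mono _ fun s (hs : t < s) => ht.trans hs.le)).mono_left
    inf_le_left

/-- The slice of v is controlled only for almost every time. Equicontinuity makes v(s, x) uniformly
close to a difference quotient of u(s, ·) with fixed step; those quotients converge as s ↓ t because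
u is continuous. So v(s, x) has a limit along good times s, and this limit is the derivative of u(t,
·), continuous by the same modulus. -/
theorem Regular.exists_deriv (h : Regular ε u v a w b) {t : ℝ} (ht : 0 ≤ t) :
    ∃ g : ℝ → ℝ, Continuous g ∧ (∀ x, HasDerivAt (fun y => u (t, y)) (g x) x) ∧
      ∀ x, Tendsto (fun s => v (s, x)) (aeRight t) (𝓝 (g x)) := by
  have hslope : ∀ e > 0, ∃ δ > 0, (∀ᶠ s in aeRight t, ∀ x y, |x - y| < δ →
      |v (s, x) - v (s, y)| ≤ e) ∧ ∀ᶠ s in aeRight t, ∀ x k, k ≠ 0 → |k| < δ →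
        |v (s, x) - (u (s, x + k) - u (s, x)) / k| ≤ e := by
    intro e he
    obtain ⟨δ, hδ, H⟩ := h.equicontinuous (t + 1) he
    have H1 := eventually_aeRight ht (lt_add_one t) H
    have H2 : ∀ᶠ s in aeRight t, Prim (fun x => u (s, x)) (fun x => v (s, x)) ∧
        Continuous fun x => v (s, x) :=
      eventually_aeRight ht (lt_add_one t) (by
        filter_upwards [h.prim_u, h.prim_v] with s h1 h2 h0 _
        exact ⟨h1 h0, (h2 h0).continuous⟩)
    refine ⟨δ, hδ, H1, ?_⟩
    filter_upwards [H1, H2] with s h1 h2 x k hk hkδ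
    have e1 : u (s, x + k) - u (s, x) = ∫ y in x..x + k, v (s, y) := (h2.1.integral_eq _ _).symm
    have e2 : v (s, x) - (u (s, x + k) - u (s, x)) / k =
        (∫ y in x..x + k, (v (s, x) - v (s, y))) / k := by
      rw [intervalIntegral.integral_sub intervalIntegrable_const
        (h2.2.intervalIntegrable _ _), e1]
      simp only [intervalIntegral.integral_const, add_sub_cancel_left, smul_eq_mul]
      field_simp
    rw [e2, abs_div, div_le_iff₀ (abs_pos.2 hk)]
    have := intervalIntegral.norm_integral_le_of_norm_le_const (a := x) (b := x + k) (C := e)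
      (f := fun y => v (s, x) - v (s, y)) fun y hy => by
        refine h1 x y (lt_of_le_of_lt ?_ hkδ)
        have := abs_sub_left_of_mem_uIcc (uIoc_subset_uIcc hy)
        rw [abs_sub_comm]
        simpa using this
    simpa using this
  have hlim : ∀ x, ∃ l, Tendsto (fun s => v (s, x)) (aeRight t) (𝓝 l) := by
    intro x
    refine cauchy_map_iff_exists_tendsto.1 ?_
    rw [Metric.cauchy_iff]
    refine ⟨inferInstance, fun e he => ?_⟩
    obtain ⟨δ, hδ, -, H⟩ := hslope (e / 8) (by positivity)
    set k := δ / 2 with hk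
    have hk0 : 0 < k := by positivity
    set D := (u (t, x + k) - u (t, x)) / k with hD
    have hDt : Tendsto (fun s => (u (s, x + k) - u (s, x)) / k) (aeRight t) (𝓝 D) :=
      ((tendsto_aeRight ht h.cont _).sub (tendsto_aeRight ht h.cont _)).div_const k
    have hDe := (Metric.tendsto_nhds.1 hDt) (e / 8) (by positivity)
    refine ⟨{r | |r - D| ≤ e / 4}, ?_, ?_⟩
    · rw [mem_map]
      filter_upwards [H, hDe] with s h1 h2
      have h3 := h1 x k hk0.ne' (by rw [abs_of_pos hk0]; linarith)
      rw [Real.dist_eq] at h2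
      change |v (s, x) - D| ≤ e / 4
      have := abs_sub_le (v (s, x)) ((u (s, x + k) - u (s, x)) / k) D
      linarith
    · intro p hp q hq
      rw [Real.dist_eq]
      have := abs_sub_le p D q
      have hq' : |q - D| ≤ e / 4 := hq
      rw [abs_sub_comm] at hq'
      have hp' : |p - D| ≤ e / 4 := hp
      linarith
  choose g hg using hlim
  refine ⟨g, ?_, ?_, hg⟩
  · rw [Metric.continuous_iff]
    intro x e he
    obtain ⟨δ, hδ, H, -⟩ := hslope (e / 2) (by positivity)
    refine ⟨δ, hδ, fun y hy => ?_⟩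
    rw [Real.dist_eq] at hy ⊢
    refine lt_of_le_of_lt (le_of_tendsto ((hg y).sub (hg x)).abs ?_) (half_lt_self he)
    filter_upwards [H] with s hs using hs y x hy
  · intro x
    rw [hasDerivAt_iff_tendsto_slope_zero, Metric.tendsto_nhdsWithin_nhds]
    intro e he
    obtain ⟨δ, hδ, -, H⟩ := hslope (e / 2) (by positivity)
    refine ⟨δ, hδ, fun k hk hkδ => ?_⟩
    rw [Real.dist_eq, sub_zero] at hkδ
    rw [Real.dist_eq, abs_sub_comm, smul_eq_mul, inv_mul_eq_div]
    refine lt_of_le_of_lt (le_of_tendsto (((hg x).sub (((tendsto_aeRight ht h.cont _).sub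
      (tendsto_aeRight ht h.cont _)).div_const k)).abs) ?_) (half_lt_self he)
    filter_upwards [H] with s hs using hs x k hk hkδ

end

/-! ### Time balance and regularized absolute values -/

/-- Balance of `∫ β(z)` for a function `z` with time derivative `g`. -/
theorem energy_balance {z g : ℝ × ℝ → ℝ} {β : ℝ → ℝ} (hβ : ContDiff ℝ 1 β) {T : ℝ} (hT : 0 ≤ T)
    (hp : ∀ᵐ x : ℝ, PrimOn (fun t => z (t, x)) (fun t => g (t, x)) 0 T)
    (hi : Integrable (fun p => deriv β (z p) * g p) (stripM T))
    (h0 : Integrable fun x => β (z (0, x))) :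
    Integrable (fun x => β (z (T, x))) ∧
      ∫ x, β (z (T, x)) = (∫ x, β (z (0, x))) +
        ∫ t in Ioo 0 T, ∫ x, deriv β (z (t, x)) * g (t, x) := by
  have e : (fun x => β (z (T, x))) =ᵐ[volume] fun x => β (z (0, x)) +
      ∫ t in Ioo 0 T, deriv β (z (t, x)) * g (t, x) := by
    filter_upwards [hp] with x hx
    have := (hx.comp hβ).integral_eq
    rw [intervalIntegral.integral_of_le hT, integral_Ioc_eq_integral_Ioo] at this
    linarith
  have hi' : Integrable fun x => ∫ t in Ioo 0 T, deriv β (z (t, x)) * g (t, x) :=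
    hi.integral_prod_right
  refine ⟨(h0.add hi').congr e.symm, ?_⟩
  rw [integral_congr_ae e, integral_add h0 hi']
  congr 1
  exact (integral_integral_swap (by exact hi)).symm

/-- The regularized absolute value. -/
def absReg (δ z : ℝ) : ℝ := √(z ^ 2 + δ ^ 2) - δ

/-- The second derivative of the regularized absolute value. -/
def absReg'' (δ z : ℝ) : ℝ := δ ^ 2 / √(z ^ 2 + δ ^ 2) ^ 3

/-- The constitutive function with parameter δ in place of ε is also a smooth sign function, so its
properties serve twice. -/
theorem hasDerivAt_absReg {δ : ℝ} (hδ : 0 < δ) (z : ℝ) :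
    HasDerivAt (absReg δ) (stress δ z) z := by
  have h1 : HasDerivAt (fun p : ℝ => p ^ 2 + δ ^ 2) (2 * z) z := by
    simpa using (hasDerivAt_pow 2 z).add_const (δ ^ 2)
  have hpos : 0 < z ^ 2 + δ ^ 2 := by positivity
  refine ((h1.sqrt hpos.ne').sub_const δ).congr_deriv ?_
  rw [stress, sq_abs]
  field_simp

theorem deriv_absReg {δ : ℝ} (hδ : 0 < δ) : deriv (absReg δ) = stress δ :=
  funext fun z => (hasDerivAt_absReg hδ z).deriv

theorem deriv_stress {δ : ℝ} (hδ : 0 < δ) : deriv (stress δ) = absReg'' δ :=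
  funext fun z => (hasDerivAt_stress hδ z).deriv

theorem contDiff_absReg {δ : ℝ} (hδ : 0 < δ) : ContDiff ℝ 1 (absReg δ) := by
  rw [contDiff_one_iff_deriv, deriv_absReg hδ]
  exact ⟨fun z => (hasDerivAt_absReg hδ z).differentiableAt, (contDiff_stress hδ).continuous⟩

theorem continuous_absReg'' {δ : ℝ} (hδ : 0 < δ) : Continuous (absReg'' δ) := by
  rw [← deriv_stress hδ]
  exact (contDiff_one_iff_deriv.1 (contDiff_stress hδ)).2

theorem absReg_nonneg (δ z : ℝ) : 0 ≤ absReg δ z :=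
  sub_nonneg.2 (Real.le_sqrt_of_sq_le (by nlinarith [sq_nonneg z]))

theorem absReg_le {δ : ℝ} (hδ : 0 < δ) (z : ℝ) : absReg δ z ≤ |z| := by
  rw [absReg, sub_le_iff_le_add]
  refine Real.sqrt_le_iff.2 ⟨by positivity, ?_⟩
  nlinarith [sq_abs z, abs_nonneg z, mul_nonneg (abs_nonneg z) hδ.le]

theorem abs_le_sqrt_add (δ z : ℝ) : |z| ≤ √(z ^ 2 + δ ^ 2) :=
  Real.abs_le_sqrt (by nlinarith [sq_nonneg δ])

theorem le_sqrt_add {δ : ℝ} (z : ℝ) : δ ≤ √(z ^ 2 + δ ^ 2) :=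
  Real.le_sqrt_of_sq_le (by nlinarith [sq_nonneg z])

theorem abs_stress_le_one (δ z : ℝ) : |stress δ z| ≤ 1 := by
  rw [stress, abs_div, sq_abs, abs_of_nonneg (Real.sqrt_nonneg _)]
  exact div_le_one_of_le₀ (abs_le_sqrt_add δ z) (Real.sqrt_nonneg _)

theorem abs_stress_le {δ : ℝ} (hδ : 0 < δ) (z : ℝ) : |stress δ z| ≤ 1 / δ * |z| := by
  rw [stress, abs_div, sq_abs, abs_of_nonneg (Real.sqrt_nonneg _), div_eq_mul_inv, mul_comm,
    ← one_div]
  gcongr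
  exact le_sqrt_add z

theorem absReg''_nonneg {δ : ℝ} (hδ : 0 < δ) (z : ℝ) : 0 ≤ absReg'' δ z := by
  unfold absReg''; positivity

theorem absReg''_le {δ : ℝ} (hδ : 0 < δ) (z : ℝ) : absReg'' δ z ≤ 1 / δ := by
  have h := le_sqrt_add (δ := δ) z
  rw [absReg'', div_le_div_iff₀ (by positivity) hδ]
  calc δ ^ 2 * δ = δ ^ 3 := by ring
    _ ≤ √(z ^ 2 + δ ^ 2) ^ 3 := by gcongr
    _ = _ := by ring

/-- A bound independent of δ: it provides the dominating function for the convective term, while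
`absReg''_mul_abs_le'` provides the pointwise convergence to 0. -/
theorem absReg''_mul_abs_le {δ : ℝ} (hδ : 0 < δ) (z : ℝ) : absReg'' δ z * |z| ≤ 1 := by
  have h := le_sqrt_add (δ := δ) z
  have h' := abs_le_sqrt_add δ z
  rw [absReg'', div_mul_eq_mul_div, div_le_one (by positivity)]
  calc δ ^ 2 * |z| ≤ √(z ^ 2 + δ ^ 2) ^ 2 * √(z ^ 2 + δ ^ 2) := by gcongr
    _ = _ := by ring

theorem absReg''_mul_abs_le' {δ : ℝ} (z : ℝ) (hz : z ≠ 0) :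
    absReg'' δ z * |z| ≤ δ ^ 2 / z ^ 2 := by
  have h' := abs_le_sqrt_add δ z
  have hz' := abs_pos.2 hz
  rw [absReg'', div_mul_eq_mul_div, div_le_div_iff₀ (pow_pos (hz'.trans_le h') 3) (by positivity)]
  rw [← sq_abs z]
  calc δ ^ 2 * |z| * |z| ^ 2 = δ ^ 2 * |z| ^ 3 := by ring
    _ ≤ δ ^ 2 * √(z ^ 2 + δ ^ 2) ^ 3 := by gcongr
    _ = _ := by rw [sq_abs]

/-- The sequence of regularization parameters `1/(n+1)`. -/
def regSeq (n : ℕ) : ℝ := 1 / ((n : ℝ) + 1)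

theorem regSeq_pos (n : ℕ) : 0 < regSeq n := by unfold regSeq; positivity

theorem tendsto_regSeq : Tendsto regSeq atTop (𝓝 0) := tendsto_one_div_add_atTop_nhds_zero_nat

theorem tendsto_absReg (z : ℝ) : Tendsto (fun n => absReg (regSeq n) z) atTop (𝓝 |z|) := by
  have h : Continuous fun δ : ℝ => absReg δ z := by unfold absReg; fun_prop
  have := (h.tendsto 0).comp tendsto_regSeq
  simpa [absReg, Function.comp_def, Real.sqrt_sq_eq_abs] using this

theorem tendsto_absReg''_mul_abs (z : ℝ) :
    Tendsto (fun n => absReg'' (regSeq n) z * |z|) atTop (𝓝 0) := by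
  by_cases hz : z = 0
  · simp [hz]
  · refine squeeze_zero (fun n => mul_nonneg (absReg''_nonneg (regSeq_pos n) z) (abs_nonneg z))
      (fun n => absReg''_mul_abs_le' z hz) ?_
    simpa using (tendsto_regSeq.pow 2).div_const (z ^ 2)

theorem tendsto_stress (z : ℝ) (hz : z ≠ 0) :
    Tendsto (fun n => stress (regSeq n) z) atTop (𝓝 (z / |z|)) := by
  have h : Tendsto (fun n => √(|z| ^ 2 + regSeq n ^ 2)) atTop (𝓝 √(|z| ^ 2 + 0 ^ 2)) :=
    ((tendsto_regSeq.pow 2).const_add _).sqrt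
  have e : √(|z| ^ 2 + 0 ^ 2) = |z| := by
    rw [zero_pow two_ne_zero, add_zero, Real.sqrt_sq (abs_nonneg z)]
  rw [e] at h
  exact tendsto_const_nhds.div h (abs_ne_zero.2 hz)

theorem memLp_stress {δ : ℝ} (hδ : 0 < δ) {α : Type*} [MeasurableSpace α] {μ : Measure α}
    {p : α → ℝ} (h : MemLp p 2 μ) : MemLp (fun z => stress δ (p z)) 2 μ :=
  h.of_le_mul ((contDiff_stress hδ).continuous.comp_aestronglyMeasurable h.1)
    (.of_forall fun z => abs_stress_le hδ (p z))

theorem memLp_sq_div_two {F f : ℝ → ℝ} (h : Prim F f) (hF : MemLp F 2) (hf : MemLp f 2) :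
    MemLp (fun x => F x ^ 2 / 2) 2 := by
  obtain ⟨K, hK, hb⟩ := h.exists_bound hF hf
  refine hF.of_le_mul (c := K / 2)
    ((h.continuous.pow 2).div_const 2).aestronglyMeasurable (.of_forall fun x => ?_)
  rw [Real.norm_eq_abs, Real.norm_eq_abs, abs_div, abs_pow, abs_two]
  nlinarith [hb x, abs_nonneg (F x)]

/-! ### Contraction in L¹ -/

/-- A function `u` on `[0,T] × ℝ` with spatial derivative `v`, time derivative `w`, and with `q`
the spatial derivative of `flux ε v - u²/2`. -/
structure Evolution (ε T : ℝ) (u v w q : ℝ × ℝ → ℝ) : Prop where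
  memLp_u : MemLp u 2 (stripM T)
  memLp_v : MemLp v 2 (stripM T)
  memLp_w : MemLp w 2 (stripM T)
  memLp_q : MemLp q 2 (stripM T)
  continuous_start : Continuous fun x => u (0, x)
  continuous_end : Continuous fun x => u (T, x)
  time : ∀ᵐ x : ℝ, PrimOn (fun t => u (t, x)) (fun t => w (t, x)) 0 T
  prim_u : ∀ᵐ t ∂volume.restrict (Ioo 0 T), Prim (fun x => u (t, x)) (fun x => v (t, x))
  prim_flux : ∀ᵐ t ∂volume.restrict (Ioo 0 T),
    Prim (fun x => flux ε (v (t, x)) - u (t, x) ^ 2 / 2) (fun x => q (t, x))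

theorem memLp_slice_strip {f : ℝ × ℝ → ℝ} {T : ℝ} (h : MemLp f 2 (stripM T)) :
    ∀ᵐ t ∂volume.restrict (Ioo 0 T), MemLp (fun x => f (t, x)) 2 := by
  have h1 := h.1.prodMk_left
  have h2 := ((memLp_two_iff_integrable_sq h.1).1 h).prod_right_ae
  filter_upwards [h1, h2] with t h1 h2
  exact (memLp_two_iff_integrable_sq h1).2 h2

/-- The instantaneous estimate behind the `L¹` contraction. -/
theorem integral_stress_mul_le {ε δ : ℝ} (hε : 0 < ε) (hδ : 0 < δ) {u₁ v₁ q₁ u₂ v₂ q₂ : ℝ → ℝ}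
    (hu₁ : MemLp u₁ 2) (hv₁ : MemLp v₁ 2) (hq₁ : MemLp q₁ 2)
    (hu₂ : MemLp u₂ 2) (hv₂ : MemLp v₂ 2) (hq₂ : MemLp q₂ 2)
    (p₁ : Prim u₁ v₁) (p₂ : Prim u₂ v₂)
    (f₁ : Prim (fun x => flux ε (v₁ x) - u₁ x ^ 2 / 2) q₁)
    (f₂ : Prim (fun x => flux ε (v₂ x) - u₂ x ^ 2 / 2) q₂) :
    ∫ x, stress δ (u₁ x - u₂ x) * (q₁ x - q₂ x) ≤
      ∫ x, absReg'' δ (u₁ x - u₂ x) * |u₁ x - u₂ x| * (|v₁ x - v₂ x| * |u₁ x + u₂ x| / 2) := by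
  set z : ℝ → ℝ := fun x => u₁ x - u₂ x with hz
  set P : ℝ → ℝ := fun x => (flux ε (v₁ x) - u₁ x ^ 2 / 2) - (flux ε (v₂ x) - u₂ x ^ 2 / 2) with hP
  have hzL : MemLp z 2 := hu₁.sub hu₂
  have hvL : MemLp (fun x => v₁ x - v₂ x) 2 := hv₁.sub hv₂
  have hqL : MemLp (fun x => q₁ x - q₂ x) 2 := hq₁.sub hq₂
  have hPL : MemLp P 2 := ((memLp_flux hε hv₁).sub (memLp_sq_div_two p₁ hu₁ hv₁)).sub
    ((memLp_flux hε hv₂).sub (memLp_sq_div_two p₂ hu₂ hv₂))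
  have hsL : MemLp (fun x => stress δ (z x)) 2 := memLp_stress hδ hzL
  have hzc : Continuous z := p₁.continuous.sub p₂.continuous
  have hj : Continuous fun x => absReg'' δ (z x) := (continuous_absReg'' hδ).comp hzc
  have hjb : ∀ x, ‖absReg'' δ (z x)‖ ≤ 1 / δ := fun x => by
    rw [Real.norm_of_nonneg (absReg''_nonneg hδ _)]; exact absReg''_le hδ _
  have hS : Prim (fun x => stress δ (z x)) (fun x => absReg'' δ (z x) * (v₁ x - v₂ x)) := by
    have := (p₁.sub p₂).comp (contDiff_stress hδ)
    simpa only [deriv_stress hδ] using this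
  have i1 : Integrable fun x => absReg'' δ (z x) * ((v₁ x - v₂ x) * P x) :=
    (hvL.integrable_mul hPL).bdd_mul hj.aestronglyMeasurable (.of_forall hjb)
  have i2 : Integrable fun x => stress δ (z x) * (q₁ x - q₂ x) := hsL.integrable_mul hqL
  have h0 := (hS.mul (f₁.sub f₂)).integral_eq_zero (hsL.integrable_mul hPL)
    ((i1.congr (.of_forall fun x => by simp only [hP]; ring)).add i2)
  rw [integral_add (i1.congr (.of_forall fun x => by simp only [hP]; ring)) i2] at h0
  have e1 : ∫ x, stress δ (z x) * (q₁ x - q₂ x) =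
      ∫ x, -(absReg'' δ (z x) * ((v₁ x - v₂ x) * P x)) := by
    rw [integral_neg, ← add_eq_zero_iff_eq_neg', ← h0]
    congr 1
    refine integral_congr_ae (.of_forall fun x => ?_)
    simp only [hP]; ring
  rw [e1]
  have i3 : Integrable fun x => absReg'' δ (z x) * |z x| *
      (|v₁ x - v₂ x| * |u₁ x + u₂ x| / 2) := by
    refine ((hvL.abs.integrable_mul (hu₁.add hu₂).abs).div_const 2).bdd_mul (c := 1)
      (hj.mul hzc.abs).aestronglyMeasurable (.of_forall fun x => ?_)
    rw [Real.norm_of_nonneg (mul_nonneg (absReg''_nonneg hδ _) (abs_nonneg _))]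
    exact absReg''_mul_abs_le hδ _
  refine integral_mono i1.neg i3 fun x => ?_
  have hJ := absReg''_nonneg hδ (z x)
  -- Two terms arise after integration by parts. The viscous one has a sign by monotonicity of the
  -- flux; in the convective one u₁² - u₂² = z(u₁ + u₂) supplies the factor |z| that compensates the
  -- concentration of the second derivative at z = 0.
  have hm : 0 ≤ (v₁ x - v₂ x) * (flux ε (v₁ x) - flux ε (v₂ x)) := by
    rcases le_total (v₁ x) (v₂ x) with h | h
    · exact mul_nonneg_of_nonpos_of_nonpos (by linarith) (by linarith [monotone_flux hε h])
    · exact mul_nonneg (by linarith) (by linarith [monotone_flux hε h])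
  have hb : (v₁ x - v₂ x) * (z x * (u₁ x + u₂ x)) ≤ |z x| * (|v₁ x - v₂ x| * |u₁ x + u₂ x|) := by
    refine (le_abs_self _).trans (le_of_eq ?_)
    rw [abs_mul, abs_mul]; ring
  calc -(absReg'' δ (z x) * ((v₁ x - v₂ x) * P x))
      = absReg'' δ (z x) * ((v₁ x - v₂ x) * (z x * (u₁ x + u₂ x)) / 2) -
        absReg'' δ (z x) * ((v₁ x - v₂ x) * (flux ε (v₁ x) - flux ε (v₂ x))) := by
          simp only [hP, hz]; ring
    _ ≤ absReg'' δ (z x) * (|z x| * (|v₁ x - v₂ x| * |u₁ x + u₂ x|) / 2) - 0 := by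
          gcongr
          exact mul_nonneg hJ hm
    _ = _ := by ring

/-- `L¹` contraction for two evolutions, the second being driven by a source whose `L¹` norm
relative to the first is at most `r`. -/
theorem Evolution.l1_contraction {ε T r : ℝ} (hε : 0 < ε) (hT : 0 ≤ T) (hr : 0 ≤ r)
    {u₁ v₁ w₁ q₁ u₂ v₂ w₂ q₂ : ℝ × ℝ → ℝ}
    (h₁ : Evolution ε T u₁ v₁ w₁ q₁) (h₂ : Evolution ε T u₂ v₂ w₂ q₂)
    (hs : ∀ᵐ t ∂volume.restrict (Ioo 0 T),
      ∫⁻ x, ‖(w₁ (t, x) - w₂ (t, x)) - (q₁ (t, x) - q₂ (t, x))‖ₑ ≤ ENNReal.ofReal r) :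
    ∫⁻ x, ‖u₁ (T, x) - u₂ (T, x)‖ₑ ≤
      (∫⁻ x, ‖u₁ (0, x) - u₂ (0, x)‖ₑ) + ENNReal.ofReal (T * r) := by
  by_cases hfin : (∫⁻ x, ‖u₁ (0, x) - u₂ (0, x)‖ₑ) = ⊤
  · simp [hfin]
  set z : ℝ × ℝ → ℝ := fun p => u₁ p - u₂ p with hz
  have hz0 : Integrable fun x => z (0, x) :=
    ⟨(h₁.continuous_start.sub h₂.continuous_start).aestronglyMeasurable, lt_top_iff_ne_top.2 hfin⟩
  have hzL : MemLp z 2 (stripM T) := h₁.memLp_u.sub h₂.memLp_u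
  have hwL : MemLp (fun p => w₁ p - w₂ p) 2 (stripM T) := h₁.memLp_w.sub h₂.memLp_w
  have hvL : MemLp (fun p => v₁ p - v₂ p) 2 (stripM T) := h₁.memLp_v.sub h₂.memLp_v
  have hzt : ∀ᵐ x : ℝ, PrimOn (fun t => z (t, x)) (fun t => w₁ (t, x) - w₂ (t, x)) 0 T := by
    filter_upwards [h₁.time, h₂.time] with x a b using a.sub b
  set m : ℝ × ℝ → ℝ := fun p => |v₁ p - v₂ p| * |u₁ p + u₂ p| / 2 with hm
  have hmI : Integrable m (stripM T) :=
    (hvL.abs.integrable_mul (h₁.memLp_u.add h₂.memLp_u).abs).div_const 2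
  set k : ℝ → ℝ × ℝ → ℝ := fun δ p => absReg'' δ (z p) * |z p| * m p with hk
  have hkm : ∀ δ, 0 < δ → AEStronglyMeasurable (fun p => absReg'' δ (z p) * |z p|) (stripM T) :=
    fun δ hδ => (((continuous_absReg'' hδ).mul continuous_abs).comp_aestronglyMeasurable hzL.1)
  have hkb : ∀ δ, 0 < δ → ∀ p, ‖absReg'' δ (z p) * |z p|‖ ≤ 1 := fun δ hδ p => by
    rw [Real.norm_of_nonneg (mul_nonneg (absReg''_nonneg hδ _) (abs_nonneg _))]
    exact absReg''_mul_abs_le hδ _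
  have hkI : ∀ δ, 0 < δ → Integrable (k δ) (stripM T) := fun δ hδ =>
    hmI.bdd_mul (hkm δ hδ) (.of_forall (hkb δ hδ))
  have key : ∀ δ, 0 < δ → ∫⁻ x, ENNReal.ofReal (absReg δ (z (T, x))) ≤
      ENNReal.ofReal ((∫ x, |z (0, x)|) + (T * r + ∫ p, k δ p ∂stripM T)) := by
    intro δ hδ
    have j0 : Integrable fun x => absReg δ (z (0, x)) :=
      hz0.abs.mono' ((contDiff_absReg hδ).continuous.comp_aestronglyMeasurable hz0.1)
        (.of_forall fun x => by
          rw [Real.norm_of_nonneg (absReg_nonneg _ _)]; exact absReg_le hδ _)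
    have hi : Integrable (fun p => stress δ (z p) * (w₁ p - w₂ p)) (stripM T) :=
      (memLp_stress hδ hzL).integrable_mul hwL
    obtain ⟨jT, hE⟩ := energy_balance (z := z) (g := fun p => w₁ p - w₂ p) (contDiff_absReg hδ) hT
      hzt (by rw [deriv_absReg hδ]; exact hi) j0
    simp only [deriv_absReg hδ] at hE
    -- The time derivative splits into the spatial part q, controlled by the instantaneous estimate,
    -- and the source, controlled in L¹ because the regularized sign is at most 1 in modulus.
    have hstep : ∀ᵐ t ∂volume.restrict (Ioo 0 T),
        ∫ x, stress δ (z (t, x)) * (w₁ (t, x) - w₂ (t, x)) ≤ r + ∫ x, k δ (t, x) := by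
      filter_upwards [hs, h₁.prim_u, h₂.prim_u, h₁.prim_flux, h₂.prim_flux,
        memLp_slice_strip h₁.memLp_u, memLp_slice_strip h₂.memLp_u,
        memLp_slice_strip h₁.memLp_v, memLp_slice_strip h₂.memLp_v,
        memLp_slice_strip h₁.memLp_w, memLp_slice_strip h₂.memLp_w,
        memLp_slice_strip h₁.memLp_q, memLp_slice_strip h₂.memLp_q] with
        t hs p₁ p₂ f₁ f₂ mu₁ mu₂ mv₁ mv₂ mw₁ mw₂ mq₁ mq₂
      have i1 := integral_stress_mul_le hε hδ mu₁ mv₁ mq₁ mu₂ mv₂ mq₂ p₁ p₂ f₁ f₂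
      have hsL := memLp_stress hδ (mu₁.sub mu₂)
      have i2 : Integrable fun x => stress δ (z (t, x)) * (q₁ (t, x) - q₂ (t, x)) :=
        hsL.integrable_mul (mq₁.sub mq₂)
      have i3 : Integrable fun x => stress δ (z (t, x)) *
          ((w₁ (t, x) - w₂ (t, x)) - (q₁ (t, x) - q₂ (t, x))) :=
        hsL.integrable_mul ((mw₁.sub mw₂).sub (mq₁.sub mq₂))
      have e : ∫ x, stress δ (z (t, x)) * (w₁ (t, x) - w₂ (t, x)) =
          (∫ x, stress δ (z (t, x)) * ((w₁ (t, x) - w₂ (t, x)) - (q₁ (t, x) - q₂ (t, x)))) +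
          ∫ x, stress δ (z (t, x)) * (q₁ (t, x) - q₂ (t, x)) := by
        rw [← integral_add i3 i2]
        exact integral_congr_ae (.of_forall fun x => by ring)
      rw [e]
      refine add_le_add ?_ i1
      refine (le_abs_self _).trans ?_
      rw [← ENNReal.ofReal_le_ofReal_iff hr, ← Real.enorm_eq_ofReal_abs]
      refine (enorm_integral_le_lintegral_enorm _).trans ((lintegral_mono fun x => ?_).trans hs)
      rw [enorm_mul]
      refine mul_le_of_le_one_left zero_le ?_
      rw [Real.enorm_eq_ofReal_abs, ENNReal.ofReal_le_one]
      exact abs_stress_le_one _ _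
    have hkt : Integrable (fun t => ∫ x, k δ (t, x)) (volume.restrict (Ioo 0 T)) :=
      (hkI δ hδ).integral_prod_left
    have h5 := integral_mono_ae hi.integral_prod_left
      ((integrable_const r).add hkt) hstep
    simp only [Pi.add_apply] at h5
    rw [integral_add (integrable_const r) hkt] at h5
    have e6 : ∫ t in Ioo 0 T, ∫ x, k δ (t, x) = ∫ p, k δ p ∂stripM T :=
      (integral_prod _ (hkI δ hδ)).symm
    have e7 : ∫ _ in Ioo 0 T, r = T * r := by
      simp [hT]
    rw [e6, e7] at h5
    rw [← ofReal_integral_eq_lintegral_ofReal jT (.of_forall fun x => absReg_nonneg _ _), hE]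
    refine ENNReal.ofReal_le_ofReal (add_le_add ?_ h5)
    exact integral_mono j0 hz0.abs fun x => absReg_le hδ _
  have hlim : Tendsto (fun n => ∫ p, k (regSeq n) p ∂stripM T) atTop (𝓝 0) := by
    have := tendsto_integral_of_dominated_convergence (μ := stripM T) (F := fun n => k (regSeq n))
      (f := fun _ => 0) m (fun n => (hkI _ (regSeq_pos n)).1) hmI
      (fun n => .of_forall fun p => by
        rw [hk, norm_mul]
        have h0 : 0 ≤ m p := by positivity
        rw [Real.norm_of_nonneg h0]
        exact mul_le_of_le_one_left h0 (hkb _ (regSeq_pos n) p))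
      (.of_forall fun p => by
        simpa using (tendsto_absReg''_mul_abs (z p)).mul_const (m p))
    simpa using this
  have hR : Tendsto (fun n => ENNReal.ofReal ((∫ x, |z (0, x)|) + (T * r +
      ∫ p, k (regSeq n) p ∂stripM T))) atTop
      (𝓝 (ENNReal.ofReal ((∫ x, |z (0, x)|) + (T * r + 0)))) :=
    (ENNReal.continuous_ofReal.tendsto _).comp ((hlim.const_add _).const_add _)
  -- Fatou's lemma is used at the final time, so integrability of z(T, ·) need not be known
  -- beforehand.
  have hL : ∫⁻ x, ‖z (T, x)‖ₑ ≤
      liminf (fun n => ∫⁻ x, ENNReal.ofReal (absReg (regSeq n) (z (T, x)))) atTop := by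
    refine le_trans (le_of_eq ?_) (lintegral_liminf_le' fun n => ?_)
    · refine lintegral_congr fun x => ?_
      rw [Real.enorm_eq_ofReal_abs]
      exact (((ENNReal.continuous_ofReal.tendsto _).comp
        (tendsto_absReg (z (T, x)))).liminf_eq).symm
    · exact (((contDiff_absReg (regSeq_pos n)).continuous.comp
        (h₁.continuous_end.sub h₂.continuous_end)).measurable.ennreal_ofReal).aemeasurable
  refine hL.trans ?_
  refine (liminf_le_liminf (.of_forall fun n => key _ (regSeq_pos n))).trans ?_
  rw [hR.liminf_eq, add_zero, ENNReal.ofReal_add (integral_nonneg fun x => abs_nonneg _)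
    (mul_nonneg hT hr)]
  refine add_le_add_left (le_of_eq ?_) _
  rw [ofReal_integral_eq_lintegral_ofReal hz0.abs (.of_forall fun x => abs_nonneg _)]
  exact lintegral_congr fun x => (Real.enorm_eq_ofReal_abs _).symm

/-! ### Consequences of contraction: bounds for u and its first derivatives -/

section

variable {ε : ℝ} {u v a w b : ℝ × ℝ → ℝ}

theorem mixedNorm_top_le {q C : ENNReal} {f : ℝ × ℝ → ℝ}
    (h : ∀ᵐ t : ℝ, 0 < t → eLpNorm (fun x => f (t, x)) q volume ≤ C) :
    mixedNorm ⊤ q (Ioi 0) f ≤ C := by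
  rw [mixedNorm, eLpNorm_exponent_top]
  refine essSup_le_of_ae_le _ ?_
  rw [EventuallyLE, ae_restrict_iff' measurableSet_Ioi]
  filter_upwards [h] with t ht hm
  simpa using ht hm

theorem ae_comp_add {p : ℝ → Prop} (h : ∀ᵐ x : ℝ, p x) (y : ℝ) : ∀ᵐ x : ℝ, p (x + y) :=
  (measurePreserving_add_right volume y).quasiMeasurePreserving.ae h

theorem memLp_shift {f : ℝ × ℝ → ℝ} {T s : ℝ} (hs : 0 ≤ s) (h : MemLp f 2 (stripM (T + s)))
    (y : ℝ) : MemLp (fun p : ℝ × ℝ => f (p.1 + s, p.2 + y)) 2 (stripM T) := by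
  have h1 : MemLp f 2 (volume.restrict (Ioo s (T + s) ×ˢ (univ : Set ℝ))) := by
    rw [stripM_eq] at h
    exact h.mono_measure (Measure.restrict_mono
      (prod_mono (Ioo_subset_Ioo_left hs) subset_rfl) le_rfl)
  have h2 := (measurePreserving_add_right (volume : Measure (ℝ × ℝ)) (s, y)).restrict_preimage
    (s := Ioo s (T + s) ×ˢ (univ : Set ℝ)) (measurableSet_Ioo.prod MeasurableSet.univ)
  have e : (fun p : ℝ × ℝ => p + (s, y)) ⁻¹' (Ioo s (T + s) ×ˢ (univ : Set ℝ)) =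
      Ioo 0 T ×ˢ (univ : Set ℝ) := by
    ext p; simp
  rw [e, ← stripM_eq] at h2
  exact h1.comp_measurePreserving h2

theorem Regular.evolution_shift (h : Regular ε u v a w b) {T s : ℝ} (hT : 0 ≤ T) (hs : 0 ≤ s)
    (y : ℝ) : Evolution ε T (fun p => u (p.1 + s, p.2 + y)) (fun p => v (p.1 + s, p.2 + y))
      (fun p => w (p.1 + s, p.2 + y)) (fun p => w (p.1 + s, p.2 + y)) where
  memLp_u := memLp_shift hs (h.memLp_u _) y
  memLp_v := memLp_shift hs (h.memLp_v _) y
  memLp_w := memLp_shift hs (h.memLp_w _) y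
  memLp_q := memLp_shift hs (h.memLp_w _) y
  continuous_start := (continuous_slice h.cont (t := 0 + s) (by linarith)).comp
    (continuous_id.add continuous_const)
  continuous_end := (continuous_slice h.cont (t := T + s) (by linarith)).comp
    (continuous_id.add continuous_const)
  time := by
    filter_upwards [ae_comp_add h.time_u y] with x hx
    refine PrimOn.comp_add (F := fun t => u (t, x + y)) (f := fun t => w (t, x + y)) (c := s)
      ((hx (T + s) (by linarith)).mono ?_)
    rw [uIcc_of_le (by linarith), uIcc_of_le (by linarith)]
    exact Icc_subset_Icc_left (by linarith)
  prim_u := by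
    rw [ae_restrict_iff' measurableSet_Ioo]
    filter_upwards [ae_comp_add h.prim_u s] with t ht hm
    exact (ht (by linarith [hm.1])).comp_add y
  prim_flux := by
    rw [ae_restrict_iff' measurableSet_Ioo]
    filter_upwards [ae_comp_add h.prim_flux s] with t ht hm
    exact (ht (by linarith [hm.1])).comp_add y

theorem Regular.evolution (h : Regular ε u v a w b) {T : ℝ} (hT : 0 ≤ T) :
    Evolution ε T u v w w := by
  simpa using h.evolution_shift hT le_rfl 0

theorem evolution_zero (ε T : ℝ) :
    Evolution ε T (fun _ => 0) (fun _ => 0) (fun _ => 0) (fun _ => 0) where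
  memLp_u := MemLp.zero'
  memLp_v := MemLp.zero'
  memLp_w := MemLp.zero'
  memLp_q := MemLp.zero'
  continuous_start := continuous_const
  continuous_end := continuous_const
  time := .of_forall fun _ => PrimOn.const 0
  prim_u := .of_forall fun _ => Prim.const 0
  prim_flux := .of_forall fun _ => Prim.const _

theorem memLp_comp_snd {f : ℝ → ℝ} (hf : MemLp f 2) (T : ℝ) :
    MemLp (fun z : ℝ × ℝ => f z.2) 2 (stripM T) := by
  unfold stripM
  exact hf.comp_snd _

/-- A fixed profile has time derivative 0 but spatial part q. Relative to a solution it is an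
evolution with source q, and this is why `Evolution` keeps w and q apart. -/
theorem evolution_stationary {f d q : ℝ → ℝ} (hf : MemLp f 2) (hd : MemLp d 2) (hq : MemLp q 2)
    (p : Prim f d) (pq : Prim (fun x => flux ε (d x) - f x ^ 2 / 2) q) (T : ℝ) :
    Evolution ε T (fun z => f z.2) (fun z => d z.2) (fun _ => 0) (fun z => q z.2) where
  memLp_u := memLp_comp_snd hf T
  memLp_v := memLp_comp_snd hd T
  memLp_w := MemLp.zero'
  memLp_q := memLp_comp_snd hq T
  continuous_start := (show Continuous fun x => f x from p.continuous)
  continuous_end := (show Continuous fun x => f x from p.continuous)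
  time := .of_forall fun x => PrimOn.const (f x)
  prim_u := .of_forall fun _ => p
  prim_flux := .of_forall fun _ => pq

theorem Regular.lintegral_le (hε : 0 < ε) (h : Regular ε u v a w b) {t : ℝ} (ht : 0 ≤ t) :
    ∫⁻ x, ‖u (t, x)‖ₑ ≤ ∫⁻ x, ‖u (0, x)‖ₑ := by
  simpa using (h.evolution ht).l1_contraction hε ht le_rfl (evolution_zero ε t)
    (.of_forall fun s => by simp)

/-- The equation is invariant under translations, so a solution contracts towards its own
translates. The case s = 0 controls ∂_x u, the case y = 0 controls ∂_t u. -/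
theorem Regular.lintegral_shift_le (hε : 0 < ε) (h : Regular ε u v a w b) {t s : ℝ} (ht : 0 ≤ t)
    (hs : 0 ≤ s) (y : ℝ) : ∫⁻ x, ‖u (t + s, x + y) - u (t, x)‖ₑ ≤
      ∫⁻ x, ‖u (s, x + y) - u (0, x)‖ₑ := by
  simpa using (h.evolution_shift ht hs y).l1_contraction hε ht le_rfl (h.evolution ht)
    (.of_forall fun s => by simp)

theorem Prim.lintegral_shift_le {f d : ℝ → ℝ} (h : Prim f d) {k : ℝ} (hk : 0 ≤ k) :
    ∫⁻ x, ‖f (x + k) - f x‖ₑ ≤ ENNReal.ofReal k * ∫⁻ x, ‖d x‖ₑ := by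
  -- Tonelli on the plane needs a representative of d that is measurable on its own, since d is
  -- evaluated at y + x.
  obtain ⟨d', hd', he⟩ := h.locallyIntegrable.aestronglyMeasurable
  have h' : Prim f d' := h.congr_ae he
  have e0 : ∫⁻ x, ‖d x‖ₑ = ∫⁻ x, ‖d' x‖ₑ :=
    lintegral_congr_ae (he.mono fun x hx => by simp only [hx])
  rw [e0]
  calc ∫⁻ x, ‖f (x + k) - f x‖ₑ ≤ ∫⁻ x, ∫⁻ y in Ioc 0 k, ‖d' (y + x)‖ₑ := by
        refine lintegral_mono fun x => ?_
        have e : f (x + k) - f x = ∫ y in Ioc 0 k, d' (y + x) := by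
          rw [← intervalIntegral.integral_of_le hk, intervalIntegral.integral_comp_add_right,
            h'.integral_eq, zero_add, add_comm k]
        rw [e]
        exact enorm_integral_le_lintegral_enorm _
    _ = ∫⁻ y in Ioc 0 k, ∫⁻ x, ‖d' (y + x)‖ₑ := by
        rw [lintegral_lintegral_swap]
        exact ((hd'.measurable.comp (measurable_snd.add measurable_fst)).enorm).aemeasurable
    _ = ∫⁻ y in Ioc 0 k, ∫⁻ x, ‖d' x‖ₑ := by
        simp_rw [lintegral_add_left_eq_self (fun x => ‖d' x‖ₑ)]
    _ = _ := by rw [setLIntegral_const, Real.volume_Ioc, sub_zero, mul_comm]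

theorem tendsto_quotient_of_hasDerivAt {f : ℝ → ℝ} {f' x : ℝ} (h : HasDerivAt f f' x) :
    Tendsto (fun n => (f (x + regSeq n) - f x) / regSeq n) atTop (𝓝 f') := by
  have h1 := hasDerivAt_iff_tendsto_slope_zero.1 h
  have h2 : Tendsto regSeq atTop (𝓝[≠] 0) := tendsto_nhdsWithin_iff.2
    ⟨tendsto_regSeq, .of_forall fun n => (regSeq_pos n).ne'⟩
  refine (h1.comp h2).congr fun n => ?_
  simp [inv_mul_eq_div]

/-- Fatou's lemma along the steps 1/(n+1): an L¹ increment of at most the step times C passes to the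
limit of the difference quotients. -/
theorem lintegral_le_of_quotients {F : ℕ → ℝ → ℝ} {g : ℝ → ℝ} {C : ENNReal}
    (hm : ∀ n, AEMeasurable (F n)) (hF : ∀ n, ∫⁻ x, ‖F n x‖ₑ ≤ ENNReal.ofReal (regSeq n) * C)
    (hl : ∀ᵐ x : ℝ, Tendsto (fun n => F n x / regSeq n) atTop (𝓝 (g x))) :
    ∫⁻ x, ‖g x‖ₑ ≤ C := by
  have h1 : ∫⁻ x, ‖g x‖ₑ = ∫⁻ x, liminf (fun n => ‖F n x / regSeq n‖ₑ) atTop :=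
    lintegral_congr_ae (hl.mono fun x hx => ((continuous_enorm.tendsto _).comp hx).liminf_eq.symm)
  rw [h1]
  refine (lintegral_liminf_le' fun n => ((hm n).div_const _).enorm).trans ?_
  refine liminf_le_of_le (by isBoundedDefault) fun c hc => ?_
  obtain ⟨n, hn⟩ := hc.exists
  refine hn.trans ?_
  have hp := regSeq_pos n
  have e : ∀ x, ‖F n x / regSeq n‖ₑ = ENNReal.ofReal (regSeq n)⁻¹ * ‖F n x‖ₑ := fun x => by
    rw [div_eq_inv_mul, enorm_mul, Real.enorm_of_nonneg (inv_nonneg.2 hp.le)]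
  simp_rw [e]
  rw [lintegral_const_mul' _ _ ENNReal.ofReal_ne_top]
  calc ENNReal.ofReal (regSeq n)⁻¹ * ∫⁻ x, ‖F n x‖ₑ
      ≤ ENNReal.ofReal (regSeq n)⁻¹ * (ENNReal.ofReal (regSeq n) * C) := by gcongr; exact hF n
    _ = C := by
        rw [← mul_assoc, ← ENNReal.ofReal_mul (inv_nonneg.2 hp.le), inv_mul_cancel₀ hp.ne',
          ENNReal.ofReal_one, one_mul]

theorem Regular.lintegral_deriv_le (hε : 0 < ε) (h : Regular ε u v a w b) {d : ℝ → ℝ}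
    (hd : Prim (fun x => u (0, x)) d) :
    ∀ᵐ t : ℝ, 0 < t → ∫⁻ x, ‖v (t, x)‖ₑ ≤ ∫⁻ x, ‖d x‖ₑ := by
  filter_upwards [h.prim_u] with t ht h0
  have hc := continuous_slice h.cont h0.le
  refine lintegral_le_of_quotients (F := fun n x => u (t, x + regSeq n) - u (t, x))
    (fun n => ((hc.comp (continuous_id.add continuous_const)).sub hc).aemeasurable) (fun n => ?_)
    ((ht h0).ae_hasDerivAt.mono fun x hx => tendsto_quotient_of_hasDerivAt hx)
  have := h.lintegral_shift_le hε h0.le le_rfl (regSeq n)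
  rw [add_zero] at this
  exact this.trans (hd.lintegral_shift_le (regSeq_pos n).le)

/-- Absolute continuity in time gives the limit for almost every x and then almost every t.
Exchanging the order requires a measurable set, hence the frozen extension of u and a measurable
version of w. -/
theorem Regular.ae_quotient_time (h : Regular ε u v a w b) :
    ∀ᵐ t : ℝ, 0 < t → ∀ᵐ x : ℝ,
      Tendsto (fun n => (u (t + regSeq n, x) - u (t, x)) / regSeq n) atTop (𝓝 (w (t, x))) := by
  have hU := continuous_extend_past h.cont
  obtain ⟨w', hw', he⟩ := (locallyIntegrable_ext0 h.memLp_w).aestronglyMeasurable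
  have hmeas : MeasurableSet {p : ℝ × ℝ | Tendsto
      (fun n => (u (max (p.2 + regSeq n) 0, p.1) - u (max p.2 0, p.1)) / regSeq n) atTop
      (𝓝 (w' (p.2, p.1)))} := by
    refine measurableSet_tendsto_fun (fun n => ?_) (hw'.measurable.comp measurable_swap)
    have c1 : Continuous fun p : ℝ × ℝ => u (max (p.2 + regSeq n) 0, p.1) :=
      hU.comp ((continuous_snd.add continuous_const).prodMk continuous_fst)
    have c2 : Continuous fun p : ℝ × ℝ => u (max p.2 0, p.1) := hU.comp continuous_swap
    exact ((c1.sub c2).div_const _).measurable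
  have h1 : ∀ᵐ x : ℝ, ∀ᵐ t : ℝ, Tendsto
      (fun n => (u (max (t + regSeq n) 0, x) - u (max t 0, x)) / regSeq n) atTop
      (𝓝 (w' (t, x))) := by
    filter_upwards [h.prim_time, ae_slice_fst he] with x hx he
    filter_upwards [hx.ae_hasDerivAt, he] with t ht he
    rw [← he]
    exact tendsto_quotient_of_hasDerivAt ht
  have h2 := (Measure.ae_ae_comm hmeas).1 h1
  filter_upwards [h2, ae_slice_snd he] with t ht he h0
  filter_upwards [ht, he] with x hx he
  rw [← he, ext0_of_pos w h0, max_eq_left h0.le] at hx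
  refine hx.congr fun n => ?_
  rw [max_eq_left (add_pos h0 (regSeq_pos n)).le]

theorem Regular.lintegral_time_deriv_le (hε : 0 < ε) (h : Regular ε u v a w b) {C : ℝ}
    (hC : 0 ≤ C) {d q : ℝ → ℝ} (hf : MemLp (fun x => u (0, x)) 2) (hd : MemLp d 2)
    (hq : MemLp q 2) (p : Prim (fun x => u (0, x)) d)
    (pq : Prim (fun x => flux ε (d x) - u (0, x) ^ 2 / 2) q)
    (hqC : ∫⁻ x, ‖q x‖ₑ ≤ ENNReal.ofReal C) :
    ∀ᵐ t : ℝ, 0 < t → ∫⁻ x, ‖w (t, x)‖ₑ ≤ ENNReal.ofReal C := by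
  -- Comparison with the stationary initial profile: the distance grows at rate at most C. The time
  -- translate estimate then moves this increment to any later time.
  have h1 : ∀ s, 0 ≤ s → ∫⁻ x, ‖u (s, x) - u (0, x)‖ₑ ≤ ENNReal.ofReal (s * C) := by
    intro s hs
    simpa using (h.evolution hs).l1_contraction hε hs hC (evolution_stationary hf hd hq p pq s)
      (.of_forall fun t => by simpa using hqC)
  filter_upwards [h.ae_quotient_time] with t ht h0
  refine lintegral_le_of_quotients (F := fun n x => u (t + regSeq n, x) - u (t, x))
    (fun n => ((continuous_slice h.cont (add_pos h0 (regSeq_pos n)).le).sub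
      (continuous_slice h.cont h0.le)).aemeasurable) (fun n => ?_) (ht h0)
  have h2 := h.lintegral_shift_le hε h0.le (regSeq_pos n).le 0
  simp only [add_zero] at h2
  refine (h2.trans (h1 _ (regSeq_pos n).le)).trans (le_of_eq ?_)
  rw [ENNReal.ofReal_mul (regSeq_pos n).le]

end

/-! ### Integral estimates at a fixed time -/

section

theorem hasDerivAt_comp_pos {f f' : ℝ → ℝ} (h : ∀ z, HasDerivAt f (f' z) z) (h0 : f' 0 = 0)
    (z : ℝ) : HasDerivAt (fun z => f (max z 0)) (f' (max z 0)) z := by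
  rcases lt_trichotomy z 0 with hz | rfl | hz
  · rw [max_eq_right hz.le, h0]
    refine (hasDerivAt_const z (f 0)).congr_of_eventuallyEq ?_
    filter_upwards [Iio_mem_nhds hz] with y hy
    rw [max_eq_right (le_of_lt hy)]
  · rw [max_self, h0, ← hasDerivWithinAt_univ, ← Iic_union_Ici (a := (0 : ℝ))]
    refine HasDerivWithinAt.union ?_ ?_
    · refine (hasDerivWithinAt_const 0 _ (f 0)).congr (fun y hy => ?_) (by simp)
      rw [max_eq_right hy]
    · have hd : HasDerivAt f 0 0 := by
        have := h 0
        rwa [h0] at this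
      refine hd.hasDerivWithinAt.congr
        (fun y hy => ?_) (by simp)
      rw [max_eq_left hy]
  · rw [max_eq_left hz.le]
    refine (h z).congr_of_eventuallyEq ?_
    filter_upwards [Ioi_mem_nhds hz] with y hy
    rw [max_eq_left (le_of_lt hy)]

theorem contDiff_one_of_hasDerivAt {f f' : ℝ → ℝ} (h : ∀ z, HasDerivAt f (f' z) z)
    (hc : Continuous f') : ContDiff ℝ 1 f := by
  rw [contDiff_one_iff_deriv, show deriv f = f' from funext fun z => (h z).deriv]
  exact ⟨fun z => (h z).differentiableAt, hc⟩

theorem Prim.comp' {F f β β' : ℝ → ℝ} (hF : Prim F f) (h : ∀ z, HasDerivAt β (β' z) z)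
    (hc : Continuous β') : Prim (fun x => β (F x)) (fun x => β' (F x) * f x) := by
  have := hF.comp (contDiff_one_of_hasDerivAt h hc)
  rwa [show deriv β = β' from funext fun z => (h z).deriv] at this

/-- Powers of the positive part of `z - m`. -/
theorem hasDerivAt_pos_pow (n : ℕ) (m z : ℝ) :
    HasDerivAt (fun z => max (z - m) 0 ^ (n + 2)) ((n + 2 : ℝ) * max (z - m) 0 ^ (n + 1)) z := by
  have h := hasDerivAt_comp_pos (f := fun z => z ^ (n + 2)) (f' := fun z => (n + 2 : ℝ) * z ^ (n + 1))
    (fun z => by simpa using hasDerivAt_pow (n + 2) z) (by simp) (z - m)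
  exact h.comp_sub_const z m

theorem pos_le_abs {m : ℝ} (hm : 0 ≤ m) (z : ℝ) : max (z - m) 0 ≤ |z| :=
  max_le ((by linarith : z - m ≤ z).trans (le_abs_self z)) (abs_nonneg z)

section Slices

variable {ε : ℝ} {u v a w b : ℝ → ℝ}

theorem memLp_mul_bdd {f g : ℝ → ℝ} {K : ℝ} (hf : Continuous f) (hb : ∀ x, |f x| ≤ K)
    (hg : MemLp g 2) : MemLp (fun x => f x * g x) 2 :=
  hg.of_le_mul (c := K) (hf.aestronglyMeasurable.mul hg.1) (.of_forall fun x => by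
    rw [norm_mul]; gcongr; exact hb x)

/-- Dissipation of convex functionals of the solution. -/
theorem integral_comp_mul_nonpos (hε : 0 < ε) (hu : MemLp u 2) (hv : MemLp v 2) (hw : MemLp w 2)
    (p : Prim u v) (pf : Prim (fun x => flux ε (v x) - u x ^ 2 / 2) w) {θ θ' : ℝ → ℝ}
    (hθ : ∀ z, HasDerivAt θ (θ' z) z) (hc : Continuous θ') (h0 : θ 0 = 0) (hpos : ∀ z, 0 ≤ θ' z) :
    ∫ x, θ (u x) * w x ≤ 0 := by
  obtain ⟨K, hK, hb⟩ := p.exists_bound hu hv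
  obtain ⟨L, hL⟩ := (isCompact_Icc (a := -K) (b := K)).exists_bound_of_continuousOn hc.continuousOn
  have hθb : ∀ x, |θ (u x)| ≤ L * |u x| := fun x => by
    have := Convex.norm_image_sub_le_of_norm_hasDerivWithin_le (s := Icc (-K) K) (f := θ)
      (f' := θ') (C := L) (fun z _ => (hθ z).hasDerivWithinAt) hL (convex_Icc _ _)
      (x := 0) (y := u x) ⟨by linarith, hK⟩ (abs_le.1 (hb x))
    simpa [h0] using this
  have hθL : MemLp (fun x => θ (u x)) 2 := by
    refine hu.of_le_mul (c := L) ?_ (.of_forall fun x => hθb x)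
    have : Continuous θ := continuous_iff_continuousAt.2 fun z => (hθ z).continuousAt
    exact (this.comp p.continuous).aestronglyMeasurable
  have hcu : Continuous fun x => θ' (u x) := hc.comp p.continuous
  have hcb : ∀ x, ‖θ' (u x)‖ ≤ L := fun x => hL _ (abs_le.1 (hb x))
  have hPL : MemLp (fun x => flux ε (v x) - u x ^ 2 / 2) 2 :=
    (memLp_flux hε hv).sub (memLp_sq_div_two p hu hv)
  have i1 : Integrable fun x => θ' (u x) * v x * (flux ε (v x) - u x ^ 2 / 2) :=
    ((hv.integrable_mul hPL).bdd_mul hcu.aestronglyMeasurable (.of_forall hcb)).congr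
      (.of_forall fun x => by simp only [Pi.mul_apply]; ring)
  have i2 : Integrable fun x => θ (u x) * w x := hθL.integrable_mul hw
  have e1 := ((p.comp' hθ hc).mul pf).integral_eq_zero (hθL.integrable_mul hPL) (i1.add i2)
  rw [integral_add i1 i2] at e1
  -- The convective contribution θ'(u) (u²/2) ∂_x u is the derivative of B(u), so its integral
  -- vanishes; only the nonnegative dissipation θ'(u) v flux(v) remains.
  set B : ℝ → ℝ := fun s => ∫ r in (0 : ℝ)..s, θ' r * r ^ 2 / 2 with hB
  have hBc : Continuous fun r => θ' r * r ^ 2 / 2 := by fun_prop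
  have hBd : ∀ z, HasDerivAt B (θ' z * z ^ 2 / 2) z := fun z =>
    intervalIntegral.integral_hasDerivAt_right (hBc.intervalIntegrable _ _)
      (hBc.stronglyMeasurableAtFilter _ _) hBc.continuousAt
  have hL0 : 0 ≤ L := (norm_nonneg _).trans (hL 0 ⟨by linarith, hK⟩)
  have hBb : ∀ x, |B (u x)| ≤ L * K / 2 * |u x| ^ 2 := fun x => by
    have := intervalIntegral.norm_integral_le_of_norm_le_const (a := 0) (b := u x)
      (C := L * (K * |u x|) / 2) (f := fun r => θ' r * r ^ 2 / 2) fun r hr => by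
        have h1 : |r| ≤ |u x| := by
          have := abs_sub_left_of_mem_uIcc (uIoc_subset_uIcc hr)
          simpa using this
        have h2 := h1.trans (hb x)
        rw [norm_div, norm_mul, norm_pow, Real.norm_ofNat, Real.norm_eq_abs r, sq]
        gcongr
        exact hL r (abs_le.1 h2)
    calc |B (u x)| ≤ L * (K * |u x|) / 2 * |u x - 0| := this
      _ = _ := by rw [sub_zero]; ring
  have i3 : Integrable fun x => B (u x) := by
    refine (hu.integrable_sq.const_mul (L * K / 2)).mono'
      ((p.comp' hBd hBc).continuous).aestronglyMeasurable (.of_forall fun x => ?_)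
    simpa only [sq_abs, Real.norm_eq_abs] using hBb x
  have i4 : Integrable fun x => θ' (u x) * u x ^ 2 / 2 * v x :=
    (((memLp_sq_div_two p hu hv).integrable_mul hv).bdd_mul hcu.aestronglyMeasurable
      (.of_forall hcb)).congr (.of_forall fun x => by simp only [Pi.mul_apply]; ring)
  have e2 := (p.comp' hBd hBc).integral_eq_zero i3 i4
  have i5 : Integrable fun x => θ' (u x) * (v x * flux ε (v x)) :=
    (hv.integrable_mul (memLp_flux hε hv)).bdd_mul hcu.aestronglyMeasurable (.of_forall hcb)
  have e4 : ∫ x, θ' (u x) * v x * (flux ε (v x) - u x ^ 2 / 2) =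
      (∫ x, θ' (u x) * (v x * flux ε (v x))) - ∫ x, θ' (u x) * u x ^ 2 / 2 * v x := by
    rw [← integral_sub i5 i4]
    exact integral_congr_ae (.of_forall fun x => by ring)
  have h5 : 0 ≤ ∫ x, θ' (u x) * (v x * flux ε (v x)) := by
    refine integral_nonneg fun x => mul_nonneg (hpos _) ?_
    rcases le_total (v x) 0 with h | h
    · exact mul_nonneg_of_nonpos_of_nonpos h ((monotone_flux hε h).trans (flux_zero ε).le)
    · exact mul_nonneg h ((flux_zero ε).ge.trans (monotone_flux hε h))
  linarith

/-- The instantaneous estimate behind Oleinik's condition. -/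
theorem integral_pos_sq_mul_nonpos (hε : 0 < ε) (hu : MemLp u 2) (hv : MemLp v 2) (ha : MemLp a 2)
    (hw : MemLp w 2) (hb : MemLp b 2) (pu : Prim u v) (pv : Prim v a) (pw : Prim w b)
    (pf : Prim (fun x => flux ε (v x) - u x ^ 2 / 2) w) {m : ℝ} (hm : 0 ≤ m) :
    ∫ x, 3 * max (v x - m) 0 ^ 2 * (b x + m ^ 2) ≤ 0 := by
  obtain ⟨K, hK, hvb⟩ := pv.exists_bound hv ha
  obtain ⟨N, hN, hub⟩ := pu.exists_bound hu hv
  set p : ℝ → ℝ := fun x => max (v x - m) 0 with hp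
  have hp0 : ∀ x, 0 ≤ p x := fun x => le_max_right _ _
  have hpv : ∀ x, p x ≤ |v x| := fun x => pos_le_abs hm _
  have hpK : ∀ x, |p x| ≤ K := fun x => by rw [abs_of_nonneg (hp0 x)]; exact (hpv x).trans (hvb x)
  have hpc : Continuous p := (pv.continuous.sub continuous_const).max continuous_const
  have hpL : MemLp p 2 := hv.of_le (hpc.aestronglyMeasurable) (.of_forall fun x => by
    rw [Real.norm_of_nonneg (hp0 x)]; exact hpv x)
  have hp2L : MemLp (fun x => p x ^ 2) 2 := by
    simpa only [sq] using memLp_mul_bdd hpc hpK hpL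
  have pp2 : Prim (fun x => p x ^ 2) (fun x => 2 * p x * a x) := by
    have := pv.comp' (hasDerivAt_pos_pow 0 m) (by fun_prop)
    simpa using this
  have hpaL : MemLp (fun x => p x * a x) 2 := memLp_mul_bdd hpc hpK ha
  have i1 : Integrable fun x => 2 * p x * a x * w x :=
    ((hpaL.integrable_mul hw).const_mul 2).congr
      (.of_forall fun x => by simp only [Pi.mul_apply]; ring)
  have i2 : Integrable fun x => p x ^ 2 * b x := hp2L.integrable_mul hb
  have e1 := (pp2.mul pw).integral_eq_zero (hp2L.integrable_mul hw) (i1.add i2)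
  rw [integral_add i1 i2] at e1
  -- A primitive of 2(s - m)₊ s, chosen so that 2pva = ∂_x H(v); a second integration by parts moves
  -- the derivative onto u and gives -∫ H(v) v.
  set H : ℝ → ℝ := fun s => 2 / 3 * max (s - m) 0 ^ 3 + m * max (s - m) 0 ^ 2 with hH
  have hHd : ∀ z, HasDerivAt H (2 * max (z - m) 0 * z) z := fun z => by
    have h1 := ((hasDerivAt_pos_pow 1 m z).const_mul (2 / 3)).add
      ((hasDerivAt_pos_pow 0 m z).const_mul m)
    refine h1.congr_deriv ?_
    rcases le_total (z - m) 0 with h | h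
    · simp [max_eq_right h]
    · rw [max_eq_left h]; norm_num; ring
  have pH : Prim (fun x => H (v x)) (fun x => 2 * p x * v x * a x) :=
    pv.comp' hHd (by fun_prop)
  have hHL : MemLp (fun x => H (v x)) 2 := by
    refine ((memLp_mul_bdd hpc hpK hp2L).const_mul (2 / 3)).add (hp2L.const_mul m) |>.congr_norm
      pH.continuous.aestronglyMeasurable (.of_forall fun x => ?_)
    simp only [Pi.add_apply, hH, hp]
    ring_nf
  have hpvaL : MemLp (fun x => p x * (v x * a x)) 2 :=
    memLp_mul_bdd hpc hpK (memLp_mul_bdd pv.continuous hvb ha)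
  have i3 : Integrable fun x => 2 * p x * v x * a x * u x :=
    ((hpvaL.integrable_mul hu).const_mul 2).congr
      (.of_forall fun x => by simp only [Pi.mul_apply]; ring)
  have i4 : Integrable fun x => H (v x) * v x := hHL.integrable_mul hv
  have e2 := (pH.mul pu).integral_eq_zero (hHL.integrable_mul hu) (i3.add i4)
  rw [integral_add i3 i4] at e2
  have hwae : ∀ᵐ x : ℝ, w x = deriv (flux ε) (v x) * a x - u x * v x := by
    have q1 := (pv.comp (contDiff_flux hε)).sub ((pu.mul pu).comp' (β := fun s => s / 2)
      (β' := fun _ => 1 / 2) (fun z => (hasDerivAt_id z).div_const 2) continuous_const)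
    have q2 := Prim.ae_unique pf (F := fun x => flux ε (v x) - u x ^ 2 / 2) (by
      convert q1 using 3 with x; ring)
    filter_upwards [q2] with x hx
    rw [hx]; ring
  -- Inserting w = flux'(v)a - uv, the viscous part is -2p flux'(v)a² ≤ 0 and is dropped.
  have hle : ∫ x, -(2 * p x * a x * w x) ≤ ∫ x, 2 * p x * v x * a x * u x := by
    refine integral_mono_ae i1.neg i3 ?_
    filter_upwards [hwae] with x hx
    rw [hx]
    have : 0 ≤ 2 * p x * (deriv (flux ε) (v x) * a x ^ 2) :=
      mul_nonneg (by linarith [hp0 x]) (mul_nonneg (deriv_flux_nonneg hε _) (sq_nonneg _))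
    nlinarith [this]
  rw [integral_neg] at hle
  have i6 : Integrable fun x => p x ^ 2 := hpL.integrable_sq
  have e5 : ∫ x, 3 * p x ^ 2 * (b x + m ^ 2) =
      3 * (∫ x, p x ^ 2 * b x) + 3 * m ^ 2 * ∫ x, p x ^ 2 := by
    rw [← integral_const_mul, ← integral_const_mul,
      ← integral_add (i2.const_mul 3) (i6.const_mul (3 * m ^ 2))]
    exact integral_congr_ae (.of_forall fun x => by ring)
  -- Where v > m, substituting v = p + m shows that H(v)v exceeds m²p² by terms with nonnegative
  -- coefficients. This is the Riccati gain that matches m' = -m².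
  have hfin : m ^ 2 * ∫ x, p x ^ 2 ≤ ∫ x, H (v x) * v x := by
    rw [← integral_const_mul]
    refine integral_mono (i6.const_mul _) i4 fun x => ?_
    simp only [hH, hp]
    rcases le_total (v x - m) 0 with h | h
    · simp [max_eq_right h]
    · rw [max_eq_left h]
      have e : (2 / 3 * (v x - m) ^ 3 + m * (v x - m) ^ 2) * v x - m ^ 2 * (v x - m) ^ 2 =
        2 / 3 * (v x - m) ^ 4 + 5 / 3 * (m * (v x - m) ^ 3) := by ring
      have : 0 ≤ 2 / 3 * (v x - m) ^ 4 + 5 / 3 * (m * (v x - m) ^ 3) := by positivity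
      linarith
  have hgoal : ∫ x, 3 * max (v x - m) 0 ^ 2 * (b x + m ^ 2) =
    ∫ x, 3 * p x ^ 2 * (b x + m ^ 2) := rfl
  rw [hgoal, e5]
  linarith

/-- The convective term is controlled in `L¹` by the time derivative. -/
theorem integral_abs_mul_le (hε : 0 < ε) (hu : MemLp u 2) (hv : MemLp v 2)
    (hw1 : Integrable w) (pu : Prim u v)
    (pf : Prim (fun x => flux ε (v x) - u x ^ 2 / 2) w) (hvc : Continuous v) :
    ∫ x, |u x * v x| ≤ 2 * ∫ x, |w x| := by
  have hσL : MemLp (fun x => flux ε (v x)) 2 := memLp_flux hε hv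
  have hσc : Continuous fun x => flux ε (v x) := (contDiff_flux hε).continuous.comp hvc
  have huv1 : Integrable fun x => u x * v x := hu.integrable_mul hv
  have pσ : Prim (fun x => flux ε (v x)) (fun x => w x + u x * v x) := by
    have := pf.add ((pu.mul pu).comp' (β := fun s => s / 2)
      (β' := fun _ => 1 / 2) (fun z => (hasDerivAt_id z).div_const 2) continuous_const)
    convert this using 2 with x x <;> ring
  -- θ approximates the indicator of {v > 0} (flux and v have the same positivity set) and ψ the
  -- sign of u. Their product turns uv into |u| max(v, 0) in the limit.
  let θ : ℝ → ℝ → ℝ := fun δ x => stress δ (max (flux ε (v x)) 0)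
  let ψ : ℝ → ℝ → ℝ := fun δ x => stress δ (u x)
  have hθc : ∀ δ, 0 < δ → Continuous (θ δ) := fun δ hδ =>
    (contDiff_stress hδ).continuous.comp (hσc.max continuous_const)
  have hψc : ∀ δ, 0 < δ → Continuous (ψ δ) := fun δ hδ =>
    (contDiff_stress hδ).continuous.comp pu.continuous
  have hθψ : ∀ δ x, ‖θ δ x * ψ δ x‖ ≤ 1 := fun δ x => by
    rw [norm_mul]
    exact mul_le_one₀ (abs_stress_le_one _ _) (norm_nonneg _) (abs_stress_le_one _ _)
  have iw : ∀ δ, 0 < δ → Integrable fun x => θ δ x * ψ δ x * w x := fun δ hδ =>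
    hw1.bdd_mul ((hθc δ hδ).mul (hψc δ hδ)).aestronglyMeasurable (.of_forall (hθψ δ))
  have iuv : ∀ δ, 0 < δ → Integrable fun x => θ δ x * ψ δ x * (u x * v x) := fun δ hδ =>
    huv1.bdd_mul ((hθc δ hδ).mul (hψc δ hδ)).aestronglyMeasurable (.of_forall (hθψ δ))
  have key : ∀ δ, 0 < δ → ∫ x, θ δ x * ψ δ x * (u x * v x) ≤ ∫ x, |w x| := by
    intro δ hδ
    let Θ : ℝ → ℝ := fun x => absReg δ (max (flux ε (v x)) 0)
    have hst0 : stress δ 0 = 0 := by simp [stress]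
    have pΘ : Prim Θ (fun x => θ δ x * (w x + u x * v x)) :=
      pσ.comp' (β := fun s => absReg δ (max s 0)) (β' := fun s => stress δ (max s 0))
        (hasDerivAt_comp_pos (hasDerivAt_absReg hδ) hst0)
        ((contDiff_stress hδ).continuous.comp (continuous_id.max continuous_const))
    have hΘL : MemLp Θ 2 := hσL.of_le pΘ.continuous.aestronglyMeasurable (.of_forall fun x => by
      rw [Real.norm_of_nonneg (absReg_nonneg _ _)]
      refine (absReg_le hδ _).trans ?_
      rw [abs_of_nonneg (le_max_right _ _)]
      exact max_le (le_abs_self _) (abs_nonneg _))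
    have pψ : Prim (ψ δ) (fun x => absReg'' δ (u x) * v x) :=
      pu.comp' (β := stress δ) (β' := absReg'' δ) (hasDerivAt_stress hδ) (continuous_absReg'' hδ)
    have hψL : MemLp (ψ δ) 2 := memLp_stress hδ hu
    have hjc : Continuous fun x => absReg'' δ (u x) := (continuous_absReg'' hδ).comp pu.continuous
    have i1 : Integrable fun x => θ δ x * (w x + u x * v x) * ψ δ x :=
      ((iw δ hδ).add (iuv δ hδ)).congr (.of_forall fun x => by simp only [Pi.add_apply]; ring)
    have i2 : Integrable fun x => Θ x * (absReg'' δ (u x) * v x) :=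
      hΘL.integrable_mul (memLp_mul_bdd hjc (fun x => by
        rw [abs_of_nonneg (absReg''_nonneg hδ _)]; exact absReg''_le hδ _) hv)
    have e1 := (pΘ.mul pψ).integral_eq_zero (hΘL.integrable_mul hψL) (i1.add i2)
    rw [integral_add i1 i2] at e1
    -- The derivative falling on the sign of u has a favourable sign: Θ vanishes wherever v ≤ 0.
    have h2 : 0 ≤ ∫ x, Θ x * (absReg'' δ (u x) * v x) := by
      refine integral_nonneg fun x => ?_
      rcases le_or_gt (v x) 0 with h | h
      · have : flux ε (v x) ≤ 0 := (monotone_flux hε h).trans (flux_zero ε).le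
        have : Θ x = 0 := by simp [Θ, max_eq_right this, absReg, Real.sqrt_sq hδ.le]
        simp [this]
      · exact mul_nonneg (absReg_nonneg _ _) (mul_nonneg (absReg''_nonneg hδ _) h.le)
    have e2 : ∫ x, θ δ x * (w x + u x * v x) * ψ δ x =
        (∫ x, θ δ x * ψ δ x * w x) + ∫ x, θ δ x * ψ δ x * (u x * v x) := by
      rw [← integral_add (iw δ hδ) (iuv δ hδ)]
      exact integral_congr_ae (.of_forall fun x => by ring)
    have h3 : -∫ x, |w x| ≤ ∫ x, θ δ x * ψ δ x * w x := by
      rw [← integral_neg]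
      refine integral_mono hw1.abs.neg (iw δ hδ) fun x => ?_
      have := neg_abs_le (θ δ x * ψ δ x * w x)
      rw [abs_mul] at this
      have h4 : |θ δ x * ψ δ x| * |w x| ≤ |w x| := mul_le_of_le_one_left (abs_nonneg _) (hθψ δ x)
      linarith
    linarith
  have hlim : Tendsto (fun n => ∫ x, θ (regSeq n) x * ψ (regSeq n) x * (u x * v x)) atTop
      (𝓝 (∫ x, |u x| * max (v x) 0)) := by
    refine tendsto_integral_of_dominated_convergence (fun x => |u x * v x|)
      (fun n => (iuv _ (regSeq_pos n)).1) huv1.abs (fun n => .of_forall fun x => ?_) (.of_forall fun x => ?_)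
    · rw [norm_mul]; exact mul_le_of_le_one_left (norm_nonneg _) (hθψ _ x)
    · by_cases hux : u x = 0
      · simp [hux]
      rcases le_or_gt (v x) 0 with h | h
      · have : flux ε (v x) ≤ 0 := (monotone_flux hε h).trans (flux_zero ε).le
        simp [θ, max_eq_right this, max_eq_right h, stress]
      · have hf := (flux_pos_iff hε (v x)).2 h
        have t1 : Tendsto (fun n => θ (regSeq n) x) atTop (𝓝 1) := by
          have := tendsto_stress (flux ε (v x)) hf.ne'
          rw [abs_of_pos hf, div_self hf.ne'] at this
          simpa only [θ, max_eq_left hf.le] using this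
        have t2 := (t1.mul (tendsto_stress (u x) hux)).mul_const (u x * v x)
        have e : 1 * (u x / |u x|) * (u x * v x) = |u x| * max (v x) 0 := by
          rw [max_eq_left h.le]
          have := abs_pos.2 hux
          field_simp
          rw [sq_abs]
        rwa [e] at t2
  have h1 := le_of_tendsto' hlim fun n => key _ (regSeq_pos n)
  -- The integrand is the derivative of u|u|/2, written with squares of positive parts. Hence the
  -- positive and negative parts of |u|v have equal integrals, and the estimate for v > 0 only has
  -- to be doubled.
  have hz : ∫ x, |u x| * v x = 0 := by
    have hd : ∀ z : ℝ, HasDerivAt (fun z => (max (z - 0) 0 ^ 2 - max (-z - 0) 0 ^ 2) / 2) |z| z := by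
      intro z
      have h1 := hasDerivAt_pos_pow 0 0 z
      have h2 := (hasDerivAt_pos_pow 0 0 (-z)).comp z (hasDerivAt_neg z)
      refine ((h1.sub h2).div_const 2).congr_deriv ?_
      rcases le_total z 0 with h | h
      · simp [max_eq_right h, max_eq_left (neg_nonneg.2 h), abs_of_nonpos h]; ring
      · simp [max_eq_left h, max_eq_right (neg_nonpos.2 h), abs_of_nonneg h]
    refine (pu.comp' hd continuous_abs).integral_eq_zero ?_ (hu.abs.integrable_mul hv)
    refine hu.integrable_sq.mono' ((pu.comp' hd continuous_abs).continuous).aestronglyMeasurable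
      (.of_forall fun x => ?_)
    rw [Real.norm_eq_abs]
    rcases le_total (u x) 0 with h | h
    · rw [sub_zero, sub_zero, max_eq_right h, max_eq_left (neg_nonneg.2 h), abs_le]
      constructor <;> nlinarith [sq_nonneg (u x)]
    · rw [sub_zero, sub_zero, max_eq_left h, max_eq_right (neg_nonpos.2 h), abs_le]
      constructor <;> nlinarith [sq_nonneg (u x)]
  have i8 : Integrable fun x => |u x| * v x := hu.abs.integrable_mul hv
  have i9 : Integrable fun x => |u x| * max (v x) 0 := by
    refine huv1.abs.mono' (pu.continuous.abs.mul (hvc.max continuous_const)).aestronglyMeasurable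
      (.of_forall fun x => ?_)
    rw [Real.norm_of_nonneg (mul_nonneg (abs_nonneg _) (le_max_right _ _)), abs_mul]
    gcongr
    exact max_le (le_abs_self _) (abs_nonneg _)
  have e : ∫ x, |u x * v x| = 2 * (∫ x, |u x| * max (v x) 0) - ∫ x, |u x| * v x := by
    rw [← integral_const_mul, ← integral_sub (i9.const_mul 2) i8]
    refine integral_congr_ae (.of_forall fun x => ?_)
    simp only [abs_mul]
    rcases le_total (v x) 0 with h | h
    · rw [max_eq_right h, abs_of_nonpos h]; ring
    · rw [max_eq_left h, abs_of_nonneg h]; ring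
  rw [e, hz, sub_zero]
  linarith

end Slices

end

/-! ### Maximum principle and Oleinik's condition -/

section

variable {ε : ℝ} {u v a w b : ℝ × ℝ → ℝ}

theorem eq_zero_of_integral_nonpos {f : ℝ → ℝ} (hf : Integrable f) (h0 : ∀ x, 0 ≤ f x)
    (h : ∫ x, f x ≤ 0) : ∀ᵐ x : ℝ, f x = 0 :=
  (integral_eq_zero_iff_of_nonneg h0 hf).1 (le_antisymm h (integral_nonneg h0))

theorem ae_stripM_of_slice {p : ℝ × ℝ → Prop} {T : ℝ}
    (h : ∀ᵐ t : ℝ, 0 < t → t < T → ∀ x, p (t, x)) :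
    ∀ᵐ z ∂stripM T, z.1 ∈ Ioo 0 T ∧ p z := by
  have h1 : ∀ᵐ t ∂volume.restrict (Ioo 0 T), t ∈ Ioo 0 T ∧ ∀ x, p (t, x) := by
    rw [ae_restrict_iff' measurableSet_Ioo]
    filter_upwards [h] with t ht hm using ⟨hm, ht hm.1 hm.2⟩
  filter_upwards [(Measure.quasiMeasurePreserving_fst (ν := (volume : Measure ℝ))).ae h1]
    with z hz using ⟨hz.1, hz.2 z.2⟩

theorem Regular.abs_le_of_initial (hε : 0 < ε) (h : Regular ε u v a w b) {M : ℝ}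
    (hM : ∀ x, |u (0, x)| ≤ M) {T : ℝ} (hT : 0 ≤ T) (x : ℝ) : |u (T, x)| ≤ M := by
  have hM0 : 0 ≤ M := (abs_nonneg _).trans (hM 0)
  -- β is convex and vanishes exactly on [-M, M]. Third powers are used so that its derivative θ is
  -- itself C¹, as `integral_comp_mul_nonpos` requires.
  set θ : ℝ → ℝ := fun z => 3 * max (z - M) 0 ^ 2 - 3 * max (-z - M) 0 ^ 2 with hθ
  set β : ℝ → ℝ := fun z => max (z - M) 0 ^ 3 + max (-z - M) 0 ^ 3 with hβ
  have hθc : Continuous θ := by fun_prop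
  have hβd : ∀ z, HasDerivAt β (θ z) z := fun z => by
    refine ((hasDerivAt_pos_pow 1 M z).add
      ((hasDerivAt_pos_pow 1 M (-z)).comp z (hasDerivAt_neg z))).congr_deriv ?_
    simp only [hθ]; push_cast; ring
  have hθd : ∀ z, HasDerivAt θ (6 * max (z - M) 0 + 6 * max (-z - M) 0) z := fun z => by
    refine (((hasDerivAt_pos_pow 0 M z).const_mul 3).sub
      (((hasDerivAt_pos_pow 0 M (-z)).comp z (hasDerivAt_neg z)).const_mul 3)).congr_deriv ?_
    push_cast; ring
  have hβ1 : ContDiff ℝ 1 β := contDiff_one_of_hasDerivAt hβd hθc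
  have hdβ : deriv β = θ := funext fun z => (hβd z).deriv
  have hθ0 : θ 0 = 0 := by simp [hθ]
  have hβz : ∀ z, |z| ≤ M → β z = 0 := fun z hz => by
    have := abs_le.1 hz
    simp only [hβ, max_eq_right (show z - M ≤ 0 by linarith),
      max_eq_right (show -z - M ≤ 0 by linarith)]
    norm_num
  have hθb : ∀ z, |θ z| ≤ 3 * |z| ^ 2 := fun z => by
    have h1 := pow_le_pow_left₀ (le_max_right (z - M) 0) (pos_le_abs hM0 z) 2
    have h2 := pow_le_pow_left₀ (le_max_right (-z - M) 0) (pos_le_abs hM0 (-z)) 2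
    rw [abs_neg] at h2
    rw [abs_le]
    constructor <;> nlinarith [sq_nonneg (max (z - M) 0), sq_nonneg (max (-z - M) 0)]
  obtain ⟨K, hK, hb⟩ := h.exists_sup_bound T
  have hθL : MemLp (fun p => θ (u p)) 2 (stripM T) := by
    refine (h.memLp_u T).of_le_mul (c := 3 * K) (hθc.comp_aestronglyMeasurable (h.memLp_u T).1) ?_
    filter_upwards [ae_stripM_of_slice (p := fun z => |u z| ≤ K)
      (hb.mono fun t ht h0 h1 x => (ht h0 h1 x).1)] with z hz
    calc ‖θ (u z)‖ ≤ 3 * |u z| ^ 2 := hθb _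
      _ = 3 * |u z| * |u z| := by ring
      _ ≤ 3 * K * ‖u z‖ := by rw [Real.norm_eq_abs]; gcongr; exact hz.2
  have hi : Integrable (fun p => deriv β (u p) * w p) (stripM T) := by
    rw [hdβ]; exact hθL.integrable_mul (h.memLp_w T)
  obtain ⟨hI, hE⟩ := energy_balance hβ1 hT (h.time_u.mono fun x hx => hx T hT) hi
    (by simp [hβz _ (hM _)])
  have hle : ∫ t in Ioo 0 T, ∫ x, deriv β (u (t, x)) * w (t, x) ≤ 0 := by
    refine integral_nonpos_of_ae ?_
    have := ae_Ioo_of_ae_pos (T := T) (p := fun t => ∫ x, deriv β (u (t, x)) * w (t, x) ≤ 0) ?_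
    · exact this
    filter_upwards [memLp_slice h.memLp_u, memLp_slice h.memLp_v, memLp_slice h.memLp_w,
      h.prim_u, h.prim_flux] with t mu mv mw p pf h0
    rw [hdβ]
    exact integral_comp_mul_nonpos hε (mu h0) (mv h0) (mw h0) (p h0) (pf h0) hθd (by fun_prop)
      hθ0 fun z => by positivity
  have h0 : ∫ x, β (u (T, x)) ≤ 0 := by
    rw [hE]; simpa [hβz _ (hM _)] using hle
  have hβ0 : ∀ z, 0 ≤ β z := fun z => by positivity
  have hc := continuous_slice h.cont hT
  -- β(u(T, ·)) is continuous and zero almost everywhere, so it is zero at every point.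
  have he := (Continuous.ae_eq_iff_eq volume (hβ1.continuous.comp hc) continuous_const).1
    (eq_zero_of_integral_nonpos hI (fun x => hβ0 _) h0)
  have hx : β (u (T, x)) = 0 := congrFun he x
  by_contra hlt
  rw [not_le, lt_abs] at hlt
  have p1 : 0 ≤ max (u (T, x) - M) 0 ^ 3 := by positivity
  have p2 : 0 ≤ max (-u (T, x) - M) 0 ^ 3 := by positivity
  rcases hlt with h1 | h1
  · have : 0 < max (u (T, x) - M) 0 ^ 3 := pow_pos (lt_max_of_lt_left (by linarith)) 3
    simp only [hβ] at hx; linarith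
  · have : 0 < max (-u (T, x) - M) 0 ^ 3 := pow_pos (lt_max_of_lt_left (by linarith)) 3
    simp only [hβ] at hx; linarith

theorem tendsto_aeRight_of_continuousOn {f : ℝ → ℝ} {t T : ℝ} (hT : t < T)
    (hf : ContinuousOn f (Icc t T)) : Tendsto f (aeRight t) (𝓝 (f t)) := by
  have h1 : Tendsto f (𝓝[Icc t T] t) (𝓝 (f t)) := hf t (left_mem_Icc.2 hT.le)
  refine h1.mono_left (inf_le_left.trans ?_)
  rw [← nhdsWithin_Ioo_eq_nhdsGT hT]
  exact nhdsWithin_mono _ Ioo_subset_Icc_self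

theorem primOn_inv_add {k T : ℝ} (hk : 0 < k) (hT : 0 ≤ T) :
    PrimOn (fun t => 1 / (t + k)) (fun t => -(1 / (t + k)) ^ 2) 0 T := by
  have hpos : ∀ t ∈ uIcc 0 T, 0 < t + k := fun t ht => by
    rw [uIcc_of_le hT] at ht; linarith [ht.1]
  constructor
  · exact ContDiffOn.absolutelyContinuousOnInterval
      (contDiffOn_const.div (contDiffOn_id.add contDiffOn_const) fun t ht => (hpos t ht).ne')
  · refine .of_forall fun t ht => ?_
    refine ((hasDerivAt_const t (1 : ℝ)).div ((hasDerivAt_id t).add_const k)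
      (hpos t ht).ne').congr_deriv ?_
    have := hpos t ht
    simp only [id]
    field_simp
    ring

/-- Comparison with the solution m(t) = 1/(t + 1/K) of m' = -m². Starting it at the finite value K,
rather than using 1/t, avoids the singularity at t = 0 and leaves room for a strict inequality
later. -/
theorem Regular.deriv_le_of_bound (hε : 0 < ε) (h : Regular ε u v a w b) {K T : ℝ} (hK : 0 < K)
    (hb : ∀ᵐ t : ℝ, 0 < t → t < T → ∀ x, |v (t, x)| ≤ K) :
    ∀ᵐ s : ℝ, 0 < s → s < T → ∀ x, v (s, x) ≤ 1 / (s + 1 / K) := by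
  obtain ⟨V, hV, hVt⟩ := h.time_v
  set m : ℝ → ℝ := fun t => 1 / (t + 1 / K) with hm
  have hm0 : m 0 = K := by simp [hm]
  have hmpos : ∀ t, 0 ≤ t → 0 < m t := fun t ht => by positivity
  have hmK : ∀ t, 0 ≤ t → m t ≤ K := fun t ht => by
    rw [← hm0]
    exact one_div_le_one_div_of_le (by positivity) (by linarith)
  set β : ℝ → ℝ := fun z => max z 0 ^ 3 with hβ
  have hβd : ∀ z, HasDerivAt β (3 * max z 0 ^ 2) z := fun z => by
    have := hasDerivAt_pos_pow 1 0 z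
    norm_num at this
    exact this
  have hβ1 : ContDiff ℝ 1 β := contDiff_one_of_hasDerivAt hβd (by fun_prop)
  have hdβ : deriv β = fun z => 3 * max z 0 ^ 2 := funext fun z => (hβd z).deriv
  have hVsl : ∀ᵐ t : ℝ, 0 < t → ∀ᵐ x : ℝ, V (t, x) = v (t, x) := by
    filter_upwards [ae_slice_snd hV] with t ht h0
    filter_upwards [ht] with x hx using hx h0
  have hstep : ∀ s, 0 < s → s < T → ∀ᵐ x : ℝ, V (s, x) ≤ m s := by
    intro s hs hsT
    -- V agrees with v only almost everywhere at positive times, so the bound at time 0 is a limit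
    -- along good times, using continuity of V in t.
    have hV0 : ∀ᵐ x : ℝ, V (0, x) ≤ K := by
      filter_upwards [ae_slice_fst hV, hVt] with x hx hp
      have hc := (hp s hs.le).continuousOn
      rw [uIcc_of_le hs.le] at hc
      refine le_of_tendsto (tendsto_aeRight_of_continuousOn hs hc)
        (eventually_aeRight (T := T) le_rfl (hs.trans hsT) ?_)
      filter_upwards [hx, hb] with t hx hb h0 h1
      rw [hx h0]
      exact (le_abs_self _).trans (hb h0 h1 x)
    have hz : ∀ᵐ x : ℝ, PrimOn (fun t => V (t, x) - m t) (fun t => b (t, x) - -(m t) ^ 2) 0 s :=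
      hVt.mono fun x hx => (hx s hs.le).sub (primOn_inv_add (by positivity) hs.le)
    have hvb : ∀ᵐ p ∂stripM s, p.1 ∈ Ioo 0 s ∧ |v p| ≤ K :=
      ae_stripM_of_slice (hb.mono fun t ht h0 h1 => ht h0 (h1.trans hsT))
    have hVv : ∀ᵐ p ∂stripM s, V p = v p := ae_stripM hV
    have hVL : MemLp V 2 (stripM s) := (memLp_congr_ae hVv).2 (h.memLp_v s)
    have hmc : AEStronglyMeasurable (fun p : ℝ × ℝ => m p.1) (stripM s) := by
      have : Measurable m := by fun_prop
      exact (this.comp measurable_fst).aestronglyMeasurable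
    have hpm : AEStronglyMeasurable (fun p => max (V p - m p.1) 0) (stripM s) :=
      (continuous_id.max continuous_const).comp_aestronglyMeasurable (hVL.1.sub hmc)
    have hpb : ∀ᵐ p ∂stripM s, ‖max (V p - m p.1) 0‖ ≤ K ∧ ‖max (V p - m p.1) 0‖ ≤ ‖V p‖ := by
      filter_upwards [hvb, hVv] with p hp he
      have := pos_le_abs (hmpos _ hp.1.1.le).le (V p)
      rw [Real.norm_of_nonneg (le_max_right _ _)]
      exact ⟨this.trans (he ▸ hp.2), this⟩
    have hpL : MemLp (fun p => max (V p - m p.1) 0) 2 (stripM s) :=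
      hVL.of_le hpm (hpb.mono fun p hp => hp.2)
    have hppL : MemLp (fun p => max (V p - m p.1) 0 * max (V p - m p.1) 0) 2 (stripM s) :=
      hpL.of_le_mul (c := K) (hpm.mul hpm) (hpb.mono fun p hp => by rw [norm_mul]; gcongr; exact hp.1)
    have hi : Integrable (fun p => deriv β (V p - m p.1) * (b p - -(m p.1) ^ 2)) (stripM s) := by
      have i1 := hppL.integrable_mul (h.memLp_b s)
      have i2 : Integrable (fun p => m p.1 ^ 2 * max (V p - m p.1) 0 ^ 2) (stripM s) := by
        refine hpL.integrable_sq.bdd_mul (c := K ^ 2) (hmc.pow 2) ?_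
        filter_upwards [hvb] with p hp
        rw [norm_pow, Real.norm_of_nonneg (hmpos _ hp.1.1.le).le]
        exact pow_le_pow_left₀ (hmpos _ hp.1.1.le).le (hmK _ hp.1.1.le) 2
      refine ((i1.add i2).const_mul 3).congr (.of_forall fun p => ?_)
      simp only [hdβ, Pi.add_apply, Pi.mul_apply]
      ring
    have hz0 : (fun x => β (V (0, x) - m 0)) =ᵐ[volume] fun _ => 0 := by
      filter_upwards [hV0] with x hx
      simp [hβ, hm0, max_eq_right (sub_nonpos.2 hx)]
    obtain ⟨hI, hE⟩ := energy_balance (z := fun p => V p - m p.1)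
      (g := fun p => b p - -(m p.1) ^ 2) hβ1 hs.le hz hi
      ((integrable_congr hz0).2 (integrable_zero _ _ _))
    have hle : ∫ t in Ioo 0 s, ∫ x, deriv β (V (t, x) - m t) * (b (t, x) - -(m t) ^ 2) ≤ 0 := by
      refine integral_nonpos_of_ae ?_
      have := ae_Ioo_of_ae_pos (T := s)
        (p := fun t => ∫ x, deriv β (V (t, x) - m t) * (b (t, x) - -(m t) ^ 2) ≤ 0) ?_
      · exact this
      filter_upwards [memLp_slice h.memLp_u, memLp_slice h.memLp_v, memLp_slice h.memLp_a,
        memLp_slice h.memLp_w, memLp_slice h.memLp_b, h.prim_u, h.prim_v, h.prim_w, h.prim_flux,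
        hVsl] with t mu mv ma mw mb pu pv pw pf hVs h0
      refine le_trans (le_of_eq ?_) (integral_pos_sq_mul_nonpos hε (mu h0) (mv h0) (ma h0) (mw h0)
        (mb h0) (pu h0) (pv h0) (pw h0) (pf h0) (hmpos t h0.le).le)
      refine integral_congr_ae ?_
      filter_upwards [hVs h0] with x hx
      rw [hdβ, hx]; ring
    have h0 : ∫ x, β (V (s, x) - m s) ≤ 0 := by
      rw [hE, integral_congr_ae hz0]; simpa using hle
    filter_upwards [eq_zero_of_integral_nonpos hI (fun x => by positivity) h0] with x hx
    by_contra hlt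
    have : 0 < max (V (s, x) - m s) 0 ^ 3 := pow_pos (lt_max_of_lt_left (by linarith)) 3
    simp only [hβ] at hx; linarith
  filter_upwards [hVsl, h.prim_v] with s hVs pv h0 h1 x
  have hc := (pv h0).continuous
  have hle : ∀ᵐ x : ℝ, v (s, x) ≤ m s := by
    filter_upwards [hVs h0, hstep s h0 h1] with x e l
    rwa [← e]
  -- An almost everywhere inequality between continuous functions is upgraded to every x by writing
  -- it as an equality of continuous functions.
  have he : (fun x => max (v (s, x)) (m s)) = fun _ => m s :=
    (Continuous.ae_eq_iff_eq volume (hc.max continuous_const) continuous_const).1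
      (hle.mono fun x hx => max_eq_right hx)
  exact max_eq_right_iff.1 (congrFun he x)

/-- Oleinik's one-sided Lipschitz condition. -/
theorem Regular.oleinik (hε : 0 < ε) (h : Regular ε u v a w b) {t : ℝ} (ht : 0 < t) :
    ContDiff ℝ 1 (fun x => u (t, x)) ∧ ∀ x, deriv (fun y => u (t, y)) x < 1 / t := by
  obtain ⟨g, hg, hd, hl⟩ := h.exists_deriv ht.le
  refine ⟨contDiff_one_of_hasDerivAt hd hg, fun x => ?_⟩
  obtain ⟨K, hK, hb⟩ := h.exists_sup_bound (t + 1)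
  have h1 := h.deriv_le_of_bound hε hK (hb.mono fun s hs h0 h1 x => (hs h0 h1 x).2)
  have h2 : ∀ᶠ s in aeRight t, v (s, x) ≤ 1 / (s + 1 / K) :=
    eventually_aeRight ht.le (lt_add_one t) (h1.mono fun s hs h0 h1 => hs h0 h1 x)
  have hKp : 0 < 1 / K := by positivity
  have h3 : ContinuousOn (fun s => 1 / (s + 1 / K)) (Icc t (t + 1)) :=
    continuousOn_const.div (continuousOn_id.add continuousOn_const) fun s hs =>
      (add_pos (ht.trans_le hs.1) hKp).ne'
  rw [(hd x).deriv]
  refine (le_of_tendsto_of_tendsto (hl x)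
    (tendsto_aeRight_of_continuousOn (lt_add_one t) h3) h2).trans_lt ?_
  exact one_div_lt_one_div_of_lt ht (by linarith)

end

/-! ### Identification of the data and bounds for the nonlinear terms -/

section

theorem HasWeakDerivLine.exists_prim {f g : ℝ → ℝ} (h : HasWeakDerivLine f g) :
    ∃ F : ℝ → ℝ, f =ᵐ[volume] F ∧ Prim F g := by
  obtain ⟨c, hc⟩ := hasWeakDerivLine_primitive h
  exact ⟨_, hc, Prim.of_eq_integral (locallyIntegrableOn_univ.1 h.2.1) 0 c fun _ => rfl⟩

theorem HasWeakDerivLine.prim {f g F : ℝ → ℝ} (h : HasWeakDerivLine f g) (hF : Continuous F)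
    (he : f =ᵐ[volume] F) : Prim F g := by
  obtain ⟨G, hG, hp⟩ := HasWeakDerivLine.exists_prim h
  have : F = G := (Continuous.ae_eq_iff_eq volume hF hp.continuous).1 (he.symm.trans hG)
  exact this ▸ hp

theorem deriv_flux_le {ε : ℝ} (hε : 0 < ε) (p : ℝ) : deriv (flux ε) p ≤ 1 / ε + ε := by
  have h : HasDerivAt (flux ε) (absReg'' ε p + ε * 1) p :=
    (hasDerivAt_stress hε p).add ((hasDerivAt_id p).const_mul ε)
  rw [h.deriv, mul_one]
  exact add_le_add_left (absReg''_le hε p) ε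

theorem prim_sq_div_two {F f : ℝ → ℝ} (h : Prim F f) :
    Prim (fun x => F x ^ 2 / 2) (fun x => F x * f x) := by
  have := h.comp' (β := fun s => s ^ 2 / 2) (β' := fun s => s)
    (fun z => ((hasDerivAt_pow 2 z).div_const 2).congr_deriv (by norm_num)) continuous_id
  exact this

/-- The derivative of the total flux of an `H²` function is square integrable. -/
theorem memLp_deriv_flux_sub {ε : ℝ} (hε : 0 < ε) {f d e q : ℝ → ℝ} (hf : MemLp f 2)
    (hd : MemLp d 2) (he : MemLp e 2) (p : Prim f d) (pd : Prim d e)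
    (pq : Prim (fun x => flux ε (d x) - f x ^ 2 / 2) q) : MemLp q 2 := by
  have p1 := (pd.comp (contDiff_flux hε)).sub (prim_sq_div_two p)
  obtain ⟨K, hK, hb⟩ := p.exists_bound hf hd
  have hc : Continuous fun x => deriv (flux ε) (d x) :=
    (contDiff_one_iff_deriv.1 (contDiff_flux hε)).2.comp pd.continuous
  have m1 : MemLp (fun x => deriv (flux ε) (d x) * e x) 2 :=
    memLp_mul_bdd hc (fun x => by
      rw [abs_of_nonneg (deriv_flux_nonneg hε _)]; exact deriv_flux_le hε _) he
  exact (memLp_congr_ae (p1.ae_unique pq)).1 (m1.sub (memLp_mul_bdd p.continuous hb hd))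

/-- A solution is regular and attains its datum. -/
theorem IsSolution.exists_regular_initial {ε : ℝ} (hε : 0 < ε) {uin : ℝ → ℝ} {u : ℝ × ℝ → ℝ}
    (hin : MemH2 uin) (hu : IsSolution ε uin u) :
    ∃ v a w b : ℝ × ℝ → ℝ, Regular ε u v a w b ∧ HasWeakDx u v ∧ HasWeakDt u w ∧
      uin =ᵐ[volume] fun x => u (0, x) := by
  obtain ⟨v, a, w, b, h, huv, huw, hW⟩ := hu.exists_regular hε
  obtain ⟨f₁, f₂, h1, -⟩ := hin
  exact ⟨v, a, w, b, h, huv, huw, h.initial hε (locallyIntegrableOn_univ.1 h1.1) hW⟩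

variable {ε : ℝ} {u v a w b : ℝ × ℝ → ℝ} {uin : ℝ → ℝ}

theorem Regular.prim_initial (h : Regular ε u v a w b) (he : uin =ᵐ[volume] fun x => u (0, x))
    {d : ℝ → ℝ} (hd : HasWeakDerivLine uin d) : Prim (fun x => u (0, x)) d :=
  HasWeakDerivLine.prim hd (continuous_slice h.cont le_rfl) he

theorem Regular.lintegral_time_deriv_le_of_initial (hε : 0 < ε) (h : Regular ε u v a w b)
    (hin : MemH2 uin) (he : uin =ᵐ[volume] fun x => u (0, x)) {C : ℝ} (hC : 0 ≤ C) {q : ℝ → ℝ}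
    (hq : IsInitialTimeDeriv ε uin q) (hqC : eLpNorm q 1 volume ≤ ENNReal.ofReal C) :
    ∀ᵐ t : ℝ, 0 < t → ∫⁻ x, ‖w (t, x)‖ₑ ≤ ENNReal.ofReal C := by
  obtain ⟨f₁, f₂, h1, h2, m0, m1, m2⟩ := hin
  obtain ⟨D, hD, pD⟩ := HasWeakDerivLine.exists_prim h2
  obtain ⟨d, hd, hw⟩ := hq
  have p1 := h.prim_initial he h1
  have pd := h.prim_initial he hd
  have p : Prim (fun x => u (0, x)) D := p1.congr_ae hD
  have hdD : d =ᵐ[volume] D := pd.ae_unique p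
  have hu0 : MemLp (fun x => u (0, x)) 2 := (memLp_congr_ae he).1 m0
  have mD : MemLp D 2 := (memLp_congr_ae hD).1 m1
  have pq : Prim (fun x => flux ε (D x) - u (0, x) ^ 2 / 2) q := by
    refine HasWeakDerivLine.prim hw (((contDiff_flux hε).continuous.comp pD.continuous).sub
      ((p.continuous.pow 2).div_const 2)) ?_
    filter_upwards [he, hdD] with x hx hy
    rw [hx, hy, flux]; ring
  exact h.lintegral_time_deriv_le hε hC hu0 mD (memLp_deriv_flux_sub hε hu0 mD m2 p pD pq) p pq
    (by rwa [← eLpNorm_one_eq_lintegral_enorm])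

theorem Regular.abs_le (hε : 0 < ε) (h : Regular ε u v a w b)
    (he : uin =ᵐ[volume] fun x => u (0, x)) {lo hi : ℝ}
    (hb : ∀ᵐ x : ℝ, lo ≤ uin x ∧ uin x ≤ hi) {t : ℝ} (ht : 0 ≤ t) (x : ℝ) :
    |u (t, x)| ≤ max |lo| |hi| := by
  refine h.abs_le_of_initial hε (fun y => ?_) ht x
  have hc := continuous_slice h.cont le_rfl
  have h1 : (fun y => max |u (0, y)| (max |lo| |hi|)) = fun _ => max |lo| |hi| :=
    (Continuous.ae_eq_iff_eq volume (hc.abs.max continuous_const) continuous_const).1 (by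
      filter_upwards [he, hb] with y e hy
      rw [← e]
      exact max_eq_right (abs_le_max_abs_abs hy.1 hy.2))
  exact max_eq_right_iff.1 (congrFun h1 y)

theorem Regular.hasWeakDx_sq (h : Regular ε u v a w b) :
    HasWeakDx (fun z => u z ^ 2 / 2) (fun z => u z * v z) := by
  refine hasWeakDx_of_prim
    (locallyIntegrable_ext0_of_integrable fun T => (h.memLp_u T).integrable_sq.div_const 2)
    (locallyIntegrable_ext0_of_integrable fun T => (h.memLp_u T).integrable_mul (h.memLp_v T)) ?_
  filter_upwards [h.prim_u] with t p h0 using prim_sq_div_two (p h0)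

theorem Regular.hasWeakDx_flux (hε : 0 < ε) (h : Regular ε u v a w b) :
    HasWeakDx (fun z => flux ε (v z)) (fun z => w z + u z * v z) := by
  refine hasWeakDx_of_prim (locallyIntegrable_ext0 fun T => memLp_flux hε (h.memLp_v T)) ?_ ?_
  · refine ((locallyIntegrable_ext0 h.memLp_w).add (locallyIntegrable_ext0_of_integrable fun T =>
      (h.memLp_u T).integrable_mul (h.memLp_v T))).congr (.of_forall fun z => ?_)
    by_cases hz : z ∈ halfPlane <;> simp [ext0, hz]
  · filter_upwards [h.prim_u, h.prim_flux] with t p pf h0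
    simpa using (pf h0).add (prim_sq_div_two (p h0))

theorem Regular.lintegral_flux_deriv_le (hε : 0 < ε) (h : Regular ε u v a w b) {C : ℝ}
    (hC : 0 ≤ C) (hw : ∀ᵐ t : ℝ, 0 < t → ∫⁻ x, ‖w (t, x)‖ₑ ≤ ENNReal.ofReal C) :
    ∀ᵐ t : ℝ, 0 < t → ∫⁻ x, ‖w (t, x) + u (t, x) * v (t, x)‖ₑ ≤ ENNReal.ofReal (3 * C) := by
  filter_upwards [hw, memLp_slice h.memLp_u, memLp_slice h.memLp_v, memLp_slice h.memLp_w,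
    h.prim_u, h.prim_v, h.prim_flux] with t hw mu mv mw pu pv pf h0
  have iw : Integrable fun x => w (t, x) := ⟨(mw h0).1, (hw h0).trans_lt ENNReal.ofReal_lt_top⟩
  have iuv : Integrable fun x => u (t, x) * v (t, x) := (mu h0).integrable_mul (mv h0)
  have h1 := integral_abs_mul_le hε (mu h0) (mv h0) iw (pu h0) (pf h0) (pv h0).continuous
  have h2 : ∫ x, |w (t, x)| ≤ C := by
    rw [← ENNReal.ofReal_le_ofReal_iff hC]
    refine le_trans (le_of_eq ?_) (hw h0)
    exact ofReal_integral_norm_eq_lintegral_enorm iw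
  have h3 : ∫⁻ x, ‖w (t, x) + u (t, x) * v (t, x)‖ₑ =
      ENNReal.ofReal (∫ x, |w (t, x) + u (t, x) * v (t, x)|) :=
    (ofReal_integral_norm_eq_lintegral_enorm (iw.add iuv)).symm
  rw [h3]
  refine ENNReal.ofReal_le_ofReal ?_
  have h4 : ∫ x, |w (t, x) + u (t, x) * v (t, x)| ≤
      (∫ x, |w (t, x)|) + ∫ x, |u (t, x) * v (t, x)| := by
    rw [← integral_add iw.abs iuv.abs]
    exact integral_mono (iw.add iuv).abs (iw.abs.add iuv.abs) fun x => abs_add_le _ _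
  linarith

end

end Viscoplastic

end

/-! ### The theorem -/

theorem proposition2p4
    (E : Set ℝ) (hE : ∀ ε ∈ E, 0 < ε)
    (uin : E → ℝ → ℝ) (u : E → ℝ × ℝ → ℝ)
    (hH2 : ∀ ε : E, Viscoplastic.MemH2 (uin ε))
    (c : ℝ) (hc : ∀ ε : E, (1 / 2 : ℝ) * ∫ x, uin ε x ^ 2 ≤ c)
    (hu : ∀ ε : E, Viscoplastic.IsSolution ε (uin ε) (u ε)) :
    -- maximum principle and `L¹` bound
    (∀ lo hi : ℝ, lo ≤ hi → Viscoplastic.DataBounds uin lo hi →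
      ∀ ε : E,
        Viscoplastic.mixedNorm ⊤ ⊤ (Ioi 0) (u ε) ≤ ENNReal.ofReal (max |lo| |hi|) ∧
        Viscoplastic.mixedNorm ⊤ 1 (Ioi 0) (u ε) ≤ eLpNorm (uin ε) 1 volume) ∧
    -- `L¹` bound for `∂_x u`; the right-hand side may be infinite
    (∀ ε : E, ∀ d : ℝ → ℝ, Viscoplastic.HasWeakDerivLine (uin ε) d →
      ∃ ux : ℝ × ℝ → ℝ, Viscoplastic.HasWeakDx (u ε) ux ∧
        Viscoplastic.mixedNorm ⊤ 1 (Ioi 0) ux ≤ eLpNorm d 1 volume) ∧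
    -- Oleinik's condition
    (∀ ε : E, ∀ t : ℝ, 0 < t →
      ContDiff ℝ 1 (fun x : ℝ => u ε (t, x)) ∧
        ∀ x : ℝ, deriv (fun y : ℝ => u ε (t, y)) x < 1 / t) ∧
    -- `L¹` bound for `∂_t u`
    (∀ C : ℝ, 0 < C → Viscoplastic.DataTimeDerivBound uin C →
      ∀ ε : E, ∃ ut : ℝ × ℝ → ℝ, Viscoplastic.HasWeakDt (u ε) ut ∧
        Viscoplastic.mixedNorm ⊤ 1 (Ioi 0) ut ≤ ENNReal.ofReal C) ∧
    -- `L¹` bound for `∂_x (u²/2)`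
    (∀ lo hi K : ℝ, lo ≤ hi → Viscoplastic.DataBounds uin lo hi →
      Viscoplastic.DataTotalVarBound uin K →
      ∃ C : ℝ, 0 < C ∧ ∀ ε : E, ∃ g : ℝ × ℝ → ℝ,
        Viscoplastic.HasWeakDx (fun z => u ε z ^ 2 / 2) g ∧
        Viscoplastic.mixedNorm ⊤ 1 (Ioi 0) g ≤ ENNReal.ofReal C) ∧
    -- `L¹` bound for `∂_x (R + ε ∂_x u)`
    (∀ lo hi C₀ : ℝ, lo ≤ hi → 0 < C₀ → Viscoplastic.DataBounds uin lo hi →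
      Viscoplastic.DataTimeDerivBound uin C₀ →
      ∃ C : ℝ, 0 < C ∧ ∀ ε : E, ∃ ux g : ℝ × ℝ → ℝ,
        Viscoplastic.HasWeakDx (u ε) ux ∧
        Viscoplastic.HasWeakDx (fun z => Viscoplastic.stress ε (ux z) + (ε : ℝ) * ux z) g ∧
        Viscoplastic.mixedNorm ⊤ 1 (Ioi 0) g ≤ ENNReal.ofReal C) := by
  have hpos : ∀ ε : E, 0 < (ε : ℝ) := fun ε => hE ε ε.2
  choose v a w b h huv huw he using fun ε : E => (hu ε).exists_regular_initial (hpos ε) (hH2 ε)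
  refine ⟨fun lo hi _ hB ε => ⟨?_, ?_⟩, fun ε d hd => ⟨v ε, huv ε, ?_⟩,
    fun ε t ht => (h ε).oleinik (hpos ε) ht, fun C hC hq ε => ⟨w ε, huw ε, ?_⟩,
    -- The bound is the product of the sup bound for u and the L¹ bound for v. The sign of K is not
    -- prescribed, hence |K|, and 1 is added only to make the constant positive.
    fun lo hi K _ hB hK => ⟨max |lo| |hi| * |K| + 1, by positivity, fun ε =>
      ⟨_, (h ε).hasWeakDx_sq, ?_⟩⟩,
    -- In ∂_x flux(v) = w + uv the first term contributes C₀ and the second at most 2C₀.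
    fun lo hi C₀ _ hC hB hq => ⟨3 * C₀, by positivity, fun ε =>
      ⟨v ε, _, huv ε, (h ε).hasWeakDx_flux (hpos ε), ?_⟩⟩⟩
  · refine Viscoplastic.mixedNorm_top_le (.of_forall fun t ht => ?_)
    rw [eLpNorm_exponent_top]
    refine essSup_le_of_ae_le _ (.of_forall fun x => ?_)
    simp only [Real.enorm_eq_ofReal_abs]
    exact ENNReal.ofReal_le_ofReal ((h ε).abs_le (hpos ε) (he ε) (hB ε).2 ht.le x)
  · refine Viscoplastic.mixedNorm_top_le (.of_forall fun t ht => ?_)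
    rw [eLpNorm_congr_ae (he ε), eLpNorm_one_eq_lintegral_enorm, eLpNorm_one_eq_lintegral_enorm]
    exact (h ε).lintegral_le (hpos ε) ht.le
  · refine Viscoplastic.mixedNorm_top_le ?_
    simp only [eLpNorm_one_eq_lintegral_enorm]
    exact (h ε).lintegral_deriv_le (hpos ε) ((h ε).prim_initial (he ε) hd)
  · refine Viscoplastic.mixedNorm_top_le ?_
    obtain ⟨q, hq, hqC⟩ := hq ε
    simp only [eLpNorm_one_eq_lintegral_enorm]
    exact (h ε).lintegral_time_deriv_le_of_initial (hpos ε) (hH2 ε) (he ε) hC.le hq hqC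
  · refine Viscoplastic.mixedNorm_top_le ?_
    obtain ⟨d, hd, hdK⟩ := hK ε
    simp only [eLpNorm_one_eq_lintegral_enorm] at hdK ⊢
    filter_upwards [(h ε).lintegral_deriv_le (hpos ε) ((h ε).prim_initial (he ε) hd)] with t hv ht
    calc ∫⁻ x, ‖u ε (t, x) * v ε (t, x)‖ₑ
        ≤ ∫⁻ x, ENNReal.ofReal (max |lo| |hi|) * ‖v ε (t, x)‖ₑ := by
          refine lintegral_mono fun x => ?_
          rw [enorm_mul, Real.enorm_eq_ofReal_abs (u ε (t, x))]
          gcongr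
          exact (h ε).abs_le (hpos ε) (he ε) (hB ε).2 ht.le x
      _ = ENNReal.ofReal (max |lo| |hi|) * ∫⁻ x, ‖v ε (t, x)‖ₑ :=
          lintegral_const_mul' _ _ ENNReal.ofReal_ne_top
      _ ≤ ENNReal.ofReal (max |lo| |hi|) * ENNReal.ofReal |K| := by
          gcongr
          exact ((hv ht).trans hdK).trans (ENNReal.ofReal_le_ofReal (le_abs_self K))
      _ ≤ ENNReal.ofReal (max |lo| |hi| * |K| + 1) := by
          rw [← ENNReal.ofReal_mul (by positivity)]
          exact ENNReal.ofReal_le_ofReal (by linarith)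
  · refine Viscoplastic.mixedNorm_top_le ?_
    obtain ⟨q, hq, hqC⟩ := hq ε
    simp only [eLpNorm_one_eq_lintegral_enorm]
    exact (h ε).lintegral_flux_deriv_le (hpos ε) hC.le
      ((h ε).lintegral_time_deriv_le_of_initial (hpos ε) (hH2 ε) (he ε) hC.le hq hqC)
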